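/- **Setting.** Let $L\ge 1$, $d_1,\dots,d_L\ge 1$, $p=\prod_k d_k$, $m_k=\prod_{i\ne k}d_i=p/d_k$, $d_{\max}=\max_k d_k$, $m_{\min}=\min_k m_k$. Write $\|\cdot\|_2$ and $\|\cdot\|_F$ for the operator and Frobenius norms, $\phi_{\min},\phi_{\max}$ for the extreme eigenvalues of a symmetric matrix, and $\kappa=\phi_{\max}/\phi_{\min}$ for the condition number of a positive definite matrix. Let $\Psi_k\in\mathbb R^{d_k\times d_k}$ be symmetric, let $$\Omega_0=\Psi_1\oplus\cdots\oplus\Psi_L=\sum_{k=1}^L I_{d_1}\otimes\cdots\otimes I_{d_{k-1}}\otimes\Psi_k\otimes I_{d_{k+1}}\otimes\cdots\otimes I_{d_L}$$ be their Kronecker sum, $\Sigma_0=\Omega_0^{-1}$, $s_k=|\{(i,j): i\ne j,\ \Psi_{k,ij}\neq 0\}|$ and $s=\sum_k m_ks_k$. One random tensor $\mathscr X\in\mathbb R^{d_1\times\cdots\times d_L}$ is observed ($n=1$), with $\mathrm{vec}(\mathscr X)=\Sigma_0^{1/2}Z$, where $Z\in\mathbb R^p$ has independent components with $\mathbb E Z_j=0$,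 $\mathbb E Z_j^2=1$ and $\|Z_j\|_{\psi_2}=\inf\{t>0:\mathbb E\exp(Z_j^2/t^2)\le 2\}\le K$. Let $\mathbf X^{(k)}\in\mathbb R^{d_k\times m_k}$ be the mode-$k$ unfolding of $\mathscr X$ (its columns are the mode-$k$ fibers), and let $S^k=\mathbf X^{(k)}\mathbf X^{(k)T}/m_k$. The TeraLasso estimator $\hat\Omega$ is a minimizer, over all positive definite $\Omega=B_1\oplus\cdots\oplus B_L$ with $B_k\in\mathbb R^{d_k\times d_k}$, of $$-\log|\Omega|+\sum_{k=1}^L m_k\Big(\langle S^k,B_k\rangle+\rho_k\sum_{i\ne j}|B_{k,ij}|\Big).$$ **Assumptions** (with constants $a_1,a_2,\varepsilon_0,C_3$). - (A1) $m_{\min}\ge\log p$, and $\rho_k=\delta_k/\varepsilon_k$ for all $k$, where $a_1\|\Sigma_0\|_2\sqrt{\log p/m_k}\le\delta_k\le a_2\|\Sigma_0\|_2\sqrt{\log p/m_k}$ and $\varepsilon_0\le\varepsilon_k<1$. - (A2) $0<\underline k_\Omega\le\phi_{\min}(\Omega_0)$ and $\phi_{\max}(\Omega_0)\le\overline k_\Omega<\infty$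 for some $\underline k_\Omega,\overline k_\Omega$. - (A3) $m_{\min}^2\ge C_3^2(L+1)\,\kappa(\Sigma_0)^4\,(s\log p+Lp)$. **Corollary (dependence on aspect ratio for $n=1$).** For every $K>0$ there are constants $a_1,c>0$, depending only on $K$, such that for all $a_2\ge a_1$ and $\varepsilon_0\in(0,1)$ there are constants $C_3,C>0$, depending only on $K,a_2,\varepsilon_0$, with the following property. In the setting above, if (A1), (A2) and (A3) hold, then with probability at least $1-L\exp(-c\log p)$ a minimizer $\hat\Omega$ exists and every minimizer satisfies $$\frac{\|\hat\Omega-\Omega_0\|_2}{\|\Omega_0\|_2}\vee\frac{\|\hat\Omega-\Omega_0\|_F}{\|\Omega_0\|_F}\le C\,\kappa(\Sigma_0)\Big(\frac{L\,d_{\max}}{m_{\min}}\Big)^{1/2}\Big(\sum_{k=1}^L\frac{s_k\log p}{d_k}+L\Big)^{1/2}.$$ -/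

import Mathlib

open MeasureTheory ProbabilityTheory

noncomputable section

namespace TeraLasso

/-! ### Matrix quantities -/

section MatrixQuantities

variable {ι : Type*} [Fintype ι] [DecidableEq ι]

/-- Smallest eigenvalue of a symmetric real matrix. -/
def phiMin (A : Matrix ι ι ℝ) : ℝ := sInf (spectrum ℝ A)

/-- Largest eigenvalue of a symmetric real matrix. -/
def phiMax (A : Matrix ι ι ℝ) : ℝ := sSup (spectrum ℝ A)

/-- Condition number of a positive definite matrix. -/
def kappa (A : Matrix ι ι ℝ) : ℝ := phiMax A / phiMin A

/-- Operator norm with respect to the Euclidean norm. -/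
def opNorm (A : Matrix ι ι ℝ) : ℝ := ‖Matrix.toEuclideanCLM (𝕜 := ℝ) A‖

/-- Frobenius norm. -/
def frobNorm (A : Matrix ι ι ℝ) : ℝ := √(∑ i, ∑ j, A i j ^ 2)

/-- Off-diagonal `ℓ₁` norm. -/
def offOne (A : Matrix ι ι ℝ) : ℝ := ∑ i, ∑ j, if i = j then 0 else |A i j|

/-- Number of non-zero off-diagonal entries. -/
def offSupp (A : Matrix ι ι ℝ) : ℕ := {ij : ι × ι | ij.1 ≠ ij.2 ∧ A ij.1 ij.2 ≠ 0}.ncard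

end MatrixQuantities

/-! ### Tensors of size `d 0 × ⋯ × d (L - 1)`

Entries of a tensor, and rows and columns of a `p × p` matrix, are indexed by multi-indices. -/

section Tensors

variable {L : ℕ}

/-- Multi-indices of a tensor with dimensions `d`; there are `p = ∏ k, d k` of them. -/
abbrev Idx (d : Fin L → ℕ) : Type := (k : Fin L) → Fin (d k)

/-- `p = ∏ k, d k`. -/
def pdim (d : Fin L → ℕ) : ℕ := ∏ k, d k

/-- `m k = ∏_{i ≠ k} d i`. -/
def mdim (d : Fin L → ℕ) (k : Fin L) : ℕ := ∏ i ∈ Finset.univ.erase k, d i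

def dmax (d : Fin L → ℕ) : ℕ := ⨆ k, d k

def mmin (d : Fin L → ℕ) : ℕ := ⨅ k, mdim d k

variable {d : Fin L → ℕ}

/-- Kronecker product `A 0 ⊗ ⋯ ⊗ A (L - 1)`. -/
def kronProd (A : (k : Fin L) → Matrix (Fin (d k)) (Fin (d k)) ℝ) : Matrix (Idx d) (Idx d) ℝ :=
  Matrix.of fun i j => ∏ k, A k (i k) (j k)

/-- Kronecker sum `B 0 ⊕ ⋯ ⊕ B (L - 1) = ∑ k, I ⊗ ⋯ ⊗ I ⊗ B k ⊗ I ⊗ ⋯ ⊗ I`. -/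
def kronSum (B : (k : Fin L) → Matrix (Fin (d k)) (Fin (d k)) ℝ) : Matrix (Idx d) (Idx d) ℝ :=
  ∑ k, kronProd (Function.update (fun _ => 1) k (B k))

/-- Mode-`k` unfolding: a `d k × m k` matrix whose columns are the mode-`k` fibers. -/
def unfolding (x : Idx d → ℝ) (k : Fin L) :
    Matrix (Fin (d k)) ((l : {l : Fin L // l ≠ k}) → Fin (d l)) ℝ :=
  Matrix.of fun a c => x ((Equiv.piSplitAt k fun l => Fin (d l)).symm (a, c))

/-- Mode-`k` Gram matrix of a single tensor. -/
def gram (x : Idx d → ℝ) (k : Fin L) : Matrix (Fin (d k)) (Fin (d k)) ℝ :=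
  (mdim d k : ℝ)⁻¹ • (unfolding x k * (unfolding x k).transpose)

/-- The penalized objective, as a function of the components of `Ω = B 0 ⊕ ⋯ ⊕ B (L - 1)`.
Its value depends on `Ω` only. -/
def objective (x : Idx d → ℝ) (ρ : Fin L → ℝ)
    (B : (k : Fin L) → Matrix (Fin (d k)) (Fin (d k)) ℝ) : ℝ :=
  -Real.log (kronSum B).det +
    ∑ k, (mdim d k : ℝ) * (((gram x k).transpose * B k).trace + ρ k * offOne (B k))

/-- `Ωhat` minimizes the objective over the positive definite Kronecker sums. -/
def IsTeraLasso (x : Idx d → ℝ) (ρ : Fin L → ℝ) (Ωhat : Matrix (Idx d) (Idx d) ℝ) : Prop :=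
  ∃ B : (k : Fin L) → Matrix (Fin (d k)) (Fin (d k)) ℝ,
    Ωhat = kronSum B ∧ (kronSum B).PosDef ∧
      ∀ B' : (k : Fin L) → Matrix (Fin (d k)) (Fin (d k)) ℝ,
        (kronSum B').PosDef → objective x ρ B ≤ objective x ρ B'

end Tensors

/-! ### The sub-gaussian model -/

section Model

variable {S : Type*} [MeasurableSpace S]

/-- The `ψ₂` norm `inf {t > 0 : E exp (Z² / t²) ≤ 2}`, equal to `⊤` if there is no such `t`. -/
def psi2Norm (μ : Measure S) (Z : S → ℝ) : ENNReal :=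
  ⨅ (t : ℝ) (_ : 0 < t) (_ : ∫⁻ ω, ENNReal.ofReal (Real.exp (Z ω ^ 2 / t ^ 2)) ∂μ ≤ 2),
    ENNReal.ofReal t

open scoped MatrixOrder in
/-- `vec X = Σ₀^{1/2} Z`, where the entries of `Z` are independent with mean zero, unit variance
and `ψ₂` norm at most `K`. -/
def IsSubgaussianTensor {ι : Type*} [Fintype ι] [DecidableEq ι] (μ : Measure S) (K : ℝ)
    (Sig0 : Matrix ι ι ℝ) (X : S → ι → ℝ) : Prop :=
  ∃ Z : ι → S → ℝ,
    (∀ i, Measurable (Z i)) ∧ iIndepFun Z μ ∧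
    (∀ i, ∫ ω, Z i ω ∂μ = 0) ∧ (∀ i, ∫ ω, Z i ω ^ 2 ∂μ = 1) ∧
    (∀ i, psi2Norm μ (Z i) ≤ ENNReal.ofReal K) ∧
    ∀ᵐ ω ∂μ, X ω = (CFC.sqrt Sig0).mulVec fun i => Z i ω

end Model

/-! ### The assumptions, for sample size `n = 1` -/

section Assumptions

variable {L : ℕ} {d : Fin L → ℕ}

/-- `min_k m k ≥ log p`, `δ k ≍ ‖Σ₀‖₂ √(log p / m k)` with constants `a₁, a₂`, and
`ρ k = δ k / ε k` with `0 < ε k < 1`, the `ε k` being at least `ε₀`. -/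
def A1 (a₁ a₂ ε₀ : ℝ) (Sig0 : Matrix (Idx d) (Idx d) ℝ) (ρ : Fin L → ℝ) : Prop :=
  Real.log (pdim d) ≤ mmin d ∧
  ∃ δ ε : Fin L → ℝ, ∀ k,
    a₁ * (opNorm Sig0 * √(Real.log (pdim d) / mdim d k)) ≤ δ k ∧
    δ k ≤ a₂ * (opNorm Sig0 * √(Real.log (pdim d) / mdim d k)) ∧
    0 < ε k ∧ ε k < 1 ∧ ε₀ ≤ ε k ∧
    ρ k = δ k / ε k

/-- Positive lower and finite upper bounds on the eigenvalues of `Ω₀`. -/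
def A2 (kLow kUp : ℝ) (Omega0 : Matrix (Idx d) (Idx d) ℝ) : Prop :=
  0 < kLow ∧ kLow ≤ phiMin Omega0 ∧ phiMax Omega0 ≤ kUp

/-- `(m_min)² ≥ C² (L + 1) κ(Σ₀)⁴ (s log p + L p)` with `s = ∑ k, m k * s k`. -/
def A3 (C : ℝ) (Psi : (k : Fin L) → Matrix (Fin (d k)) (Fin (d k)) ℝ)
    (Sig0 : Matrix (Idx d) (Idx d) ℝ) : Prop :=
  C ^ 2 * (L + 1) * kappa Sig0 ^ 4 *
      ((∑ k, (mdim d k : ℝ) * offSupp (Psi k)) * Real.log (pdim d) + L * pdim d)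
    ≤ (mmin d : ℝ) ^ 2

end Assumptions

end TeraLasso

end

/-!
Up to the penalty, the objective differs from its value at `Ω₀` by the sum of a convex function,
coming from `-log det`, and a linear noise term. The strong convexity of `-log det` makes the
curvature at least quadratic in `‖Ω - Ω₀‖_F` as long as the operator norm of `Ω - Ω₀` is small
compared with `φ_min(Ω₀)`; for a Kronecker sum the operator norm is at most `√((L + 1) / m_min)`
times the Frobenius norm, and this gain lets a single observation suffice. The noise is the linear
form `D ↦ xᵀ D x - tr(Σ₀ D)`. By the Hanson–Wright inequality each off-diagonal coordinate of it is
dominated by the penalty, whereas the diagonal ones, which form a space of dimension at most `L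
d_max`, are controlled jointly through the norm of a projection of the subgaussian vector. On the
sphere of the claimed radius the curvature wins, so by convexity the objective exceeds its value at
`Ω₀` outside the ball, and a minimizer exists in the ball by compactness.
-/

noncomputable section

namespace TeraLasso

/-! ### Exponential moments -/

/-- The exponential function with values in `[0, ∞]`. Stating moment bounds for it and the Lebesgue
integral, instead of `Real.exp` and the Bochner integral, makes integrability part of the bound. -/
def eexp (x : ℝ) : ENNReal := ENNReal.ofReal (Real.exp x)

@[fun_prop]
theorem measurable_eexp : Measurable eexp := by
  unfold eexp; fun_prop

theorem eexp_zero : eexp 0 = 1 := by simp [eexp]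

theorem eexp_add (x y : ℝ) : eexp (x + y) = eexp x * eexp y := by
  rw [eexp, Real.exp_add, ENNReal.ofReal_mul (Real.exp_pos x).le]; rfl

theorem eexp_sum {ι : Type*} (s : Finset ι) (f : ι → ℝ) :
    eexp (∑ i ∈ s, f i) = ∏ i ∈ s, eexp (f i) := by
  simp only [eexp, Real.exp_sum, ENNReal.ofReal_prod_of_nonneg fun i _ => (Real.exp_pos (f i)).le]

theorem eexp_mono {x y : ℝ} (h : x ≤ y) : eexp x ≤ eexp y :=
  ENNReal.ofReal_le_ofReal (Real.exp_le_exp.2 h)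

theorem eexp_mul_eexp_neg (x : ℝ) : eexp x * eexp (-x) = 1 := by
  rw [← eexp_add, add_neg_cancel, eexp_zero]

theorem eexp_mul_eq_rpow (a x : ℝ) : eexp (a * x) = eexp x ^ a := by
  rw [eexp, eexp, ENNReal.ofReal_rpow_of_pos (Real.exp_pos x), ← Real.exp_mul, mul_comm]

theorem two_le_eexp_one : 2 ≤ eexp 1 := by
  rw [eexp, ← ENNReal.ofReal_ofNat]
  exact ENNReal.ofReal_le_ofReal (by linarith [Real.add_one_le_exp 1])

theorem eexp_log_natCast {n : ℕ} (hn : 0 < n) : eexp (Real.log n) = n := by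
  rw [eexp, Real.exp_log (by exact_mod_cast hn), ENNReal.ofReal_natCast]

section Scalar

variable {S : Type*} [MeasurableSpace S] {μ : Measure S}

theorem lintegral_eexp_le_two_of_psi2Norm_lt {t : ℝ} {Z : S → ℝ}
    (h : psi2Norm μ Z < ENNReal.ofReal t) : ∫⁻ ω, eexp (Z ω ^ 2 / t ^ 2) ∂μ ≤ 2 := by
  simp only [psi2Norm, iInf_lt_iff] at h
  obtain ⟨u, hu, hule, hut⟩ := h
  have : u < t := (ENNReal.ofReal_lt_ofReal_iff_of_nonneg hu.le).1 hut
  exact (lintegral_mono fun ω => eexp_mono (by gcongr)).trans hule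

theorem integrable_exp_of_lintegral_eexp_ne_top {f : S → ℝ} (hf : Measurable f)
    (h : ∫⁻ ω, eexp (f ω) ∂μ ≠ ⊤) : Integrable (fun ω => Real.exp (f ω)) μ := by
  refine ⟨by fun_prop, ?_⟩
  rw [hasFiniteIntegral_iff_ofReal (.of_forall fun _ => (Real.exp_pos _).le)]
  exact h.lt_top

theorem lintegral_eexp_eq_ofReal_integral {f : S → ℝ}
    (hf : Integrable (fun ω => Real.exp (f ω)) μ) :
    ∫⁻ ω, eexp (f ω) ∂μ = ENNReal.ofReal (∫ ω, Real.exp (f ω) ∂μ) :=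
  (ofReal_integral_eq_lintegral_ofReal hf (.of_forall fun _ => (Real.exp_pos _).le)).symm

theorem integral_exp_le_of_lintegral_eexp_le {f : S → ℝ} {c : ℝ} (hc : 0 ≤ c)
    (h : ∫⁻ ω, eexp (f ω) ∂μ ≤ ENNReal.ofReal c) : ∫ ω, Real.exp (f ω) ∂μ ≤ c := by
  by_cases hf : Integrable (fun ω => Real.exp (f ω)) μ
  · rwa [lintegral_eexp_eq_ofReal_integral hf, ENNReal.ofReal_le_ofReal_iff hc] at h
  · rwa [integral_undef hf]

theorem lintegral_eexp_le_ofReal_integral {f g : S → ℝ} (hg : Integrable g μ)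
    (hfg : ∀ ω, Real.exp (f ω) ≤ g ω) :
    ∫⁻ ω, eexp (f ω) ∂μ ≤ ENNReal.ofReal (∫ ω, g ω ∂μ) := by
  rw [ofReal_integral_eq_lintegral_ofReal hg
    (.of_forall fun ω => (Real.exp_pos _).le.trans (hfg ω))]
  exact lintegral_mono fun ω => ENNReal.ofReal_le_ofReal (hfg ω)

theorem exp_le_add_exp_sq (x : ℝ) : Real.exp x ≤ x + Real.exp (x ^ 2) := by
  have hsq := Real.add_one_le_exp (x ^ 2)
  rcases le_total |x| 1 with hx | hx
  · linarith [(abs_le.1 (Real.abs_exp_sub_one_sub_id_le hx)).2]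
  rcases le_abs'.1 hx with hneg | hpos
  · have : Real.exp x ≤ 1 := Real.exp_le_one_iff.2 (by linarith)
    nlinarith
  · have : Real.exp x ≤ Real.exp (x ^ 2) := Real.exp_le_exp.2 (by nlinarith)
    linarith

theorem exp_le_one_add_add_sq_mul_exp_abs (x : ℝ) :
    Real.exp x ≤ 1 + x + x ^ 2 * Real.exp |x| := by
  rcases le_total |x| 1 with hx | hx
  · have : x ^ 2 * 1 ≤ x ^ 2 * Real.exp |x| := by gcongr; exact Real.one_le_exp (abs_nonneg x)
    linarith [(abs_le.1 (Real.abs_exp_sub_one_sub_id_le hx)).2]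
  · have hexp := Real.add_one_le_exp |x|
    have hsq : 1 ≤ x ^ 2 := (one_le_sq_iff_one_le_abs x).2 hx
    rcases abs_cases x with ⟨habs, -⟩ | ⟨habs, hneg⟩ <;> rw [habs] at hx hexp ⊢
    · nlinarith [Real.exp_pos x]
    · have : Real.exp x ≤ 1 := Real.exp_le_one_iff.2 hneg.le
      nlinarith [Real.exp_pos (-x)]

variable {Z : S → ℝ} {t : ℝ}

theorem integrable_of_lintegral_eexp_sq_le (hZ : Measurable Z) (ht : 0 < t)
    (hψ : ∫⁻ ω, eexp (Z ω ^ 2 / t ^ 2) ∂μ ≤ 2) : Integrable Z μ := by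
  have hexp : Integrable (fun ω => Real.exp (Z ω ^ 2 / t ^ 2)) μ :=
    integrable_exp_of_lintegral_eexp_ne_top (by fun_prop) (ne_top_of_le_ne_top (by simp) hψ)
  refine (hexp.const_mul t).mono' hZ.aestronglyMeasurable (.of_forall fun ω => ?_)
  calc ‖Z ω‖ = t * |Z ω / t| := by rw [Real.norm_eq_abs, abs_div, abs_of_pos ht]; field_simp
    _ ≤ t * ((Z ω / t) ^ 2 + 1) := by
        gcongr
        nlinarith [sq_abs (Z ω / t), sq_nonneg (|Z ω / t| - 1)]
    _ ≤ t * Real.exp (Z ω ^ 2 / t ^ 2) := by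
        rw [div_pow]
        gcongr
        exact Real.add_one_le_exp _

theorem integrable_sq_of_integral_eq_one (hvar : ∫ ω, Z ω ^ 2 ∂μ = 1) :
    Integrable (fun ω => Z ω ^ 2) μ :=
  not_imp_comm.1 integral_undef (by simp [hvar])

theorem lintegral_eexp_mul_le_lintegral_eexp_sq (hZ : Integrable Z μ) (hZm : Measurable Z)
    (hmean : ∫ ω, Z ω ∂μ = 0) (a : ℝ) :
    ∫⁻ ω, eexp (a * Z ω) ∂μ ≤ ∫⁻ ω, eexp ((a * Z ω) ^ 2) ∂μ := by
  by_cases htop : ∫⁻ ω, eexp ((a * Z ω) ^ 2) ∂μ = ⊤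
  · simp [htop]
  have hexp := integrable_exp_of_lintegral_eexp_ne_top (by fun_prop) htop
  refine (lintegral_eexp_le_ofReal_integral ((hZ.const_mul a).add hexp)
    fun ω => exp_le_add_exp_sq (a * Z ω)).trans_eq ?_
  rw [integral_add' (hZ.const_mul a) hexp, integral_const_mul, hmean, mul_zero, zero_add,
    lintegral_eexp_eq_ofReal_integral hexp]

variable [IsProbabilityMeasure μ]

theorem lintegral_eexp_mul_le_of_le_one {f : S → ℝ} (hf : Measurable f) {θ b : ℝ}
    (hθ_nonneg : 0 ≤ θ) (hθ_le : θ ≤ 1) (hfb : ∫⁻ ω, eexp (f ω) ∂μ ≤ eexp b) :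
    ∫⁻ ω, eexp (θ * f ω) ∂μ ≤ eexp (θ * b) := by
  rcases hθ_nonneg.eq_or_lt with rfl | hθ_nonneg
  · simp [eexp_zero]
  have hjensen := eLpNorm'_le_eLpNorm'_of_exponent_le hθ_nonneg hθ_le μ
    (measurable_eexp.comp hf).aestronglyMeasurable
  simp only [eLpNorm', Function.comp_apply, enorm_eq_self, ENNReal.rpow_one, div_one] at hjensen
  rw [one_div, ENNReal.rpow_inv_le_iff hθ_nonneg] at hjensen
  simp only [eexp_mul_eq_rpow]
  exact hjensen.trans (ENNReal.rpow_le_rpow hfb hθ_nonneg.le)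

theorem lintegral_eexp_mul_le (hZ : Measurable Z) (ht : 0 < t) (hmean : ∫ ω, Z ω ∂μ = 0)
    (hψ : ∫⁻ ω, eexp (Z ω ^ 2 / t ^ 2) ∂μ ≤ 2) (a : ℝ) :
    ∫⁻ ω, eexp (a * Z ω) ∂μ ≤ eexp (a ^ 2 * t ^ 2) := by
  have hZi := integrable_of_lintegral_eexp_sq_le hZ ht hψ
  have hmeas : Measurable fun ω => Z ω ^ 2 / t ^ 2 := by fun_prop
  have hψ1 := hψ.trans two_le_eexp_one
  rcases le_total (a ^ 2 * t ^ 2) 1 with hle | hge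
  · have hscale ω : (a * Z ω) ^ 2 = a ^ 2 * t ^ 2 * (Z ω ^ 2 / t ^ 2) := by field_simp
    calc ∫⁻ ω, eexp (a * Z ω) ∂μ ≤ ∫⁻ ω, eexp (a ^ 2 * t ^ 2 * (Z ω ^ 2 / t ^ 2)) ∂μ := by
          simpa only [hscale] using lintegral_eexp_mul_le_lintegral_eexp_sq hZi hZ hmean a
      _ ≤ eexp (a ^ 2 * t ^ 2) := by
          simpa using lintegral_eexp_mul_le_of_le_one hmeas (by positivity) hle hψ1
  · have hyoung ω : a * Z ω ≤ a ^ 2 * t ^ 2 / 2 + 1 / 2 * (Z ω ^ 2 / t ^ 2) := by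
      have : a * Z ω = (a * t) * (Z ω / t) := by field_simp
      rw [this, ← div_pow, ← mul_pow]
      nlinarith [sq_nonneg (a * t - Z ω / t)]
    calc ∫⁻ ω, eexp (a * Z ω) ∂μ
        ≤ ∫⁻ ω, eexp (a ^ 2 * t ^ 2 / 2) * eexp (1 / 2 * (Z ω ^ 2 / t ^ 2)) ∂μ :=
          lintegral_mono fun ω => (eexp_mono (hyoung ω)).trans_eq (eexp_add _ _)
      _ = eexp (a ^ 2 * t ^ 2 / 2) * ∫⁻ ω, eexp (1 / 2 * (Z ω ^ 2 / t ^ 2)) ∂μ :=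
          lintegral_const_mul _ (by fun_prop)
      _ ≤ eexp (a ^ 2 * t ^ 2 / 2) * eexp (1 / 2 * 1) := by
          gcongr
          exact lintegral_eexp_mul_le_of_le_one hmeas (by norm_num) (by norm_num) hψ1
      _ ≤ eexp (a ^ 2 * t ^ 2) := by
          rw [← eexp_add]
          exact eexp_mono (by linarith)

theorem one_le_sq_of_lintegral_eexp_sq_le (hZ : Measurable Z) (ht : 0 < t)
    (hvar : ∫ ω, Z ω ^ 2 ∂μ = 1) (hψ : ∫⁻ ω, eexp (Z ω ^ 2 / t ^ 2) ∂μ ≤ 2) : 1 ≤ t ^ 2 := by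
  have hsq := (integrable_sq_of_integral_eq_one hvar).div_const (t ^ 2)
  have hexp := integrable_exp_of_lintegral_eexp_ne_top (by fun_prop)
    (ne_top_of_le_ne_top (by simp) hψ)
  have hle : ∫ ω, (Z ω ^ 2 / t ^ 2 + 1) ∂μ ≤ 2 :=
    (integral_mono (hsq.add (integrable_const _)) hexp fun ω => Real.add_one_le_exp _).trans
      (integral_exp_le_of_lintegral_eexp_le (by norm_num) (by simpa using hψ))
  rw [integral_add hsq (integrable_const _), integral_div, hvar, integral_const, probReal_univ,
    one_smul] at hle
  exact (div_le_one (by positivity)).1 (by linarith)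

theorem exp_mul_sub_one_le {a z t : ℝ} (ht : 1 ≤ t ^ 2) (ha : |a| * t ^ 2 ≤ 1 / 4) :
    Real.exp (a * (z ^ 2 - 1)) ≤
      1 + a * (z ^ 2 - 1) + 24 * (|a| * t ^ 2) ^ 2 * Real.exp (z ^ 2 / t ^ 2) := by
  set τ := |a| * t ^ 2 with hτ
  set w := z ^ 2 / t ^ 2
  have : 0 ≤ τ := by positivity
  have hw0 : 0 ≤ w := by positivity
  have habs : |a * (z ^ 2 - 1)| ≤ τ * (w + 1) := by
    have hz : t ^ 2 * w = z ^ 2 := mul_div_cancel₀ _ (by positivity)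
    rw [abs_mul, hτ, mul_assoc]
    gcongr
    rw [abs_le]
    constructor <;> nlinarith [sq_nonneg z]
  have habs_le : |a * (z ^ 2 - 1)| ≤ (w + 1) / 4 := habs.trans (by nlinarith)
  have hquad : (w + 1) ^ 2 ≤ 8 * Real.exp ((w + 1) / 2) := by
    nlinarith [Real.quadratic_le_exp_of_nonneg (x := (w + 1) / 2) (by positivity)]
  have hexp : Real.exp ((w + 1) / 2) * Real.exp ((w + 1) / 4) ≤ 3 * Real.exp w := by
    rw [← Real.exp_add]
    calc Real.exp ((w + 1) / 2 + (w + 1) / 4) ≤ Real.exp (1 + w) :=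
          Real.exp_le_exp.2 (by linarith)
      _ = Real.exp 1 * Real.exp w := Real.exp_add _ _
      _ ≤ 3 * Real.exp w := by gcongr; exact Real.exp_one_lt_three.le
  have hrem : (a * (z ^ 2 - 1)) ^ 2 * Real.exp |a * (z ^ 2 - 1)| ≤ 24 * τ ^ 2 * Real.exp w :=
    calc (a * (z ^ 2 - 1)) ^ 2 * Real.exp |a * (z ^ 2 - 1)|
        ≤ (τ * (w + 1)) ^ 2 * Real.exp ((w + 1) / 4) := by rw [← sq_abs]; gcongr
      _ ≤ τ ^ 2 * (8 * Real.exp ((w + 1) / 2)) * Real.exp ((w + 1) / 4) := by rw [mul_pow]; gcongr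
      _ = 8 * τ ^ 2 * (Real.exp ((w + 1) / 2) * Real.exp ((w + 1) / 4)) := by ring
      _ ≤ 8 * τ ^ 2 * (3 * Real.exp w) := by gcongr
      _ = 24 * τ ^ 2 * Real.exp w := by ring
  linarith [exp_le_one_add_add_sq_mul_exp_abs (a * (z ^ 2 - 1))]

theorem lintegral_eexp_mul_sq_sub_one_le (hZ : Measurable Z) (ht : 0 < t)
    (hvar : ∫ ω, Z ω ^ 2 ∂μ = 1) (hψ : ∫⁻ ω, eexp (Z ω ^ 2 / t ^ 2) ∂μ ≤ 2) {a : ℝ}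
    (ha : |a| * t ^ 2 ≤ 1 / 4) :
    ∫⁻ ω, eexp (a * (Z ω ^ 2 - 1)) ∂μ ≤ eexp (48 * (a ^ 2 * t ^ 4)) := by
  have ht1 := one_le_sq_of_lintegral_eexp_sq_le hZ ht hvar hψ
  have hexp := integrable_exp_of_lintegral_eexp_ne_top (by fun_prop)
    (ne_top_of_le_ne_top (by simp) hψ)
  have hcentred : Integrable (fun ω => Z ω ^ 2 - 1) μ :=
    (integrable_sq_of_integral_eq_one hvar).sub (integrable_const _)
  have hlin : Integrable (fun ω => 1 + a * (Z ω ^ 2 - 1)) μ :=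
    (integrable_const _).add (hcentred.const_mul a)
  have hlin1 : ∫ ω, (1 + a * (Z ω ^ 2 - 1)) ∂μ = 1 := by
    rw [integral_add (integrable_const _) (hcentred.const_mul a), integral_const_mul,
      integral_sub (integrable_sq_of_integral_eq_one hvar) (integrable_const _), hvar]
    simp
  have hexp2 : ∫ ω, Real.exp (Z ω ^ 2 / t ^ 2) ∂μ ≤ 2 :=
    integral_exp_le_of_lintegral_eexp_le (by norm_num) (by simpa using hψ)
  refine (lintegral_eexp_le_ofReal_integral (hlin.add (hexp.const_mul _))
    fun ω => exp_mul_sub_one_le ht1 ha).trans (ENNReal.ofReal_le_ofReal ?_)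
  rw [integral_add' hlin (hexp.const_mul _), hlin1, integral_const_mul,
    show a ^ 2 * t ^ 4 = (|a| * t ^ 2) ^ 2 by rw [mul_pow, sq_abs]; ring]
  nlinarith [Real.add_one_le_exp (48 * (|a| * t ^ 2) ^ 2), sq_nonneg (|a| * t ^ 2)]

end Scalar

/-! ### Frobenius norm, operator norm and spectrum -/

section Norms

variable {ι : Type*} [Fintype ι]

open Matrix

/-- Squared Frobenius norm. -/
def frobSq (A : Matrix ι ι ℝ) : ℝ := ∑ i, ∑ j, A i j ^ 2

theorem frobSq_nonneg (A : Matrix ι ι ℝ) : 0 ≤ frobSq A := by unfold frobSq; positivity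

theorem frobSq_transpose (A : Matrix ι ι ℝ) : frobSq Aᵀ = frobSq A := Finset.sum_comm

theorem frobSq_eq_sum_col_dotProduct (A : Matrix ι ι ℝ) :
    frobSq A = ∑ j, A.col j ⬝ᵥ A.col j := by
  rw [← frobSq_transpose]
  simp only [frobSq, dotProduct, col_apply, transpose_apply, ← sq]

theorem frobSq_eq_trace (A : Matrix ι ι ℝ) : frobSq A = (Aᵀ * A).trace :=
  frobSq_eq_sum_col_dotProduct A

theorem frobSq_smul (c : ℝ) (A : Matrix ι ι ℝ) : frobSq (c • A) = c ^ 2 * frobSq A := by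
  simp only [frobSq, Finset.mul_sum, Matrix.smul_apply, smul_eq_mul, mul_pow]

theorem frobNorm_eq_sqrt (A : Matrix ι ι ℝ) : frobNorm A = √(frobSq A) := rfl

theorem frobNorm_sq (A : Matrix ι ι ℝ) : frobNorm A ^ 2 = frobSq A :=
  Real.sq_sqrt (frobSq_nonneg A)

theorem frobNorm_nonneg (A : Matrix ι ι ℝ) : 0 ≤ frobNorm A := Real.sqrt_nonneg _

theorem dotProduct_self_eq_norm_sq (x : ι → ℝ) : x ⬝ᵥ x = ‖WithLp.toLp 2 x‖ ^ 2 := by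
  rw [EuclideanSpace.real_norm_sq_eq]
  simp only [dotProduct, sq]

variable [DecidableEq ι]

open scoped Matrix.Norms.L2Operator in
theorem opNorm_eq_norm (A : Matrix ι ι ℝ) : opNorm A = ‖A‖ := l2_opNorm_toEuclideanCLM A

theorem opNorm_nonneg (A : Matrix ι ι ℝ) : 0 ≤ opNorm A := norm_nonneg _

theorem dotProduct_mulVec_self_le (A : Matrix ι ι ℝ) (x : ι → ℝ) :
    (A *ᵥ x) ⬝ᵥ (A *ᵥ x) ≤ opNorm A ^ 2 * (x ⬝ᵥ x) := by
  rw [dotProduct_self_eq_norm_sq, dotProduct_self_eq_norm_sq, ← mul_pow, ← toEuclideanCLM_toLp]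
  gcongr
  exact (toEuclideanCLM (𝕜 := ℝ) A).le_opNorm _

theorem opNorm_le_of_dotProduct_mulVec_self_le {A : Matrix ι ι ℝ} {b : ℝ} (hb : 0 ≤ b)
    (h : ∀ x, (A *ᵥ x) ⬝ᵥ (A *ᵥ x) ≤ b ^ 2 * (x ⬝ᵥ x)) : opNorm A ≤ b := by
  refine ContinuousLinearMap.opNorm_le_bound _ hb fun x => ?_
  have hx := h x.ofLp
  rw [dotProduct_self_eq_norm_sq, dotProduct_self_eq_norm_sq, ← mul_pow] at hx
  exact le_of_sq_le_sq hx (by positivity)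

theorem opNorm_le_frobNorm (A : Matrix ι ι ℝ) : opNorm A ≤ frobNorm A := by
  refine opNorm_le_of_dotProduct_mulVec_self_le (frobNorm_nonneg A) fun x => ?_
  rw [frobNorm_sq, frobSq, Finset.sum_mul]
  refine Finset.sum_le_sum fun i _ => ?_
  simpa only [mulVec, dotProduct, ← sq] using
    Finset.sum_mul_sq_le_sq_mul_sq Finset.univ (A i) x

theorem opNorm_add_le (A B : Matrix ι ι ℝ) : opNorm (A + B) ≤ opNorm A + opNorm B := by
  simpa only [opNorm, map_add] using norm_add_le _ _

theorem opNorm_sum_le {κ : Type*} (s : Finset κ) (A : κ → Matrix ι ι ℝ) :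
    opNorm (∑ k ∈ s, A k) ≤ ∑ k ∈ s, opNorm (A k) := by
  simpa only [opNorm, map_sum] using norm_sum_le _ _

theorem opNorm_mul_le (A B : Matrix ι ι ℝ) : opNorm (A * B) ≤ opNorm A * opNorm B := by
  simpa only [opNorm, map_mul] using norm_mul_le _ _

theorem opNorm_smul_one_le (c : ℝ) : opNorm (c • (1 : Matrix ι ι ℝ)) ≤ |c| := by
  refine opNorm_le_of_dotProduct_mulVec_self_le (abs_nonneg c) fun x => le_of_eq ?_
  simp only [smul_mulVec, one_mulVec, smul_dotProduct, dotProduct_smul, smul_eq_mul, sq_abs]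
  ring

theorem opNorm_transpose (A : Matrix ι ι ℝ) : opNorm Aᵀ = opNorm A := by
  rw [opNorm_eq_norm, opNorm_eq_norm, ← conjTranspose_eq_transpose_of_trivial,
    l2_opNorm_conjTranspose]

theorem opNorm_transpose_mul_self (A : Matrix ι ι ℝ) : opNorm (Aᵀ * A) = opNorm A ^ 2 := by
  rw [opNorm_eq_norm, opNorm_eq_norm, ← conjTranspose_eq_transpose_of_trivial,
    l2_opNorm_conjTranspose_mul_self, sq]

theorem frobSq_mul_le (A B : Matrix ι ι ℝ) : frobSq (A * B) ≤ opNorm A ^ 2 * frobSq B := by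
  rw [frobSq_eq_sum_col_dotProduct, frobSq_eq_sum_col_dotProduct, Finset.mul_sum]
  exact Finset.sum_le_sum fun j _ => dotProduct_mulVec_self_le A (B.col j)

theorem frobSq_conj_le (R A : Matrix ι ι ℝ) :
    frobSq (Rᵀ * A * R) ≤ opNorm (Rᵀ * R) ^ 2 * frobSq A :=
  calc frobSq (Rᵀ * A * R) = frobSq (Rᵀ * (Rᵀ * A)ᵀ) := by
        rw [← frobSq_transpose, transpose_mul (Rᵀ * A)]
    _ ≤ opNorm Rᵀ ^ 2 * (opNorm Rᵀ ^ 2 * frobSq A) := by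
        refine (frobSq_mul_le _ _).trans ?_
        rw [frobSq_transpose]
        gcongr
        exact frobSq_mul_le _ _
    _ = opNorm (Rᵀ * R) ^ 2 * frobSq A := by
        rw [opNorm_transpose, opNorm_transpose_mul_self]; ring

theorem opNorm_conj_le (R A : Matrix ι ι ℝ) :
    opNorm (Rᵀ * A * R) ≤ opNorm (Rᵀ * R) * opNorm A :=
  calc opNorm (Rᵀ * A * R) ≤ opNorm Rᵀ * opNorm A * opNorm R :=
        (opNorm_mul_le _ _).trans
          (mul_le_mul_of_nonneg_right (opNorm_mul_le _ _) (opNorm_nonneg _))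
    _ = opNorm (Rᵀ * R) * opNorm A := by
        rw [opNorm_transpose, opNorm_transpose_mul_self]; ring

theorem abs_dotProduct_mulVec_le (A : Matrix ι ι ℝ) (x : ι → ℝ) :
    |x ⬝ᵥ (A *ᵥ x)| ≤ opNorm A * (x ⬝ᵥ x) := by
  have hinner : x ⬝ᵥ (A *ᵥ x) = inner ℝ (WithLp.toLp 2 x)
      (toEuclideanCLM (𝕜 := ℝ) A (WithLp.toLp 2 x)) := by rw [inner_toEuclideanCLM]
  rw [hinner, dotProduct_self_eq_norm_sq]
  calc _ ≤ ‖WithLp.toLp 2 x‖ * (opNorm A * ‖WithLp.toLp 2 x‖) :=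
        (abs_real_inner_le_norm _ _).trans
          (mul_le_mul_of_nonneg_left ((toEuclideanCLM (𝕜 := ℝ) A).le_opNorm _) (norm_nonneg _))
    _ = opNorm A * ‖WithLp.toLp 2 x‖ ^ 2 := by ring

theorem abs_diag_le_opNorm (A : Matrix ι ι ℝ) (i : ι) : |A i i| ≤ opNorm A := by
  simpa using abs_dotProduct_mulVec_le A (Pi.single i 1)

theorem dotProduct_mulVec_self_of_transpose_mul_self_eq_one {U : Matrix ι ι ℝ} (hU : Uᵀ * U = 1)
    (x : ι → ℝ) : (U *ᵥ x) ⬝ᵥ (U *ᵥ x) = x ⬝ᵥ x := by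
  rw [dotProduct_mulVec, ← mulVec_transpose, mulVec_mulVec, hU, one_mulVec]

end Norms

section Spectrum

variable {ι : Type*}

open Matrix

theorem isHermitian_iff_isSymm {A : Matrix ι ι ℝ} : A.IsHermitian ↔ A.IsSymm := by
  rw [IsHermitian, IsSymm, conjTranspose_eq_transpose_of_trivial]

variable [Fintype ι] [DecidableEq ι]

open scoped Matrix.Norms.L2Operator in
theorem isGreatest_abs_spectrum [Nonempty ι] {A : Matrix ι ι ℝ} (hA : A.IsHermitian) :
    IsGreatest ((|·|) '' spectrum ℝ A) (opNorm A) := by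
  rw [opNorm_eq_norm]
  exact IsometricContinuousFunctionalCalculus.isGreatest_norm_spectrum (𝕜 := ℝ) A hA

theorem abs_eigenvalues_le_opNorm {A : Matrix ι ι ℝ} (hA : A.IsHermitian) (l : ι) :
    |hA.eigenvalues l| ≤ opNorm A :=
  have : Nonempty ι := ⟨l⟩
  (isGreatest_abs_spectrum hA).2 ⟨_, hA.eigenvalues_mem_spectrum_real l, rfl⟩

theorem isGreatest_phiMax [Nonempty ι] {A : Matrix ι ι ℝ} (hA : A.IsHermitian) :
    IsGreatest (spectrum ℝ A) (phiMax A) :=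
  finite_real_spectrum.isCompact.isGreatest_sSup
    ⟨_, hA.eigenvalues_mem_spectrum_real (Classical.arbitrary ι)⟩

theorem isLeast_phiMin [Nonempty ι] {A : Matrix ι ι ℝ} (hA : A.IsHermitian) :
    IsLeast (spectrum ℝ A) (phiMin A) :=
  finite_real_spectrum.isCompact.isLeast_sInf
    ⟨_, hA.eigenvalues_mem_spectrum_real (Classical.arbitrary ι)⟩

theorem pos_of_mem_spectrum {A : Matrix ι ι ℝ} (hA : A.PosDef) {x : ℝ} (hx : x ∈ spectrum ℝ A) :
    0 < x := by
  rw [hA.isHermitian.spectrum_real_eq_range_eigenvalues] at hx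
  obtain ⟨l, rfl⟩ := hx
  exact hA.eigenvalues_pos l

theorem posDef_of_phiMin_pos {A : Matrix ι ι ℝ} (hA : A.IsHermitian) (h : 0 < phiMin A) :
    A.PosDef :=
  hA.posDef_iff_eigenvalues_pos.2 fun l =>
    have : Nonempty ι := ⟨l⟩
    h.trans_le ((isLeast_phiMin hA).2 (hA.eigenvalues_mem_spectrum_real l))

theorem opNorm_eq_phiMax [Nonempty ι] {A : Matrix ι ι ℝ} (hA : A.PosDef) :
    opNorm A = phiMax A := by
  obtain ⟨⟨x, hx, hxA : |x| = _⟩, hle⟩ := isGreatest_abs_spectrum hA.isHermitian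
  have hmax := isGreatest_phiMax hA.isHermitian
  refine le_antisymm ?_ ((le_abs_self _).trans (hle ⟨_, hmax.1, rfl⟩))
  rw [← hxA, abs_of_pos (pos_of_mem_spectrum hA hx)]
  exact hmax.2 hx

theorem opNorm_inv_le [Nonempty ι] {A : Matrix ι ι ℝ} (hA : A.PosDef) :
    opNorm A⁻¹ ≤ (phiMin A)⁻¹ := by
  obtain ⟨⟨x, hx, hxA : |x| = _⟩, -⟩ := isGreatest_abs_spectrum hA.inv.isHermitian
  have hinv : x⁻¹ ∈ spectrum ℝ A := by
    obtain ⟨u, rfl⟩ := hA.isUnit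
    rwa [← coe_units_inv, ← inv_inv x, spectrum.inv₀_mem_inv_iff] at hx
  rw [← hxA, abs_of_pos (pos_of_mem_spectrum hA.inv hx), ← inv_inv x]
  exact inv_anti₀ (pos_of_mem_spectrum hA (isLeast_phiMin hA.isHermitian).1)
    ((isLeast_phiMin hA.isHermitian).2 hinv)

theorem opNorm_mul_opNorm_inv_le_kappa [Nonempty ι] {A : Matrix ι ι ℝ} (hA : A.PosDef) :
    opNorm A * opNorm A⁻¹ ≤ kappa A := by
  rw [kappa, div_eq_mul_inv, ← opNorm_eq_phiMax hA]
  exact mul_le_mul_of_nonneg_left (opNorm_inv_le hA) (opNorm_nonneg _)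

open scoped MatrixOrder in
theorem sqrt_mul_sqrt_self {A : Matrix ι ι ℝ} (hA : A.PosSemidef) :
    CFC.sqrt A * CFC.sqrt A = A :=
  CFC.sqrt_mul_sqrt_self A hA.nonneg

open scoped MatrixOrder in
theorem isSymm_sqrt (A : Matrix ι ι ℝ) : (CFC.sqrt A).IsSymm :=
  isHermitian_iff_isSymm.1 (nonneg_iff_posSemidef.1 (CFC.sqrt_nonneg A)).isHermitian

open scoped MatrixOrder in
theorem exists_isSymm_sqrt {A : Matrix ι ι ℝ} (hA : A.PosDef) :
    ∃ R Q : Matrix ι ι ℝ,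
      R.IsSymm ∧ Q.IsSymm ∧ R * R = A⁻¹ ∧ Q * Q = A ∧ R * Q = 1 ∧ Q * R = 1 := by
  have hsq := sqrt_mul_sqrt_self hA.posSemidef
  have hdet : IsUnit (CFC.sqrt A).det := by
    have hdetA := hA.det_pos
    rw [← hsq, det_mul] at hdetA
    exact (left_ne_zero_of_mul hdetA.ne').isUnit
  refine ⟨(CFC.sqrt A)⁻¹, CFC.sqrt A, ?_, isSymm_sqrt A, ?_, hsq, nonsing_inv_mul _ hdet,
    mul_nonsing_inv _ hdet⟩
  · rw [IsSymm, transpose_nonsing_inv, isSymm_sqrt A]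
  · rw [← Matrix.mul_inv_rev, hsq]

theorem exists_orthogonal_diagonalization {A : Matrix ι ι ℝ} (hA : A.IsHermitian) :
    ∃ U : Matrix ι ι ℝ, Uᵀ * U = 1 ∧ U * Uᵀ = 1 ∧ A = U * diagonal hA.eigenvalues * Uᵀ := by
  refine ⟨hA.eigenvectorUnitary, ?_, ?_, ?_⟩
  · simpa only [star_eq_conjTranspose, conjTranspose_eq_transpose_of_trivial] using
      Unitary.coe_star_mul_self hA.eigenvectorUnitary
  · simpa only [Unitary.coe_star, star_eq_conjTranspose,
      conjTranspose_eq_transpose_of_trivial] using Unitary.coe_mul_star_self hA.eigenvectorUnitary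
  · conv_lhs => rw [hA.spectral_theorem, Unitary.conjStarAlgAut_apply, star_eq_conjTranspose,
      conjTranspose_eq_transpose_of_trivial]
    rfl

theorem exists_orthogonal_dotProduct_mulVec_self_eq (B : Matrix ι ι ℝ) :
    ∃ (U : Matrix ι ι ℝ) (e : ι → ℝ), U * Uᵀ = 1 ∧ (∀ l, 0 ≤ e l ∧ e l ≤ opNorm B ^ 2) ∧
      ∑ l, e l = frobSq B ∧
      ∀ x, (B *ᵥ x) ⬝ᵥ (B *ᵥ x) = ∑ l, e l * (Uᵀ *ᵥ x) l ^ 2 := by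
  have hpsd : (Bᵀ * B).PosSemidef := posSemidef_conjTranspose_mul_self B
  have hG := hpsd.isHermitian
  obtain ⟨U, -, hU, hdiag⟩ := exists_orthogonal_diagonalization hG
  refine ⟨U, hG.eigenvalues, hU, fun l => ⟨hpsd.eigenvalues_nonneg l, ?_⟩, ?_, fun x => ?_⟩
  · rw [← opNorm_transpose_mul_self]
    exact (le_abs_self _).trans (abs_eigenvalues_le_opNorm hG l)
  · rw [frobSq_eq_trace, hG.trace_eq_sum_eigenvalues]
    simp
  · have : (B *ᵥ x) ⬝ᵥ (B *ᵥ x) = x ⬝ᵥ ((Bᵀ * B) *ᵥ x) := by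
      rw [← mulVec_mulVec, dotProduct_mulVec x, vecMul_transpose]
    rw [this]
    conv_lhs => rw [hdiag]
    rw [← mulVec_mulVec, ← mulVec_mulVec, dotProduct_mulVec, ← mulVec_transpose]
    simp only [dotProduct, mulVec_diagonal]
    exact Finset.sum_congr rfl fun l _ => by ring

end Spectrum

/-! ### Quadratic forms in independent sub-gaussian variables -/

section Gaussian

theorem lintegral_eexp_mul_gaussianReal (y : ℝ) :
    ∫⁻ g, eexp (y * g) ∂(gaussianReal 0 1) = eexp (y ^ 2 / 2) := by
  rw [lintegral_eexp_eq_ofReal_integral (integrable_exp_mul_gaussianReal y)]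
  have hmgf := mgf_gaussianReal (p := gaussianReal 0 1) (X := id) (μ := 0) (v := 1) (by simp) y
  simp only [mgf, id] at hmgf
  simp [hmgf, eexp]

theorem lintegral_eexp_mul_sq_gaussianReal {a : ℝ} (ha : a < 1 / 2) :
    ∫⁻ g, eexp (a * g ^ 2) ∂(gaussianReal 0 1) = ENNReal.ofReal √(1 - 2 * a)⁻¹ := by
  have hdensity (x : ℝ) : (gaussianPDF 0 1 * fun g => eexp (a * g ^ 2)) x
      = ENNReal.ofReal ((√(2 * Real.pi))⁻¹ * Real.exp (-(1 / 2 - a) * x ^ 2)) := by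
    simp only [Pi.mul_apply, gaussianPDF, gaussianPDFReal, eexp, NNReal.coe_one, mul_one, sub_zero]
    rw [← ENNReal.ofReal_mul (by positivity), mul_assoc, ← Real.exp_add]
    congr 3
    ring
  have hnormalize : (2 * Real.pi)⁻¹ * (Real.pi / (1 / 2 - a)) = (1 - 2 * a)⁻¹ := by
    have : 1 - 2 * a ≠ 0 := by linarith
    have : 1 / 2 - a ≠ 0 := by linarith
    field_simp
  rw [gaussianReal_of_var_ne_zero _ one_ne_zero,
    lintegral_withDensity_eq_lintegral_mul _ (measurable_gaussianPDF _ _) (by fun_prop),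
    lintegral_congr hdensity, ← ofReal_integral_eq_lintegral_ofReal
      ((integrable_exp_neg_mul_sq (sub_pos.2 ha)).const_mul _) (.of_forall fun _ => by positivity),
    integral_const_mul, integral_gaussian, ← Real.sqrt_inv, ← Real.sqrt_mul (by positivity),
    hnormalize]

theorem lintegral_eexp_mul_sq_gaussianReal_le {a : ℝ} (ha_nonneg : 0 ≤ a) (ha : a ≤ 1 / 4) :
    ∫⁻ g, eexp (a * g ^ 2) ∂(gaussianReal 0 1) ≤ eexp (2 * a) := by
  rw [lintegral_eexp_mul_sq_gaussianReal (by linarith)]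
  refine ENNReal.ofReal_le_ofReal (Real.sqrt_le_iff.2 ⟨(Real.exp_pos _).le, ?_⟩)
  calc (1 - 2 * a)⁻¹ ≤ 1 + 4 * a := by rw [inv_le_iff_one_le_mul₀ (by linarith)]; nlinarith
    _ ≤ Real.exp (4 * a) := by linarith [Real.add_one_le_exp (4 * a)]
    _ = Real.exp (2 * a) ^ 2 := by rw [← Real.exp_nat_mul]; congr 1; push_cast; ring

variable {ι : Type*} [Fintype ι]

theorem lintegral_pi_prod (ν : ι → Measure ℝ) [∀ i, IsProbabilityMeasure (ν i)]
    (f : ι → ℝ → ENNReal) (hf : ∀ i, Measurable (f i)) :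
    ∫⁻ g, ∏ i, f i (g i) ∂(Measure.pi ν) = ∏ i, ∫⁻ x, f i x ∂(ν i) := by
  have hind : iIndepFun (fun i (g : ι → ℝ) => f i (g i)) (Measure.pi ν) :=
    iIndepFun_pi fun i => (hf i).aemeasurable
  rw [lintegral_prod_eq_prod_lintegral_of_indepFun Finset.univ _ hind (fun i => by fun_prop)]
  exact Finset.prod_congr rfl fun i _ => (measurePreserving_eval ν i).lintegral_comp (hf i)

theorem lintegral_eexp_sum_mul_pi_gaussianReal (y : ι → ℝ) :
    ∫⁻ g, eexp (∑ l, y l * g l) ∂(Measure.pi fun _ => gaussianReal 0 1) =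
      eexp (∑ l, y l ^ 2 / 2) := by
  simp only [eexp_sum, ← lintegral_eexp_mul_gaussianReal]
  exact lintegral_pi_prod _ (fun l x => eexp (y l * x)) fun l => by fun_prop

theorem lintegral_eexp_sum_mul_sq_pi_gaussianReal_le {a : ι → ℝ} (ha_nonneg : ∀ l, 0 ≤ a l)
    (ha : ∀ l, a l ≤ 1 / 4) :
    ∫⁻ g, eexp (∑ l, a l * g l ^ 2) ∂(Measure.pi fun _ => gaussianReal 0 1) ≤
      eexp (∑ l, 2 * a l) := by
  simp only [eexp_sum]
  rw [lintegral_pi_prod _ (fun l x => eexp (a l * x ^ 2)) fun l => by fun_prop]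
  exact Finset.prod_le_prod' fun l _ => lintegral_eexp_mul_sq_gaussianReal_le (ha_nonneg l) (ha l)

end Gaussian

section SubgaussianVector

variable {S : Type*} [MeasurableSpace S] {μ : Measure S} {ι : Type*} [Fintype ι] {t c : ℝ}

open Matrix

/-- Gaussian linearization: `exp (‖y‖² / 2)` is the average of `exp ⟨y, g⟩` over a standard
Gaussian `g`, so that bounds for linear forms of `W` can be integrated to quadratic ones. -/
theorem lintegral_eexp_sum_mul_sq_le [SFinite μ] {W : ι → S → ℝ} (hW : ∀ i, Measurable (W i))
    (hsub : ∀ a : ι → ℝ, ∫⁻ ω, eexp (∑ i, a i * W i ω) ∂μ ≤ eexp (t ^ 2 * ∑ i, a i ^ 2))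
    {a : ι → ℝ} (ha_nonneg : ∀ l, 0 ≤ a l) (ha : ∀ l, 8 * t ^ 2 * a l ≤ 1) :
    ∫⁻ ω, eexp (∑ l, a l * W l ω ^ 2) ∂μ ≤ eexp (4 * t ^ 2 * ∑ l, a l) := by
  set r : ι → ℝ := fun l => √(2 * a l)
  have hr l : r l ^ 2 = 2 * a l := Real.sq_sqrt (by linarith [ha_nonneg l])
  have hlinearize ω : eexp (∑ l, a l * W l ω ^ 2) =
      ∫⁻ g, eexp (∑ l, r l * g l * W l ω) ∂(Measure.pi fun _ => gaussianReal 0 1) := by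
    rw [← lintegral_congr fun g => congrArg eexp <|
      Finset.sum_congr rfl fun l _ => mul_right_comm (r l) (W l ω) (g l),
      lintegral_eexp_sum_mul_pi_gaussianReal]
    simp only [mul_pow, hr]
    congr! 2
    ring
  calc ∫⁻ ω, eexp (∑ l, a l * W l ω ^ 2) ∂μ
      = ∫⁻ g, ∫⁻ ω, eexp (∑ l, r l * g l * W l ω) ∂μ ∂(Measure.pi fun _ => gaussianReal 0 1) := by
        rw [lintegral_congr hlinearize, lintegral_lintegral_swap]
        exact Measurable.aemeasurable (by fun_prop)
    _ ≤ ∫⁻ g, eexp (∑ l, 2 * t ^ 2 * a l * g l ^ 2) ∂(Measure.pi fun _ => gaussianReal 0 1) := by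
        refine lintegral_mono fun g => (hsub fun l => r l * g l).trans_eq ?_
        simp only [mul_pow, hr, Finset.mul_sum]
        congr! 2
        ring
    _ ≤ eexp (∑ l, 2 * (2 * t ^ 2 * a l)) :=
        lintegral_eexp_sum_mul_sq_pi_gaussianReal_le
          (fun l => by have := ha_nonneg l; positivity) fun l => by linarith [ha l]
    _ = eexp (4 * t ^ 2 * ∑ l, a l) := by
        rw [Finset.mul_sum]
        congr! 2
        ring

theorem lintegral_eexp_norm_mulVec_sq_le [SFinite μ] [DecidableEq ι] {Z : ι → S → ℝ}
    (hZ : ∀ i, Measurable (Z i))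
    (hsub : ∀ a : ι → ℝ, ∫⁻ ω, eexp (∑ i, a i * Z i ω) ∂μ ≤ eexp (t ^ 2 * ∑ i, a i ^ 2))
    (B : Matrix ι ι ℝ) (hc : 0 ≤ c) (hcB : 8 * c * t ^ 2 * opNorm B ^ 2 ≤ 1) :
    ∫⁻ ω, eexp (c * ((B *ᵥ fun i => Z i ω) ⬝ᵥ (B *ᵥ fun i => Z i ω))) ∂μ
      ≤ eexp (4 * c * t ^ 2 * frobSq B) := by
  obtain ⟨U, e, hU, he, hsum, hquad⟩ := exists_orthogonal_dotProduct_mulVec_self_eq B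
  have hrot (a : ι → ℝ) :
      ∫⁻ ω, eexp (∑ l, a l * (Uᵀ *ᵥ fun i => Z i ω) l) ∂μ ≤ eexp (t ^ 2 * ∑ l, a l ^ 2) := by
    have hlin ω : ∑ l, a l * (Uᵀ *ᵥ fun i => Z i ω) l = ∑ i, (U *ᵥ a) i * Z i ω := by
      change a ⬝ᵥ (Uᵀ *ᵥ _) = (U *ᵥ a) ⬝ᵥ _
      rw [dotProduct_mulVec, vecMul_transpose]
    have hU' : Uᵀ * U = 1 := mul_eq_one_comm.1 hU
    have hnorm : ∑ i, (U *ᵥ a) i ^ 2 = ∑ i, a i ^ 2 := by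
      simpa only [dotProduct, ← sq] using dotProduct_mulVec_self_of_transpose_mul_self_eq_one hU' a
    simpa only [hlin, hnorm] using hsub (U *ᵥ a)
  have hbound := lintegral_eexp_sum_mul_sq_le (a := fun l => c * e l)
    (fun l => by simp only [mulVec, dotProduct]; fun_prop) hrot
    (fun l => mul_nonneg hc (he l).1) fun l => by
      have : c * t ^ 2 * e l ≤ c * t ^ 2 * opNorm B ^ 2 := by gcongr; exact (he l).2
      linarith
  simp only [mul_assoc, ← Finset.mul_sum, ← hquad, hsum] at hbound
  exact hbound.trans_eq (congrArg eexp (by ring))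

end SubgaussianVector

section Independent

variable {S : Type*} [MeasurableSpace S] {μ : Measure S}

theorem lintegral_comp_prod_of_indepFun [IsProbabilityMeasure μ] {α β : Type*} [MeasurableSpace α]
    [MeasurableSpace β] {U : S → α} {V : S → β} (hU : Measurable U) (hV : Measurable V)
    (h : IndepFun U V μ) {F : α × β → ENNReal} (hF : Measurable F) :
    ∫⁻ ω, F (U ω, V ω) ∂μ = ∫⁻ ω', ∫⁻ ω, F (U ω, V ω') ∂μ ∂μ := by
  have hmap := (indepFun_iff_map_prod_eq_prod_map_map hU.aemeasurable hV.aemeasurable).1 h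
  have : IsProbabilityMeasure (μ.map U) := Measure.isProbabilityMeasure_map hU.aemeasurable
  have : IsProbabilityMeasure (μ.map V) := Measure.isProbabilityMeasure_map hV.aemeasurable
  calc ∫⁻ ω, F (U ω, V ω) ∂μ = ∫⁻ z, F z ∂(μ.map fun ω => (U ω, V ω)) :=
        (lintegral_map hF (hU.prodMk hV)).symm
    _ = ∫⁻ v, ∫⁻ u, F (u, v) ∂(μ.map U) ∂(μ.map V) := by
        rw [hmap, lintegral_prod_symm _ hF.aemeasurable]
    _ = ∫⁻ ω', ∫⁻ u, F (u, V ω') ∂(μ.map U) ∂μ := lintegral_map hF.lintegral_prod_left' hV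
    _ = ∫⁻ ω', ∫⁻ ω, F (U ω, V ω') ∂μ ∂μ :=
        lintegral_congr fun ω' => lintegral_map (hF.comp measurable_prodMk_right) hU

variable {ι : Type*}

/-- Independent variables with mean zero, unit variance and `E exp (Z² / t²) ≤ 2`. -/
structure SubgaussianFamily (μ : Measure S) (t : ℝ) (Z : ι → S → ℝ) : Prop where
  measurable : ∀ i, Measurable (Z i)
  indep : iIndepFun Z μ
  mean : ∀ i, ∫ ω, Z i ω ∂μ = 0
  variance : ∀ i, ∫ ω, Z i ω ^ 2 ∂μ = 1
  tail : ∀ i, ∫⁻ ω, eexp (Z i ω ^ 2 / t ^ 2) ∂μ ≤ 2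
  pos : 0 < t

variable {t : ℝ} {Z : ι → S → ℝ}

theorem SubgaussianFamily.lintegral_eexp_sum_comp_eq (h : SubgaussianFamily μ t Z) (s : Finset ι)
    {f : ι → ℝ → ℝ} (hf : ∀ i, Measurable (f i)) :
    ∫⁻ ω, eexp (∑ i ∈ s, f i (Z i ω)) ∂μ = ∏ i ∈ s, ∫⁻ ω, eexp (f i (Z i ω)) ∂μ := by
  simp only [eexp_sum]
  exact lintegral_prod_eq_prod_lintegral_of_indepFun s (fun i ω => eexp (f i (Z i ω)))
    (h.indep.comp (fun i x => eexp (f i x)) fun i => measurable_eexp.comp (hf i))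
    fun i => measurable_eexp.comp ((hf i).comp (h.measurable i))

variable [IsProbabilityMeasure μ]

theorem SubgaussianFamily.lintegral_eexp_sum_le (h : SubgaussianFamily μ t Z) (s : Finset ι)
    (a : ι → ℝ) :
    ∫⁻ ω, eexp (∑ i ∈ s, a i * Z i ω) ∂μ ≤ eexp (t ^ 2 * ∑ i ∈ s, a i ^ 2) := by
  rw [h.lintegral_eexp_sum_comp_eq s fun i => measurable_const_mul (a i), Finset.mul_sum, eexp_sum]
  refine Finset.prod_le_prod' fun i _ => ?_
  rw [mul_comm (t ^ 2)]
  exact lintegral_eexp_mul_le (h.measurable i) h.pos (h.mean i) (h.tail i) (a i)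

theorem SubgaussianFamily.lintegral_eexp_sum_mul_sq_sub_one_le (h : SubgaussianFamily μ t Z)
    (s : Finset ι) (a : ι → ℝ) (ha : ∀ i ∈ s, |a i| * t ^ 2 ≤ 1 / 4) :
    ∫⁻ ω, eexp (∑ i ∈ s, a i * (Z i ω ^ 2 - 1)) ∂μ ≤ eexp (48 * t ^ 4 * ∑ i ∈ s, a i ^ 2) := by
  rw [h.lintegral_eexp_sum_comp_eq s (f := fun i x => a i * (x ^ 2 - 1)) fun i => by fun_prop,
    Finset.mul_sum, eexp_sum]
  exact Finset.prod_le_prod' fun i hi => (lintegral_eexp_mul_sq_sub_one_le (h.measurable i) h.pos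
    (h.variance i) (h.tail i) (ha i hi)).trans (eexp_mono (by linarith))

end Independent

/-! ### The Hanson–Wright inequality -/

section HansonWright

open Matrix

section Convexity

variable {S κ : Type*} [MeasurableSpace S] {μ : Measure S} {s : Finset κ} {w : κ → ℝ}

theorem eexp_sum_mul_le (hw : ∀ k ∈ s, 0 ≤ w k) (hsum : ∑ k ∈ s, w k = 1) (x : κ → ℝ) :
    eexp (∑ k ∈ s, w k * x k) ≤ ∑ k ∈ s, ENNReal.ofReal (w k) * eexp (x k) := by
  have hjensen := convexOn_exp.map_sum_le (p := x) hw hsum fun _ _ => Set.mem_univ _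
  simp only [smul_eq_mul] at hjensen
  refine (ENNReal.ofReal_le_ofReal hjensen).trans_eq ?_
  rw [ENNReal.ofReal_sum_of_nonneg fun k hk => mul_nonneg (hw k hk) (Real.exp_pos _).le]
  exact Finset.sum_congr rfl fun k hk => ENNReal.ofReal_mul (hw k hk)

theorem lintegral_eexp_sum_mul_le_of_forall_le (hw : ∀ k ∈ s, 0 ≤ w k) (hsum : ∑ k ∈ s, w k = 1)
    {f : κ → S → ℝ} (hf : ∀ k ∈ s, Measurable (f k)) {M : ENNReal}
    (hM : ∀ k ∈ s, ∫⁻ ω, eexp (f k ω) ∂μ ≤ M) :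
    ∫⁻ ω, eexp (∑ k ∈ s, w k * f k ω) ∂μ ≤ M := by
  have hmeas k (hk : k ∈ s) : AEMeasurable (fun ω => ENNReal.ofReal (w k) * eexp (f k ω)) μ :=
    (measurable_eexp.comp (hf k hk)).aemeasurable.const_mul _
  calc ∫⁻ ω, eexp (∑ k ∈ s, w k * f k ω) ∂μ
      ≤ ∫⁻ ω, ∑ k ∈ s, ENNReal.ofReal (w k) * eexp (f k ω) ∂μ :=
        lintegral_mono fun ω => eexp_sum_mul_le hw hsum fun k => f k ω
    _ = ∑ k ∈ s, ENNReal.ofReal (w k) * ∫⁻ ω, eexp (f k ω) ∂μ := by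
        rw [lintegral_finsetSum' _ hmeas]
        exact Finset.sum_congr rfl fun k _ => lintegral_const_mul' _ _ ENNReal.ofReal_ne_top
    _ ≤ ∑ k ∈ s, ENNReal.ofReal (w k) * M :=
        Finset.sum_le_sum fun k hk => mul_le_mul_right (hM k hk) _
    _ = M := by
        rw [← Finset.sum_mul, ← ENNReal.ofReal_sum_of_nonneg hw, hsum, ENNReal.ofReal_one, one_mul]

end Convexity

variable {ι : Type*} [DecidableEq ι]

/-- The part of `A` with rows in `I` and columns outside `I`, whose quadratic form involves only
products of a coordinate in `I` and one outside `I`. -/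
def crossBlock (A : Matrix ι ι ℝ) (I : Finset ι) : Matrix ι ι ℝ :=
  Matrix.of fun i j => if i ∈ I ∧ j ∉ I then A i j else 0

variable [Fintype ι]

theorem card_filter_mem_and_notMem {i j : ι} (hij : i ≠ j) :
    4 * (Finset.univ.filter fun I : Finset ι => i ∈ I ∧ j ∉ I).card = 2 ^ Fintype.card ι := by
  have hfilter : (Finset.univ.filter fun I : Finset ι => i ∈ I ∧ j ∉ I)
      = Finset.Icc {i} (Finset.univ.erase j) := by
    ext I
    simp only [Finset.mem_filter, Finset.mem_univ, true_and, Finset.mem_Icc,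
      Finset.singleton_subset_iff, Finset.subset_erase, Finset.subset_univ]
  have hsub : ({i} : Finset ι) ⊆ Finset.univ.erase j := by simp [hij]
  have htwo : 2 ≤ Fintype.card ι := Finset.card_pair hij ▸ Finset.card_le_univ {i, j}
  rw [hfilter, Finset.card_Icc_finset hsub, Finset.card_erase_of_mem (Finset.mem_univ j),
    Finset.card_univ, Finset.card_singleton, Nat.sub_sub, show 4 = 2 ^ 2 from rfl, ← pow_add,
    Nat.add_sub_cancel' htwo]

theorem four_smul_sum_crossBlock (A : Matrix ι ι ℝ) :
    (4 : ℝ) • ∑ I, crossBlock A I = (2 : ℝ) ^ Fintype.card ι • (A - diagonal A.diag) := by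
  ext i j
  simp only [Matrix.smul_apply, Matrix.sum_apply, crossBlock, of_apply, Matrix.sub_apply,
    smul_eq_mul]
  rcases eq_or_ne i j with rfl | hij
  · simp
  · rw [← Finset.sum_filter, Finset.sum_const, nsmul_eq_mul, diagonal_apply_ne _ hij, sub_zero,
      ← mul_assoc]
    congr 1
    exact_mod_cast card_filter_mem_and_notMem hij

theorem crossBlock_mulVec_apply (A : Matrix ι ι ℝ) (I : Finset ι) (z : ι → ℝ) (i : ι) :
    (crossBlock A I *ᵥ z) i = if i ∈ I then ∑ j ∈ Iᶜ, A i j * z j else 0 := by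
  simp only [mulVec, dotProduct, crossBlock, of_apply]
  split_ifs with hi
  · simp [hi, Finset.sum_ite, Finset.compl_eq_univ_sdiff, Finset.filter_notMem_eq_sdiff]
  · simp [hi]

theorem dotProduct_crossBlock_mulVec (A : Matrix ι ι ℝ) (I : Finset ι) (y z : ι → ℝ) :
    y ⬝ᵥ (crossBlock A I *ᵥ z) = ∑ i ∈ I, ∑ j ∈ Iᶜ, y i * (A i j * z j) := by
  simp only [dotProduct, crossBlock_mulVec_apply, mul_ite, mul_zero, Finset.sum_ite_mem,
    Finset.univ_inter, Finset.mul_sum]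

theorem frobSq_crossBlock_le (A : Matrix ι ι ℝ) (I : Finset ι) :
    frobSq (crossBlock A I) ≤ frobSq A := by
  refine Finset.sum_le_sum fun i _ => Finset.sum_le_sum fun j _ => ?_
  simp only [crossBlock, of_apply]
  split_ifs
  · exact le_rfl
  · rw [zero_pow two_ne_zero]; positivity

theorem opNorm_crossBlock_le (A : Matrix ι ι ℝ) (I : Finset ι) :
    opNorm (crossBlock A I) ≤ opNorm A := by
  refine opNorm_le_of_dotProduct_mulVec_self_le (opNorm_nonneg A) fun x => ?_
  set y : ι → ℝ := fun j => if j ∈ I then 0 else x j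
  have hAy i : (A *ᵥ y) i = ∑ j ∈ Iᶜ, A i j * x j := by
    simp [mulVec, dotProduct, y, Finset.sum_ite, Finset.compl_eq_univ_sdiff,
      Finset.filter_notMem_eq_sdiff]
  calc (crossBlock A I *ᵥ x) ⬝ᵥ (crossBlock A I *ᵥ x)
      ≤ (A *ᵥ y) ⬝ᵥ (A *ᵥ y) := by
        refine Finset.sum_le_sum fun i _ => ?_
        rw [crossBlock_mulVec_apply, ← hAy]
        split_ifs
        · exact le_rfl
        · rw [mul_zero]; exact mul_self_nonneg _
    _ ≤ opNorm A ^ 2 * (y ⬝ᵥ y) := dotProduct_mulVec_self_le A y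
    _ ≤ opNorm A ^ 2 * (x ⬝ᵥ x) := by
        refine mul_le_mul_of_nonneg_left (Finset.sum_le_sum fun i _ => ?_) (sq_nonneg _)
        simp only [y]
        split_ifs
        · rw [mul_zero]; exact mul_self_nonneg _
        · exact le_rfl

variable {S : Type*} [MeasurableSpace S] {μ : Measure S} [IsProbabilityMeasure μ] {t : ℝ}
  {Z : ι → S → ℝ}

theorem lintegral_eexp_crossBlock_eq (hZ : ∀ i, Measurable (Z i)) (hind : iIndepFun Z μ) (a : ℝ)
    (A : Matrix ι ι ℝ) (I : Finset ι) :
    ∫⁻ ω, eexp (a * ((fun i => Z i ω) ⬝ᵥ (crossBlock A I *ᵥ fun i => Z i ω))) ∂μ =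
      ∫⁻ ω', ∫⁻ ω, eexp (a * ((fun i => Z i ω) ⬝ᵥ (crossBlock A I *ᵥ fun i => Z i ω'))) ∂μ ∂μ := by
  have hform (y z : ι → ℝ) : y ⬝ᵥ (crossBlock A I *ᵥ z) =
      ∑ i : I, ∑ j : (Iᶜ : Finset ι), y i * (A i j * z j) := by
    rw [dotProduct_crossBlock_mulVec, ← Finset.sum_coe_sort]
    exact Finset.sum_congr rfl fun i _ => (Finset.sum_coe_sort _ _).symm
  simp_rw [hform]
  exact lintegral_comp_prod_of_indepFun (by fun_prop) (by fun_prop)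
    (hind.indepFun_finset I Iᶜ disjoint_compl_right hZ)
    (F := fun z => eexp (a * ∑ i : I, ∑ j : (Iᶜ : Finset ι), z.1 i * (A i j * z.2 j)))
    (by fun_prop)

namespace SubgaussianFamily

theorem lintegral_eexp_crossBlock_le (h : SubgaussianFamily μ t Z) {A : Matrix ι ι ℝ} {a : ℝ}
    (haA : 8 * a ^ 2 * t ^ 4 * opNorm A ^ 2 ≤ 1) (I : Finset ι) :
    ∫⁻ ω, eexp (a * ((fun i => Z i ω) ⬝ᵥ (crossBlock A I *ᵥ fun i => Z i ω))) ∂μ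
      ≤ eexp (4 * a ^ 2 * t ^ 4 * frobSq A) := by
  have hop : 8 * (a ^ 2 * t ^ 2) * t ^ 2 * opNorm (crossBlock A I) ^ 2 ≤ 1 :=
    calc 8 * (a ^ 2 * t ^ 2) * t ^ 2 * opNorm (crossBlock A I) ^ 2
        = 8 * a ^ 2 * t ^ 4 * opNorm (crossBlock A I) ^ 2 := by ring
      _ ≤ 8 * a ^ 2 * t ^ 4 * opNorm A ^ 2 := by
        have := opNorm_nonneg (crossBlock A I)
        gcongr
        exact opNorm_crossBlock_le A I
      _ ≤ 1 := haA
  rw [lintegral_eexp_crossBlock_eq h.measurable h.indep]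
  calc ∫⁻ ω', ∫⁻ ω, eexp (a * ((fun i => Z i ω) ⬝ᵥ (crossBlock A I *ᵥ fun i => Z i ω'))) ∂μ ∂μ
      ≤ ∫⁻ ω', eexp (a ^ 2 * t ^ 2 * ((crossBlock A I *ᵥ fun i => Z i ω') ⬝ᵥ
          (crossBlock A I *ᵥ fun i => Z i ω'))) ∂μ := by
        refine lintegral_mono fun ω' => ?_
        refine le_of_eq_of_le (lintegral_congr fun ω => ?_) ((h.lintegral_eexp_sum_le Finset.univ
          (a • (crossBlock A I *ᵥ fun i => Z i ω'))).trans_eq ?_)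
        · rw [dotProduct_comm, ← smul_eq_mul, ← smul_dotProduct, dotProduct]
        · simp only [Pi.smul_apply, smul_eq_mul, dotProduct, Finset.mul_sum]
          congr! 2
          ring
    _ ≤ eexp (4 * (a ^ 2 * t ^ 2) * t ^ 2 * frobSq (crossBlock A I)) :=
        lintegral_eexp_norm_mulVec_sq_le h.measurable (h.lintegral_eexp_sum_le Finset.univ) _
          (by positivity) hop
    _ ≤ eexp (4 * a ^ 2 * t ^ 4 * frobSq A) := by
        refine eexp_mono (le_of_eq_of_le (by ring) (mul_le_mul_of_nonneg_left
          (frobSq_crossBlock_le A I) (by positivity : 0 ≤ 4 * a ^ 2 * t ^ 4)))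

theorem lintegral_eexp_offDiag_le (h : SubgaussianFamily μ t Z) {A : Matrix ι ι ℝ} {a : ℝ}
    (haA : 128 * a ^ 2 * t ^ 4 * opNorm A ^ 2 ≤ 1) :
    ∫⁻ ω, eexp (a * ((fun i => Z i ω) ⬝ᵥ ((A - diagonal A.diag) *ᵥ fun i => Z i ω))) ∂μ
      ≤ eexp (64 * a ^ 2 * t ^ 4 * frobSq A) := by
  have hm := h.measurable
  have haverage (z : ι → ℝ) : a * (z ⬝ᵥ ((A - diagonal A.diag) *ᵥ z)) =
      ∑ I, ((2 : ℝ) ^ Fintype.card ι)⁻¹ * (4 * a * (z ⬝ᵥ (crossBlock A I *ᵥ z))) := by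
    have hsmul := congrArg (fun B => z ⬝ᵥ (B *ᵥ z)) (four_smul_sum_crossBlock A)
    simp only [smul_mulVec, dotProduct_smul, smul_eq_mul, sum_mulVec, dotProduct_sum] at hsmul
    rw [← Finset.mul_sum, ← Finset.mul_sum, mul_right_comm, hsmul]
    field_simp
  simp_rw [haverage]
  refine lintegral_eexp_sum_mul_le_of_forall_le (fun _ _ => by positivity) (by simp)
    (fun I _ => ?_) fun I _ => ?_
  · simp only [mulVec, dotProduct]
    fun_prop
  · refine (h.lintegral_eexp_crossBlock_le (a := 4 * a) (by nlinarith) I).trans_eq ?_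
    congr 1
    ring

theorem lintegral_eexp_diag_le (h : SubgaussianFamily μ t Z) {A : Matrix ι ι ℝ} {a : ℝ}
    (haA : 4 * |a| * t ^ 2 * opNorm A ≤ 1) :
    ∫⁻ ω, eexp (a * ((fun i => Z i ω) ⬝ᵥ (diagonal A.diag *ᵥ fun i => Z i ω) - A.trace)) ∂μ
      ≤ eexp (48 * a ^ 2 * t ^ 4 * frobSq A) := by
  have hform (z : ι → ℝ) : a * (z ⬝ᵥ (diagonal A.diag *ᵥ z) - A.trace) =
      ∑ i, a * A i i * (z i ^ 2 - 1) := by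
    simp only [dotProduct, mulVec_diagonal, trace, diag_apply, ← Finset.sum_sub_distrib,
      Finset.mul_sum]
    exact Finset.sum_congr rfl fun i _ => by ring
  simp_rw [hform]
  refine (h.lintegral_eexp_sum_mul_sq_sub_one_le Finset.univ _ fun i _ => ?_).trans
    (eexp_mono ?_)
  · calc |a * A i i| * t ^ 2 ≤ |a| * opNorm A * t ^ 2 := by
          rw [abs_mul]; gcongr; exact abs_diag_le_opNorm A i
      _ ≤ 1 / 4 := by linarith
  · calc 48 * t ^ 4 * ∑ i, (a * A i i) ^ 2 = 48 * a ^ 2 * t ^ 4 * ∑ i, A i i ^ 2 := by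
          simp only [mul_pow, ← Finset.mul_sum]; ring
      _ ≤ 48 * a ^ 2 * t ^ 4 * frobSq A := by
          refine mul_le_mul_of_nonneg_left (Finset.sum_le_sum fun i _ => ?_) (by positivity)
          exact Finset.single_le_sum (f := fun j => A i j ^ 2) (fun j _ => sq_nonneg _)
            (Finset.mem_univ i)

theorem lintegral_eexp_quadratic_le (h : SubgaussianFamily μ t Z) {A : Matrix ι ι ℝ} {a : ℝ}
    (haA : 32 * |a| * t ^ 2 * opNorm A ≤ 1) :
    ∫⁻ ω, eexp (a * ((fun i => Z i ω) ⬝ᵥ (A *ᵥ fun i => Z i ω) - A.trace)) ∂μ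
      ≤ eexp (256 * a ^ 2 * t ^ 4 * frobSq A) := by
  have hm := h.measurable
  have hnonneg : 0 ≤ |a| * t ^ 2 * opNorm A := by have := opNorm_nonneg A; positivity
  have hfrob : 0 ≤ a ^ 2 * t ^ 4 * frobSq A := by have := frobSq_nonneg A; positivity
  have hsq : (|a| * t ^ 2 * opNorm A) ^ 2 = a ^ 2 * t ^ 4 * opNorm A ^ 2 := by
    rw [mul_pow, mul_pow, sq_abs]; ring
  have hsplit (z : ι → ℝ) : a * (z ⬝ᵥ (A *ᵥ z) - A.trace) =
      ∑ k : Fin 2, 1 / 2 * ![2 * a * (z ⬝ᵥ (diagonal A.diag *ᵥ z) - A.trace),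
        2 * a * (z ⬝ᵥ ((A - diagonal A.diag) *ᵥ z))] k := by
    simp [sub_mulVec, dotProduct_sub]
    ring
  simp_rw [hsplit]
  refine lintegral_eexp_sum_mul_le_of_forall_le
    (f := fun k ω => ![2 * a * ((fun i => Z i ω) ⬝ᵥ (diagonal A.diag *ᵥ fun i => Z i ω) - A.trace),
        2 * a * ((fun i => Z i ω) ⬝ᵥ ((A - diagonal A.diag) *ᵥ fun i => Z i ω))] k)
    (fun _ _ => by positivity) (by simp) ?_ ?_
  · simp only [Finset.mem_univ, forall_const, Fin.forall_fin_two, mulVec, dotProduct]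
    constructor <;> simp only [cons_val_zero, cons_val_one, cons_val_fin_one] <;> fun_prop
  · simp only [Finset.mem_univ, forall_const, Fin.forall_fin_two]
    refine ⟨(h.lintegral_eexp_diag_le (a := 2 * a) ?_).trans (eexp_mono (by linarith)),
      (h.lintegral_eexp_offDiag_le (a := 2 * a) ?_).trans (eexp_mono (by linarith))⟩
    · rw [abs_mul, abs_two]; linarith
    · nlinarith

end SubgaussianFamily

end HansonWright

/-! ### Norms of random vectors from exponential moments of linear functionals -/

section RandomVector

variable {S : Type*} [MeasurableSpace S] {μ : Measure S}

theorem measure_le_of_lintegral_eexp_le {f : S → ℝ} (hf : Measurable f) {a b : ℝ}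
    (h : ∫⁻ ω, eexp (f ω) ∂μ ≤ eexp b) : μ {ω | a ≤ f ω} ≤ eexp (b - a) := by
  have hsub : {ω | a ≤ f ω} ⊆ {ω | eexp a ≤ eexp (f ω)} := fun ω hω => eexp_mono hω
  calc μ {ω | a ≤ f ω} = eexp (-a) * (eexp a * μ {ω | a ≤ f ω}) := by
        rw [← mul_assoc, mul_comm (eexp (-a)), eexp_mul_eexp_neg, one_mul]
    _ ≤ eexp (-a) * eexp b := by
        gcongr
        exact (mul_le_mul_right (measure_mono hsub) _).trans
          ((mul_meas_ge_le_lintegral (by fun_prop) _).trans h)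
    _ = eexp (b - a) := by rw [← eexp_add]; congr 1; ring

open Metric Module

variable {E : Type*} [NormedAddCommGroup E] [InnerProductSpace ℝ E]

theorem exists_closedBall_subset_forall_le_inner {R : ℝ} (hR : 0 ≤ R) (x : E) :
    ∃ v₀ : E, closedBall v₀ (R / 4) ⊆ closedBall 0 R ∧
      ∀ v ∈ closedBall v₀ (R / 4), R / 4 * ‖x‖ ≤ inner ℝ v x := by
  set v₀ : E := (R / 2 * ‖x‖⁻¹) • x
  have hnorm : ‖v₀‖ ≤ R / 2 := by
    rw [norm_smul, Real.norm_of_nonneg (by positivity), mul_assoc]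
    exact mul_le_of_le_one_right (by positivity) inv_mul_le_one
  have hinner : inner ℝ v₀ x = R / 2 * ‖x‖ := by
    rw [real_inner_smul_left, real_inner_self_eq_norm_sq]
    rcases eq_or_ne ‖x‖ 0 with hx | hx
    · simp [hx]
    · field_simp
  refine ⟨v₀, closedBall_subset_closedBall' ?_, fun v hv => ?_⟩
  · rw [dist_zero_right]; linarith
  · have hcs := abs_le.1 (abs_real_inner_le_norm (v - v₀) x)
    have hle : ‖v - v₀‖ * ‖x‖ ≤ R / 4 * ‖x‖ := by
      gcongr; exact mem_closedBall_iff_norm.1 hv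
    rw [inner_sub_left, hinner] at hcs
    linarith [hcs.1]

variable [FiniteDimensional ℝ E] [MeasurableSpace E] [BorelSpace E]

theorem volume_closedBall_div_four {R : ℝ} (hR : 0 ≤ R) (x : E) :
    4 ^ finrank ℝ E * volume (closedBall x (R / 4)) = volume (closedBall (0 : E) R) := by
  have hfour : (4 : ENNReal) ^ finrank ℝ E = ENNReal.ofReal (4 ^ finrank ℝ E) := by
    rw [ENNReal.ofReal_pow (by norm_num)]; simp
  rw [Measure.addHaar_closedBall volume x (by positivity), Measure.addHaar_closedBall volume 0 hR,
    ← mul_assoc, hfour, ← ENNReal.ofReal_mul (by positivity), ← mul_pow,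
    mul_div_cancel₀ R (by norm_num)]

theorem volume_mul_eexp_norm_le_lintegral {R : ℝ} (hR : 0 ≤ R) (x : E) :
    volume (closedBall (0 : E) R) * eexp (R / 4 * ‖x‖) ≤
      4 ^ finrank ℝ E * ∫⁻ v in closedBall (0 : E) R, eexp (inner ℝ v x) := by
  obtain ⟨v₀, hsub, hle⟩ := exists_closedBall_subset_forall_le_inner hR x
  rw [← volume_closedBall_div_four hR v₀, mul_assoc]
  gcongr 4 ^ finrank ℝ E * ?_
  calc volume (closedBall v₀ (R / 4)) * eexp (R / 4 * ‖x‖)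
      = ∫⁻ _ in closedBall v₀ (R / 4), eexp (R / 4 * ‖x‖) := by rw [setLIntegral_const, mul_comm]
    _ ≤ ∫⁻ v in closedBall v₀ (R / 4), eexp (inner ℝ v x) :=
        setLIntegral_mono' measurableSet_closedBall fun v hv => eexp_mono (hle v hv)
    _ ≤ ∫⁻ v in closedBall (0 : E) R, eexp (inner ℝ v x) := lintegral_mono_set hsub

/-- Averaging over a ball replaces the usual union bound over a net of the sphere. -/
theorem lintegral_eexp_norm_le [SFinite μ] {N : S → E} (hN : Measurable N) {R : ℝ} (hR : 0 < R)
    {M : ENNReal} (h : ∀ v : E, ‖v‖ ≤ R → ∫⁻ ω, eexp (inner ℝ v (N ω)) ∂μ ≤ M) :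
    ∫⁻ ω, eexp (R / 4 * ‖N ω‖) ∂μ ≤ 4 ^ finrank ℝ E * M := by
  have hpos : volume (closedBall (0 : E) R) ≠ 0 := (measure_closedBall_pos volume _ hR).ne'
  have hfin : volume (closedBall (0 : E) R) ≠ ⊤ := measure_closedBall_lt_top.ne
  have hmeas : Measurable (Function.uncurry fun (ω : S) (v : E) => eexp (inner ℝ v (N ω))) :=
    measurable_eexp.comp (measurable_snd.inner (hN.comp measurable_fst))
  refine (ENNReal.mul_le_mul_iff_right hpos hfin).1 ?_
  calc volume (closedBall (0 : E) R) * ∫⁻ ω, eexp (R / 4 * ‖N ω‖) ∂μ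
      ≤ ∫⁻ ω, 4 ^ finrank ℝ E * (∫⁻ v in closedBall (0 : E) R, eexp (inner ℝ v (N ω))) ∂μ := by
        rw [← lintegral_const_mul' _ _ hfin]
        exact lintegral_mono fun ω => volume_mul_eexp_norm_le_lintegral hR.le (N ω)
    _ = 4 ^ finrank ℝ E * ∫⁻ v in closedBall (0 : E) R, ∫⁻ ω, eexp (inner ℝ v (N ω)) ∂μ := by
        rw [lintegral_const_mul' _ _ (by simp), lintegral_lintegral_swap hmeas.aemeasurable]
    _ ≤ 4 ^ finrank ℝ E * ∫⁻ _ in closedBall (0 : E) R, M := by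
        gcongr 4 ^ finrank ℝ E * ?_
        exact setLIntegral_mono' measurableSet_closedBall fun v hv =>
          h v (mem_closedBall_zero_iff.1 hv)
    _ = volume (closedBall (0 : E) R) * (4 ^ finrank ℝ E * M) := by rw [setLIntegral_const]; ring

end RandomVector

/-! ### Strong convexity of the negative log-determinant -/

section LogDet

open Matrix

theorem log_one_add_le_sub_sq_div_four {e : ℝ} (hneg : -1 < e) (hone : e ≤ 1) :
    Real.log (1 + e) ≤ e - e ^ 2 / 4 := by
  rcases le_total 0 e with hnonneg | hnonpos
  · have hsq : e ^ 2 * (9 / 16) ≤ (e - e ^ 2 / 4) ^ 2 := by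
      rw [show (e - e ^ 2 / 4) ^ 2 = e ^ 2 * (1 - e / 4) ^ 2 by ring]
      gcongr
      nlinarith
    rw [Real.log_le_iff_le_exp (by linarith)]
    nlinarith [Real.quadratic_le_exp_of_nonneg (x := e - e ^ 2 / 4) (by nlinarith), sq_nonneg e]
  · have hseries := Real.hasSum_pow_div_log_of_abs_lt_one (x := -e)
      (by rw [abs_neg, abs_of_nonpos hnonpos]; linarith)
    have hterm (n : ℕ) (_ : n ∉ Finset.range 2) : 0 ≤ (-e) ^ (n + 1) / ((n : ℝ) + 1) := by
      have : 0 ≤ -e := by linarith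
      positivity
    have hpartial := sum_le_hasSum (Finset.range 2) hterm hseries
    norm_num [Finset.sum_range_succ] at hpartial
    nlinarith [sq_nonneg e]

theorem mul_sq_div_four_le_sub_log_one_add {e θ : ℝ} (hneg : -1 < e) (hθ : θ ≤ 1)
    (hθe : θ * |e| ≤ 1) : θ * e ^ 2 / 4 ≤ e - Real.log (1 + e) := by
  rcases le_total e 1 with hle | hge
  · nlinarith [log_one_add_le_sub_sq_div_four hneg hle, sq_nonneg e]
  · have hlog : Real.log ((1 + e) / 2) ≤ (1 + e) / 2 - 1 :=
      Real.log_le_sub_one_of_pos (by linarith)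
    rw [Real.log_div (by linarith) two_ne_zero] at hlog
    rw [abs_of_pos (by linarith)] at hθe
    have hsq : θ * e ^ 2 ≤ e := by nlinarith
    linarith [Real.log_two_lt_d9]

variable {ι : Type*} [Fintype ι] [DecidableEq ι] {A D E : Matrix ι ι ℝ} {θ : ℝ}

theorem det_one_add_eq_prod_eigenvalues (hE : E.IsHermitian) :
    (1 + E).det = ∏ l, (1 + hE.eigenvalues l) := by
  obtain ⟨U, hUU, hUU_comm, hE_eq⟩ := exists_orthogonal_diagonalization hE
  have hdiag : 1 + E = U * (1 + diagonal hE.eigenvalues) * Uᵀ := by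
    rw [mul_add, add_mul, mul_one, hUU_comm, ← hE_eq]
  rw [hdiag, det_mul_comm, ← mul_assoc, hUU, one_mul, ← diagonal_one, diagonal_add, det_diagonal]

theorem frobSq_eq_sum_eigenvalues_sq (hE : E.IsHermitian) :
    frobSq E = ∑ l, hE.eigenvalues l ^ 2 := by
  obtain ⟨U, hUU, _, hE_eq⟩ := exists_orthogonal_diagonalization hE
  have hsq : E * E = U * (diagonal hE.eigenvalues * diagonal hE.eigenvalues) * Uᵀ := by
    calc E * E = U * diagonal hE.eigenvalues * (Uᵀ * U) * diagonal hE.eigenvalues * Uᵀ := by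
          conv_lhs => rw [hE_eq]
          simp only [Matrix.mul_assoc]
      _ = U * (diagonal hE.eigenvalues * diagonal hE.eigenvalues) * Uᵀ := by
          rw [hUU, mul_one]; simp only [Matrix.mul_assoc]
  rw [frobSq_eq_trace, (isHermitian_iff_isSymm.1 hE).eq, hsq, trace_mul_cycle, hUU, one_mul,
    diagonal_mul_diagonal, trace_diagonal]
  exact Finset.sum_congr rfl fun l _ => (sq _).symm

theorem neg_one_lt_eigenvalues (hpos : (1 + E).PosDef) (hE : E.IsHermitian) (l : ι) :
    -1 < hE.eigenvalues l := by
  set u : ι → ℝ := ⇑(hE.eigenvectorBasis l)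
  have hunit : u ⬝ᵥ u = 1 := by
    rw [dotProduct_self_eq_norm_sq]
    simp [u, hE.eigenvectorBasis.orthonormal.1 l]
  have hquad := hpos.dotProduct_mulVec_pos (x := u) fun hu => by simp [hu] at hunit
  rw [star_trivial, add_mulVec, one_mulVec, hE.mulVec_eigenvectorBasis l, dotProduct_add,
    dotProduct_smul, hunit, smul_eq_mul, mul_one] at hquad
  linarith

theorem log_det_one_add_le (hpos : (1 + E).PosDef) (hθ_nonneg : 0 ≤ θ) (hθ_le : θ ≤ 1)
    (hθ : θ * opNorm E ≤ 1) : θ * frobSq E / 4 ≤ E.trace - Real.log (1 + E).det := by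
  have hE : E.IsHermitian := by simpa using hpos.isHermitian.sub isHermitian_one
  have hev := neg_one_lt_eigenvalues hpos hE
  have htrace : E.trace = ∑ l, hE.eigenvalues l := by simpa using hE.trace_eq_sum_eigenvalues
  rw [htrace, det_one_add_eq_prod_eigenvalues hE, Real.log_prod fun l _ => by linarith [hev l],
    ← Finset.sum_sub_distrib, frobSq_eq_sum_eigenvalues_sq hE, Finset.mul_sum, Finset.sum_div]
  refine Finset.sum_le_sum fun l _ =>
    mul_sq_div_four_le_sub_log_one_add (hev l) hθ_le (hθ.trans' ?_)
  gcongr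
  exact abs_eigenvalues_le_opNorm hE l

theorem det_add_eq_det_mul_of_conj_eq_one {R : Matrix ι ι ℝ} (hR : R * A * R = 1) :
    (A + D).det = A.det * (1 + R * D * R).det := by
  have hdet : A.det * (R.det * R.det) = 1 := by
    rw [← det_one (n := ι), ← hR, det_mul, det_mul]
    ring
  rw [← hR, ← add_mul, ← mul_add, det_mul, det_mul]
  linear_combination (-(A + D).det) * hdet

/-- Conjugating by `A^{-1/2}` reduces to the expansion at the identity; `θ = 1` gives strong
convexity near `A`, and small `θ` covers distant arguments. -/
theorem mul_frobSq_le_log_det_sub (hA : A.PosDef) (hAD : (A + D).PosDef)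
    (hθ_nonneg : 0 ≤ θ) (hθ_le : θ ≤ 1) (hθ : θ * (opNorm A⁻¹ * opNorm D) ≤ 1) :
    θ * frobSq D ≤ 4 * opNorm A ^ 2 *
      (Real.log A.det - Real.log (A + D).det + (A⁻¹ * D).trace) := by
  obtain ⟨R, Q, hR, hQ, hRR, hQQ, hRQ, hQR⟩ := exists_isSymm_sqrt hA
  set E := R * D * R
  have hRAR : R * A * R = 1 := by
    rw [← hQQ, ← Matrix.mul_assoc R, hRQ, one_mul, hQR]
  have hconj : 1 + E = R * (A + D) * R := by
    rw [mul_add, add_mul, hRAR]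
  have hpos : (1 + E).PosDef := by
    have hinj : Function.Injective R.mulVec :=
      mulVec_injective_of_isUnit (IsUnit.of_mul_eq_one Q hRQ)
    simpa [hconj, conjTranspose_eq_transpose_of_trivial, hR.eq] using
      hAD.conjTranspose_mul_mul_same hinj
  have hopE : opNorm E ≤ opNorm A⁻¹ * opNorm D := by
    simpa only [hR.eq, hRR] using opNorm_conj_le R D
  have hfrob : frobSq D ≤ opNorm A ^ 2 * frobSq E := by
    have hD : Qᵀ * E * Q = D := by
      rw [hQ.eq]
      calc Q * (R * D * R) * Q = (Q * R) * D * (R * Q) := by simp only [Matrix.mul_assoc]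
        _ = D := by rw [hQR, hRQ, one_mul, mul_one]
    calc frobSq D = frobSq (Qᵀ * E * Q) := by rw [hD]
      _ ≤ opNorm A ^ 2 * frobSq E := by simpa only [hQ.eq, hQQ] using frobSq_conj_le Q E
  have htrace : E.trace = (A⁻¹ * D).trace := by rw [trace_mul_cycle, hRR]
  rw [det_add_eq_det_mul_of_conj_eq_one hRAR, Real.log_mul hA.det_pos.ne' hpos.det_pos.ne',
    ← htrace]
  calc θ * frobSq D ≤ θ * (opNorm A ^ 2 * frobSq E) := by gcongr
    _ = 4 * opNorm A ^ 2 * (θ * frobSq E / 4) := by ring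
    _ ≤ 4 * opNorm A ^ 2 * (E.trace - Real.log (1 + E).det) := by
        gcongr
        exact log_det_one_add_le hpos hθ_nonneg hθ_le (hθ.trans' (by gcongr))
    _ = _ := by ring

end LogDet

/-! ### Kronecker sums -/

section Kronecker

variable {L : ℕ} {d : Fin L → ℕ}

open Matrix

/-- `I ⊗ ⋯ ⊗ I ⊗ A ⊗ I ⊗ ⋯ ⊗ I` with `A` in position `k`, the building block of Kronecker sums. -/
def modeEmbed (k : Fin L) (A : Matrix (Fin (d k)) (Fin (d k)) ℝ) : Matrix (Idx d) (Idx d) ℝ :=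
  kronProd (Function.update (fun _ => 1) k A)

theorem kronSum_eq_sum (B : (k : Fin L) → Matrix (Fin (d k)) (Fin (d k)) ℝ) :
    kronSum B = ∑ k, modeEmbed k (B k) := rfl

theorem modeEmbed_apply (k : Fin L) (A : Matrix (Fin (d k)) (Fin (d k)) ℝ) (i j : Idx d) :
    modeEmbed k A i j = if ∀ l, l ≠ k → i l = j l then A (i k) (j k) else 0 := by
  simp only [modeEmbed, kronProd, of_apply]
  rw [← Finset.mul_prod_erase _ _ (Finset.mem_univ k), Function.update_self]
  have hother : ∀ l ∈ Finset.univ.erase k,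
      Function.update (fun l => (1 : Matrix (Fin (d l)) (Fin (d l)) ℝ)) k A l (i l) (j l)
        = if i l = j l then 1 else 0 := fun l hl => by
    rw [Function.update_of_ne (Finset.ne_of_mem_erase hl), one_apply]
  rw [Finset.prod_congr rfl hother, Finset.prod_ite_zero]
  simp

/-- The multi-index with `a` in position `k` and `c` in the other positions. It identifies
multi-indices with pairs of a row index and a column index of the mode-`k` unfolding. -/
def joinAt (k : Fin L) (a : Fin (d k)) (c : (l : {l : Fin L // l ≠ k}) → Fin (d l)) : Idx d :=
  (Equiv.piSplitAt k fun l => Fin (d l)).symm (a, c)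

theorem joinAt_self (k : Fin L) (a : Fin (d k)) (c : (l : {l : Fin L // l ≠ k}) → Fin (d l)) :
    joinAt k a c k = a := by
  simp [joinAt, Equiv.piSplitAt]

theorem joinAt_of_ne {k l : Fin L} (h : l ≠ k) (a : Fin (d k))
    (c : (l : {l : Fin L // l ≠ k}) → Fin (d l)) : joinAt k a c l = c ⟨l, h⟩ := by
  simp [joinAt, Equiv.piSplitAt, h]

theorem joinAt_inj {k : Fin L} {a b : Fin (d k)} {c c' : (l : {l : Fin L // l ≠ k}) → Fin (d l)} :
    joinAt k a c = joinAt k b c' ↔ a = b ∧ c = c' := by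
  rw [joinAt, joinAt, (Equiv.piSplitAt k fun l => Fin (d l)).symm.injective.eq_iff, Prod.mk.injEq]

theorem exists_eq_joinAt (k : Fin L) (i : Idx d) : ∃ a c, i = joinAt k a c :=
  ⟨_, _, ((Equiv.piSplitAt k fun l => Fin (d l)).symm_apply_apply i).symm⟩

theorem sum_idx_eq {M : Type*} [AddCommMonoid M] (k : Fin L) (f : Idx d → M) :
    ∑ i, f i = ∑ c, ∑ a, f (joinAt k a c) := by
  rw [← (Equiv.piSplitAt k fun l => Fin (d l)).symm.sum_comp, Fintype.sum_prod_type,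
    Finset.sum_comm]
  rfl

theorem modeEmbed_joinAt (k : Fin L) (A : Matrix (Fin (d k)) (Fin (d k)) ℝ) (a b : Fin (d k))
    (c c' : (l : {l : Fin L // l ≠ k}) → Fin (d l)) :
    modeEmbed k A (joinAt k a c) (joinAt k b c') = if c = c' then A a b else 0 := by
  rw [modeEmbed_apply, joinAt_self, joinAt_self]
  refine if_congr ⟨fun h => ?_, fun h l hl => ?_⟩ rfl rfl
  · ext ⟨l, hl⟩
    rw [← joinAt_of_ne hl a c, ← joinAt_of_ne hl b c', h l hl]
  · rw [joinAt_of_ne hl, joinAt_of_ne hl, h]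

theorem modeEmbed_add (k : Fin L) (A B : Matrix (Fin (d k)) (Fin (d k)) ℝ) :
    modeEmbed k (A + B) = modeEmbed k A + modeEmbed k B := by
  ext i j
  simp only [modeEmbed_apply, Matrix.add_apply]
  split_ifs <;> simp

theorem modeEmbed_smul (k : Fin L) (r : ℝ) (A : Matrix (Fin (d k)) (Fin (d k)) ℝ) :
    modeEmbed k (r • A) = r • modeEmbed k A := by
  ext i j
  simp only [modeEmbed_apply, Matrix.smul_apply]
  split_ifs <;> simp

theorem modeEmbed_sum {κ : Type*} (k : Fin L) (s : Finset κ)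
    (A : κ → Matrix (Fin (d k)) (Fin (d k)) ℝ) :
    modeEmbed k (∑ i ∈ s, A i) = ∑ i ∈ s, modeEmbed k (A i) := by
  ext i j
  simp only [modeEmbed_apply, Matrix.sum_apply]
  split_ifs <;> simp

theorem modeEmbed_one (k : Fin L) :
    modeEmbed k (1 : Matrix (Fin (d k)) (Fin (d k)) ℝ) = 1 := by
  ext i j
  obtain ⟨a, c, rfl⟩ := exists_eq_joinAt k i
  obtain ⟨b, c', rfl⟩ := exists_eq_joinAt k j
  rw [modeEmbed_joinAt, one_apply, one_apply, ← ite_and]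
  exact if_congr (and_comm.trans joinAt_inj.symm) rfl rfl

theorem modeEmbed_transpose (k : Fin L) (A : Matrix (Fin (d k)) (Fin (d k)) ℝ) :
    (modeEmbed k A)ᵀ = modeEmbed k Aᵀ := by
  ext i j
  simp only [transpose_apply, modeEmbed_apply]
  exact if_congr ⟨fun h l hl => (h l hl).symm, fun h l hl => (h l hl).symm⟩ rfl rfl

theorem modeEmbed_mul (k : Fin L) (A B : Matrix (Fin (d k)) (Fin (d k)) ℝ) :
    modeEmbed k A * modeEmbed k B = modeEmbed k (A * B) := by
  ext i j
  obtain ⟨a, c, rfl⟩ := exists_eq_joinAt k i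
  obtain ⟨b, c', rfl⟩ := exists_eq_joinAt k j
  rw [mul_apply, sum_idx_eq k, Finset.sum_eq_single c (fun c₂ _ hc => by
    simp only [modeEmbed_joinAt, if_neg hc.symm, zero_mul, Finset.sum_const_zero]) (by simp)]
  simp only [modeEmbed_joinAt, if_true, mul_apply]
  split_ifs <;> simp

theorem modeEmbed_mulVec_joinAt (k : Fin L) (A : Matrix (Fin (d k)) (Fin (d k)) ℝ)
    (x : Idx d → ℝ) (a : Fin (d k)) (c : (l : {l : Fin L // l ≠ k}) → Fin (d l)) :
    (modeEmbed k A *ᵥ x) (joinAt k a c) = (A *ᵥ fun b => x (joinAt k b c)) a := by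
  simp only [mulVec, dotProduct]
  rw [sum_idx_eq k, Finset.sum_eq_single c (fun c' _ hc => by
    simp only [modeEmbed_joinAt, if_neg hc.symm, zero_mul, Finset.sum_const_zero]) (by simp)]
  simp only [modeEmbed_joinAt, if_true]

theorem card_rest (k : Fin L) :
    Fintype.card ((l : {l : Fin L // l ≠ k}) → Fin (d l)) = mdim d k := by
  rw [Fintype.card_pi, mdim]
  simp only [Fintype.card_fin]
  exact (Finset.prod_subtype _ (by simp) d).symm

theorem card_idx : Fintype.card (Idx d) = pdim d := by
  rw [Fintype.card_pi, pdim]; simp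

theorem trace_modeEmbed (k : Fin L) (A : Matrix (Fin (d k)) (Fin (d k)) ℝ) :
    (modeEmbed k A).trace = mdim d k * A.trace := by
  rw [Matrix.trace, sum_idx_eq k]
  simp only [diag_apply, modeEmbed_joinAt, if_true]
  rw [Finset.sum_const, Finset.card_univ, card_rest, nsmul_eq_mul]
  rfl

theorem trace_modeEmbed_mul (k : Fin L) (A B : Matrix (Fin (d k)) (Fin (d k)) ℝ) :
    ((modeEmbed k A)ᵀ * modeEmbed k B).trace = mdim d k * (Aᵀ * B).trace := by
  rw [modeEmbed_transpose, modeEmbed_mul, trace_modeEmbed]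

theorem modeEmbed_mul_modeEmbed_of_ne {k l : Fin L} (h : k ≠ l)
    (A : Matrix (Fin (d k)) (Fin (d k)) ℝ) (B : Matrix (Fin (d l)) (Fin (d l)) ℝ) (i j : Idx d) :
    modeEmbed k A i j * modeEmbed l B i j
      = if i = j then A (i k) (i k) * B (i l) (i l) else 0 := by
  split_ifs with hij
  · subst hij; simp [modeEmbed_apply]
  · rw [modeEmbed_apply, modeEmbed_apply]
    split_ifs with hk hl
    · refine absurd (funext fun m => ?_) hij
      by_cases hm : m = k
      · exact hl m (hm ▸ h)
      · exact hk m hm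
    all_goals simp

theorem trace_modeEmbed_mul_of_ne {k l : Fin L} (h : k ≠ l)
    {A : Matrix (Fin (d k)) (Fin (d k)) ℝ} (B : Matrix (Fin (d l)) (Fin (d l)) ℝ)
    (hA : A.trace = 0) : ((modeEmbed k A)ᵀ * modeEmbed l B).trace = 0 := by
  simp only [Matrix.trace, diag_apply, mul_apply, transpose_apply,
    modeEmbed_mul_modeEmbed_of_ne h, Finset.sum_ite_eq', Finset.mem_univ, if_true]
  rw [sum_idx_eq k]
  refine Finset.sum_eq_zero fun c _ => ?_
  simp only [joinAt_self, joinAt_of_ne h.symm]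
  rw [← Finset.sum_mul, show ∑ a, A a a = 0 from hA, zero_mul]

theorem frobSq_modeEmbed (k : Fin L) (A : Matrix (Fin (d k)) (Fin (d k)) ℝ) :
    frobSq (modeEmbed k A) = mdim d k * frobSq A := by
  rw [frobSq_eq_trace, frobSq_eq_trace, trace_modeEmbed_mul]

theorem opNorm_modeEmbed_le (k : Fin L) (A : Matrix (Fin (d k)) (Fin (d k)) ℝ) :
    opNorm (modeEmbed k A) ≤ opNorm A := by
  refine opNorm_le_of_dotProduct_mulVec_self_le (opNorm_nonneg A) fun x => ?_
  rw [dotProduct, dotProduct, sum_idx_eq k, sum_idx_eq k, Finset.mul_sum]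
  simp only [modeEmbed_mulVec_joinAt]
  exact Finset.sum_le_sum fun c _ => dotProduct_mulVec_self_le A fun a => x (joinAt k a c)

theorem mdim_pos (hd : ∀ k, 1 ≤ d k) (k : Fin L) : 0 < mdim d k :=
  Finset.prod_pos fun l _ => hd l

theorem pdim_pos (hd : ∀ k, 1 ≤ d k) : 0 < pdim d := Finset.prod_pos fun l _ => hd l

theorem mul_mdim (k : Fin L) : d k * mdim d k = pdim d :=
  Finset.mul_prod_erase _ _ (Finset.mem_univ k)

theorem mul_trace_gram (hd : ∀ k, 1 ≤ d k) (x : Idx d → ℝ) (k : Fin L)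
    (B : Matrix (Fin (d k)) (Fin (d k)) ℝ) :
    (mdim d k : ℝ) * ((gram x k)ᵀ * B).trace = x ⬝ᵥ (modeEmbed k B *ᵥ x) := by
  have hm : (mdim d k : ℝ) ≠ 0 := by exact_mod_cast (mdim_pos hd k).ne'
  have hfiber a c : unfolding x k a c = x (joinAt k a c) := rfl
  rw [gram, transpose_smul, smul_mul, trace_smul, smul_eq_mul, mul_inv_cancel_left₀ hm,
    transpose_mul, transpose_transpose, Matrix.mul_assoc, trace_mul_comm, Matrix.mul_assoc,
    dotProduct, sum_idx_eq k]
  simp only [modeEmbed_mulVec_joinAt]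
  simp only [Matrix.trace, diag_apply, mul_apply, transpose_apply, hfiber, mulVec, dotProduct]

theorem objective_eq (hd : ∀ k, 1 ≤ d k) (x : Idx d → ℝ) (ρ : Fin L → ℝ)
    (B : (k : Fin L) → Matrix (Fin (d k)) (Fin (d k)) ℝ) :
    objective x ρ B = -Real.log (kronSum B).det + x ⬝ᵥ (kronSum B *ᵥ x)
      + ∑ k, (mdim d k : ℝ) * (ρ k * offOne (B k)) := by
  simp only [objective, mul_add, Finset.sum_add_distrib, mul_trace_gram hd, kronSum_eq_sum,
    sum_mulVec, dotProduct_sum, add_assoc]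

theorem kronSum_isSymm {B : (k : Fin L) → Matrix (Fin (d k)) (Fin (d k)) ℝ}
    (h : ∀ k, (B k).IsSymm) : (kronSum B).IsSymm := by
  rw [Matrix.IsSymm, kronSum_eq_sum, transpose_sum]
  exact Finset.sum_congr rfl fun k _ => by rw [modeEmbed_transpose, (h k).eq]

theorem kronSum_add (A B : (k : Fin L) → Matrix (Fin (d k)) (Fin (d k)) ℝ) :
    kronSum (fun k => A k + B k) = kronSum A + kronSum B := by
  simp only [kronSum_eq_sum, modeEmbed_add, Finset.sum_add_distrib]

theorem kronSum_sub (A B : (k : Fin L) → Matrix (Fin (d k)) (Fin (d k)) ℝ) :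
    kronSum (fun k => A k - B k) = kronSum A - kronSum B := by
  rw [eq_sub_iff_add_eq, ← kronSum_add]
  simp only [sub_add_cancel]

theorem kronSum_smul_one (c : Fin L → ℝ) :
    kronSum (d := d) (fun k => c k • 1) = (∑ k, c k) • 1 := by
  simp only [kronSum_eq_sum, modeEmbed_smul, modeEmbed_one, Finset.sum_smul]

theorem trace_kronSum_mul {A : (k : Fin L) → Matrix (Fin (d k)) (Fin (d k)) ℝ}
    (B : (k : Fin L) → Matrix (Fin (d k)) (Fin (d k)) ℝ) (hA : ∀ k, (A k).trace = 0) :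
    ((kronSum A)ᵀ * kronSum B).trace = ∑ k, mdim d k * ((A k)ᵀ * B k).trace := by
  rw [kronSum_eq_sum, kronSum_eq_sum, transpose_sum, Finset.sum_mul, trace_sum]
  refine Finset.sum_congr rfl fun k _ => ?_
  rw [Finset.mul_sum, trace_sum, Finset.sum_eq_single k, trace_modeEmbed_mul]
  · exact fun l _ hl => trace_modeEmbed_mul_of_ne hl.symm _ (hA k)
  · simp

theorem frobSq_kronSum_of_trace_eq_zero {A : (k : Fin L) → Matrix (Fin (d k)) (Fin (d k)) ℝ}
    (hA : ∀ k, (A k).trace = 0) : frobSq (kronSum A) = ∑ k, mdim d k * frobSq (A k) := by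
  simp only [frobSq_eq_trace]
  exact trace_kronSum_mul A hA

end Kronecker

section Decomposition

open Matrix

theorem frobSq_add {ι : Type*} [Fintype ι] {A B : Matrix ι ι ℝ} (h : (Aᵀ * B).trace = 0) :
    frobSq (A + B) = frobSq A + frobSq B := by
  have hBA : (Bᵀ * A).trace = 0 := by
    rw [← h, ← trace_transpose, transpose_mul, transpose_transpose]
  simp only [frobSq_eq_trace, transpose_add, mul_add, add_mul, trace_add, h, hBA]
  ring

variable {ι : Type*} [DecidableEq ι]

/-- Off-diagonal part of a matrix, the part on which the penalty acts. -/
def offPart (A : Matrix ι ι ℝ) : Matrix ι ι ℝ :=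
  Matrix.of fun i j => if i = j then 0 else A i j

/-- Diagonal part of a matrix, which the penalty does not see. -/
def diagPart (A : Matrix ι ι ℝ) : Matrix ι ι ℝ :=
  diagonal A.diag

theorem offPart_add_diagPart (A : Matrix ι ι ℝ) : offPart A + diagPart A = A := by
  ext i j
  rcases eq_or_ne i j with rfl | h
  · simp [offPart, diagPart]
  · simp [offPart, diagPart, h]

variable [Fintype ι]

theorem trace_offPart (A : Matrix ι ι ℝ) : (offPart A).trace = 0 := by
  simp [offPart, Matrix.trace]

theorem trace_offPart_mul_diagPart (A B : Matrix ι ι ℝ) :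
    ((offPart A)ᵀ * diagPart B).trace = 0 := by
  simp [Matrix.trace, diagPart, offPart]

/-- Orthogonal projection of a matrix onto the matrices of trace zero. The components of a
Kronecker sum are unique once they are made traceless. -/
def traceless (A : Matrix ι ι ℝ) : Matrix ι ι ℝ :=
  A - (A.trace / Fintype.card ι) • 1

theorem trace_traceless [Nonempty ι] (A : Matrix ι ι ℝ) : (traceless A).trace = 0 := by
  rw [traceless, trace_sub, trace_smul, trace_one, smul_eq_mul,
    div_mul_cancel₀ _ (Nat.cast_ne_zero.2 Fintype.card_ne_zero), sub_self]

end Decomposition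

section KroneckerDecomposition

variable {L : ℕ} {d : Fin L → ℕ}

open Matrix

theorem frobSq_kronSum_eq_off_add_diag (D : (k : Fin L) → Matrix (Fin (d k)) (Fin (d k)) ℝ) :
    frobSq (kronSum D) = ∑ k, mdim d k * frobSq (offPart (D k))
      + frobSq (kronSum fun k => diagPart (D k)) := by
  have hD : kronSum D = kronSum (fun k => offPart (D k)) + kronSum fun k => diagPart (D k) := by
    rw [← kronSum_add]; simp only [offPart_add_diagPart]
  have horth : ((kronSum fun k => offPart (D k))ᵀ * kronSum fun k => diagPart (D k)).trace = 0 := by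
    rw [trace_kronSum_mul _ fun k => trace_offPart (D k)]
    simp only [trace_offPart_mul_diagPart, mul_zero, Finset.sum_const_zero]
  rw [hD, frobSq_add horth, frobSq_kronSum_of_trace_eq_zero fun k => trace_offPart (D k)]

/-- Mean of the diagonal of the Kronecker sum of `D`, the coefficient of its projection onto the
multiples of the identity. -/
def diagMean (D : (k : Fin L) → Matrix (Fin (d k)) (Fin (d k)) ℝ) : ℝ :=
  ∑ k, (D k).trace / d k

theorem kronSum_eq_traceless_add (D : (k : Fin L) → Matrix (Fin (d k)) (Fin (d k)) ℝ) :
    kronSum D = kronSum (fun k => traceless (D k)) + diagMean D • 1 := by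
  rw [diagMean, ← kronSum_smul_one, ← kronSum_add]
  simp [traceless]

theorem trace_traceless_component (hd : ∀ k, 1 ≤ d k)
    (D : (k : Fin L) → Matrix (Fin (d k)) (Fin (d k)) ℝ) (k : Fin L) :
    (traceless (D k)).trace = 0 :=
  haveI : Nonempty (Fin (d k)) := ⟨⟨0, hd k⟩⟩
  trace_traceless (D k)

theorem frobSq_kronSum_eq_traceless_add (hd : ∀ k, 1 ≤ d k)
    (D : (k : Fin L) → Matrix (Fin (d k)) (Fin (d k)) ℝ) :
    frobSq (kronSum D) = ∑ k, mdim d k * frobSq (traceless (D k)) + pdim d * diagMean D ^ 2 := by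
  have htr := trace_traceless_component hd D
  have hone : frobSq (1 : Matrix (Idx d) (Idx d) ℝ) = pdim d := by
    rw [frobSq_eq_trace, transpose_one, one_mul, trace_one, card_idx]
  rw [kronSum_eq_traceless_add, frobSq_add, frobSq_kronSum_of_trace_eq_zero htr, frobSq_smul,
    hone, mul_comm (diagMean D ^ 2)]
  rw [Matrix.mul_smul, mul_one, trace_smul, trace_transpose, kronSum_eq_sum, trace_sum]
  simp only [trace_modeEmbed, htr, mul_zero, Finset.sum_const_zero, smul_zero]

theorem mmin_le (k : Fin L) : mmin d ≤ mdim d k := ciInf_le (OrderBot.bddBelow _) k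

theorem le_dmax (k : Fin L) : d k ≤ dmax d := le_ciSup (Set.finite_range d).bddAbove k

theorem mdim_le_pdim (hd : ∀ k, 1 ≤ d k) (k : Fin L) : mdim d k ≤ pdim d := by
  rw [← mul_mdim k]
  exact Nat.le_mul_of_pos_left _ (hd k)

theorem exists_mmin_eq (hL : 1 ≤ L) : ∃ k, mdim d k = mmin d :=
  have : Nonempty (Fin L) := ⟨⟨0, hL⟩⟩
  exists_eq_ciInf_of_finite

theorem mmin_pos (hL : 1 ≤ L) (hd : ∀ k, 1 ≤ d k) : 0 < mmin d := by
  obtain ⟨k, hk⟩ := exists_mmin_eq (d := d) hL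
  exact hk ▸ mdim_pos hd k

theorem mmin_mul_sum_sq_le (hL : 1 ≤ L) (hd : ∀ k, 1 ≤ d k)
    (D : (k : Fin L) → Matrix (Fin (d k)) (Fin (d k)) ℝ) :
    mmin d * (∑ k, frobSq (traceless (D k)) + diagMean D ^ 2) ≤ frobSq (kronSum D) := by
  rw [frobSq_kronSum_eq_traceless_add hd, mul_add, Finset.mul_sum]
  have hp : (mmin d : ℝ) ≤ pdim d := by
    exact_mod_cast (mmin_le ⟨0, hL⟩).trans (mdim_le_pdim hd _)
  gcongr with k
  · exact frobSq_nonneg _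
  · exact mmin_le k

theorem opNorm_kronSum_le_sum (D : (k : Fin L) → Matrix (Fin (d k)) (Fin (d k)) ℝ) :
    opNorm (kronSum D) ≤ ∑ k, frobNorm (traceless (D k)) + |diagMean D| := by
  rw [kronSum_eq_traceless_add]
  refine (opNorm_add_le _ _).trans (add_le_add ?_ (opNorm_smul_one_le _))
  rw [kronSum_eq_sum]
  exact (opNorm_sum_le _ _).trans (Finset.sum_le_sum fun k _ =>
    (opNorm_modeEmbed_le k _).trans (opNorm_le_frobNorm _))

theorem sq_sum_add_le (f : Fin L → ℝ) (c : ℝ) :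
    (∑ k, f k + c) ^ 2 ≤ (L + 1) * (∑ k, f k ^ 2 + c ^ 2) := by
  have hCS := sq_sum_le_card_mul_sum_sq (s := (Finset.univ : Finset (Option (Fin L))))
    (f := fun o => o.elim c f)
  simpa [Fintype.sum_option, add_comm] using hCS

theorem opNorm_kronSum_le (hL : 1 ≤ L) (hd : ∀ k, 1 ≤ d k)
    (D : (k : Fin L) → Matrix (Fin (d k)) (Fin (d k)) ℝ) :
    opNorm (kronSum D) ≤ √((L + 1) / mmin d) * frobNorm (kronSum D) := by
  have hm : (0 : ℝ) < mmin d := by exact_mod_cast mmin_pos hL hd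
  rw [frobNorm_eq_sqrt, ← Real.sqrt_mul (by positivity)]
  refine Real.le_sqrt_of_sq_le ?_
  have hsum : opNorm (kronSum D) ^ 2
      ≤ (L + 1) * (∑ k, frobSq (traceless (D k)) + diagMean D ^ 2) := by
    refine (pow_le_pow_left₀ (opNorm_nonneg _) (opNorm_kronSum_le_sum D) 2).trans ?_
    simpa only [frobNorm_sq, sq_abs] using
      sq_sum_add_le (fun k => frobNorm (traceless (D k))) |diagMean D|
  rw [div_mul_eq_mul_div, le_div_iff₀ hm]
  calc opNorm (kronSum D) ^ 2 * mmin d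
      ≤ (L + 1) * (∑ k, frobSq (traceless (D k)) + diagMean D ^ 2) * mmin d := by gcongr
    _ = (L + 1) * (mmin d * (∑ k, frobSq (traceless (D k)) + diagMean D ^ 2)) := by ring
    _ ≤ (L + 1) * frobSq (kronSum D) := by gcongr; exact mmin_mul_sum_sq_le hL hd D

end KroneckerDecomposition

/-! ### Deviations of quadratic forms and the basic inequality -/

section Deviation

open Matrix

section General

variable {ι : Type*} [Fintype ι]

/-- Deviation of the quadratic form `x ⬝ M x` from `tr (Σ₀ M)`, which is its mean when `x` is a
random vector with covariance `Σ₀`. -/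
def deviation (x : ι → ℝ) (Sig0 M : Matrix ι ι ℝ) : ℝ :=
  x ⬝ᵥ (M *ᵥ x) - (Sig0 * M).trace

theorem deviation_add (x : ι → ℝ) (Sig0 M N : Matrix ι ι ℝ) :
    deviation x Sig0 (M + N) = deviation x Sig0 M + deviation x Sig0 N := by
  simp only [deviation, add_mulVec, dotProduct_add, mul_add, trace_add]; ring

theorem deviation_smul (x : ι → ℝ) (Sig0 : Matrix ι ι ℝ) (c : ℝ) (M : Matrix ι ι ℝ) :
    deviation x Sig0 (c • M) = c * deviation x Sig0 M := by
  simp only [deviation, smul_mulVec, dotProduct_smul, Matrix.mul_smul, trace_smul, smul_eq_mul]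
  ring

theorem deviation_sum {κ : Type*} (x : ι → ℝ) (Sig0 : Matrix ι ι ℝ) (s : Finset κ)
    (M : κ → Matrix ι ι ℝ) :
    deviation x Sig0 (∑ k ∈ s, M k) = ∑ k ∈ s, deviation x Sig0 (M k) := by
  simp only [deviation, sum_mulVec, dotProduct_sum, Finset.mul_sum, trace_sum,
    Finset.sum_sub_distrib]

variable [DecidableEq ι]

theorem offOne_eq_sum_offPart (A : Matrix ι ι ℝ) : offOne A = ∑ a, ∑ b, |offPart A a b| := by
  simp only [offOne, offPart, of_apply, apply_ite abs, abs_zero]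

theorem offOne_congr {A B : Matrix ι ι ℝ} (h : ∀ i j, i ≠ j → A i j = B i j) :
    offOne A = offOne B :=
  Finset.sum_congr rfl fun i _ => Finset.sum_congr rfl fun j _ => by
    split_ifs with hij
    · rfl
    · rw [h i j hij]

/-- Finset version of the off-diagonal support counted by `offSupp`. -/
def offSupport (A : Matrix ι ι ℝ) : Finset (ι × ι) :=
  {ij | ij.1 ≠ ij.2 ∧ A ij.1 ij.2 ≠ 0}

theorem offSupp_eq_card (A : Matrix ι ι ℝ) : offSupp A = (offSupport A).card := by
  rw [offSupp, ← Set.ncard_coe_finset]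
  congr 1
  ext
  simp [offSupport]

theorem sum_abs_offPart_le (T : Finset (ι × ι)) (D : Matrix ι ι ℝ) :
    ∑ ij ∈ T, |offPart D ij.1 ij.2| ≤ √T.card * frobNorm (offPart D) := by
  rw [frobNorm_eq_sqrt, ← Real.sqrt_mul (by positivity)]
  refine Real.le_sqrt_of_sq_le (sq_sum_le_card_mul_sum_sq.trans ?_)
  gcongr
  simp only [sq_abs, frobSq]
  rw [← Fintype.sum_prod_type' (f := fun i j => offPart D i j ^ 2)]
  exact Finset.sum_le_sum_of_subset_of_nonneg (Finset.subset_univ _) fun _ _ _ => sq_nonneg _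

theorem offOne_add_ge_sub_sum (P D : Matrix ι ι ℝ) :
    offOne P + offOne D - 2 * ∑ ij ∈ offSupport P, |offPart D ij.1 ij.2| ≤ offOne (P + D) := by
  simp only [offOne]
  rw [offSupport, Finset.sum_filter, Fintype.sum_prod_type]
  simp only [Finset.mul_sum, ← Finset.sum_add_distrib, ← Finset.sum_sub_distrib]
  refine Finset.sum_le_sum fun i _ => Finset.sum_le_sum fun j _ => ?_
  rcases eq_or_ne i j with hij | hij
  · simp [hij]
  · by_cases hP : P i j = 0
    · simp [hij, hP]
    · simp only [hij, hP, if_false, ne_eq, not_false_eq_true, and_self, if_true, offPart,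
        of_apply, Matrix.add_apply]
      have htri := abs_sub_abs_le_abs_sub (P i j) (-(D i j))
      rw [abs_neg, sub_neg_eq_add] at htri
      linarith

theorem offOne_add_ge (P D : Matrix ι ι ℝ) :
    offOne P + offOne D - 2 * (√(offSupp P) * frobNorm (offPart D)) ≤ offOne (P + D) := by
  have hCS := sum_abs_offPart_le (offSupport P) D
  rw [← offSupp_eq_card] at hCS
  linarith [offOne_add_ge_sub_sum P D]

end General

variable {L : ℕ} {d : Fin L → ℕ}

/-- Deterministic control of the noise: every off-diagonal entry of the mode-`k` Gram matrix is
within `w k` of its mean, in the scaling of the objective, and deviations along diagonal Kronecker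
sums are at most `T` in the norm dual to the Frobenius norm. -/
structure DeviationBound (x : Idx d → ℝ) (Sig0 : Matrix (Idx d) (Idx d) ℝ) (w : Fin L → ℝ)
    (T : ℝ) : Prop where
  off : ∀ (k : Fin L) (a b : Fin (d k)), a ≠ b →
    |deviation x Sig0 (modeEmbed k (Matrix.single a b 1))| ≤ w k
  diag : ∀ D : (k : Fin L) → Matrix (Fin (d k)) (Fin (d k)) ℝ,
    |deviation x Sig0 (kronSum fun k => diagPart (D k))|
      ≤ T * frobNorm (kronSum fun k => diagPart (D k))

variable {x : Idx d → ℝ} {Sig0 : Matrix (Idx d) (Idx d) ℝ}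

theorem modeEmbed_offPart_eq_sum (k : Fin L) (A : Matrix (Fin (d k)) (Fin (d k)) ℝ) :
    modeEmbed k (offPart A)
      = ∑ a, ∑ b, offPart A a b • modeEmbed k (Matrix.single a b (1 : ℝ)) := by
  conv_lhs => rw [matrix_eq_sum_single (offPart A)]
  simp only [modeEmbed_sum, ← modeEmbed_smul, smul_single, smul_eq_mul, mul_one]

theorem abs_deviation_offPart_le {k : Fin L} {c : ℝ} (h : ∀ a b : Fin (d k), a ≠ b →
      |deviation x Sig0 (modeEmbed k (Matrix.single a b 1))| ≤ c)
    (A : Matrix (Fin (d k)) (Fin (d k)) ℝ) :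
    |deviation x Sig0 (modeEmbed k (offPart A))| ≤ c * offOne A := by
  rw [modeEmbed_offPart_eq_sum, offOne_eq_sum_offPart]
  simp only [deviation_sum, deviation_smul, Finset.mul_sum]
  refine (Finset.abs_sum_le_sum_abs _ _).trans (Finset.sum_le_sum fun a _ => ?_)
  refine (Finset.abs_sum_le_sum_abs _ _).trans (Finset.sum_le_sum fun b _ => ?_)
  rw [abs_mul, mul_comm]
  rcases eq_or_ne a b with rfl | hab
  · simp [offPart]
  · gcongr
    exact h a b hab

/-- A penalty that dominates the noise leaves only the error on the support of the truth. -/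
theorem neg_le_deviation_offPart_add_penalty {k : Fin L} {w : ℝ} (hw : 0 ≤ w)
    (h : ∀ a b : Fin (d k), a ≠ b → |deviation x Sig0 (modeEmbed k (Matrix.single a b 1))| ≤ w)
    (P D : Matrix (Fin (d k)) (Fin (d k)) ℝ) :
    -(2 * (w * (√(offSupp P) * frobNorm (offPart D))))
      ≤ deviation x Sig0 (modeEmbed k (offPart D)) + w * (offOne (P + D) - offOne P) := by
  have hnoise := (abs_le.1 (abs_deviation_offPart_le h D)).1
  have hpenalty := mul_le_mul_of_nonneg_left (offOne_add_ge P D) hw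
  linarith

theorem sum_mul_sqrt_mul_le {κ : Type*} [Fintype κ] {m ρ s : κ → ℝ} {W : ℝ} (hm : ∀ k, 0 ≤ m k)
    (hs : ∀ k, 0 ≤ s k) (hW : 0 ≤ W) (h : ∀ k, m k * ρ k ^ 2 ≤ W ^ 2) (f : κ → ℝ) :
    ∑ k, m k * ρ k * (√(s k) * f k) ≤ W * √(∑ k, s k) * √(∑ k, m k * f k ^ 2) := by
  have hsplit k : m k * ρ k * (√(s k) * f k) = (√(m k) * ρ k * √(s k)) * (√(m k) * f k) := by
    rw [← Real.mul_self_sqrt (hm k), Real.sqrt_mul_self (Real.sqrt_nonneg _)]; ring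
  have hleft : ∑ k, (√(m k) * ρ k * √(s k)) ^ 2 ≤ W ^ 2 * ∑ k, s k := by
    rw [Finset.mul_sum]
    refine Finset.sum_le_sum fun k _ => ?_
    rw [mul_pow, mul_pow, Real.sq_sqrt (hm k), Real.sq_sqrt (hs k)]
    exact mul_le_mul_of_nonneg_right (h k) (hs k)
  have hright : ∑ k, (√(m k) * f k) ^ 2 = ∑ k, m k * f k ^ 2 :=
    Finset.sum_congr rfl fun k _ => by rw [mul_pow, Real.sq_sqrt (hm k)]
  calc ∑ k, m k * ρ k * (√(s k) * f k)
      = ∑ k, (√(m k) * ρ k * √(s k)) * (√(m k) * f k) := Finset.sum_congr rfl fun k _ => hsplit k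
    _ ≤ √(∑ k, (√(m k) * ρ k * √(s k)) ^ 2) * √(∑ k, (√(m k) * f k) ^ 2) :=
        Real.sum_mul_le_sqrt_mul_sqrt _ _ _
    _ ≤ √(W ^ 2 * ∑ k, s k) * √(∑ k, m k * f k ^ 2) := by rw [hright]; gcongr
    _ = W * √(∑ k, s k) * √(∑ k, m k * f k ^ 2) := by
        rw [Real.sqrt_mul (sq_nonneg W), Real.sqrt_sq hW]

theorem sum_mdim_mul_frobSq_offPart_le (D : (k : Fin L) → Matrix (Fin (d k)) (Fin (d k)) ℝ) :
    ∑ k, (mdim d k : ℝ) * frobSq (offPart (D k)) ≤ frobSq (kronSum D) := by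
  rw [frobSq_kronSum_eq_off_add_diag D]
  exact le_add_of_nonneg_right (frobSq_nonneg _)

theorem frobNorm_kronSum_diagPart_le (D : (k : Fin L) → Matrix (Fin (d k)) (Fin (d k)) ℝ) :
    frobNorm (kronSum fun k => diagPart (D k)) ≤ frobNorm (kronSum D) := by
  rw [frobNorm_eq_sqrt, frobNorm_eq_sqrt, frobSq_kronSum_eq_off_add_diag D]
  exact Real.sqrt_le_sqrt (le_add_of_nonneg_left (Finset.sum_nonneg fun k _ =>
    mul_nonneg (by positivity) (frobSq_nonneg _)))

theorem deviation_kronSum_eq (D : (k : Fin L) → Matrix (Fin (d k)) (Fin (d k)) ℝ) :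
    deviation x Sig0 (kronSum D) = ∑ k, deviation x Sig0 (modeEmbed k (offPart (D k)))
      + deviation x Sig0 (kronSum fun k => diagPart (D k)) := by
  rw [← deviation_sum, ← kronSum_eq_sum, ← deviation_add, ← kronSum_add]
  simp only [offPart_add_diagPart]

theorem DeviationBound.neg_le_deviation_add_penalty {ρ : Fin L → ℝ} {W T : ℝ}
    (h : DeviationBound x Sig0 (fun k => mdim d k * ρ k) T) (hρ : ∀ k, 0 ≤ ρ k) (hW : 0 ≤ W)
    (hρW : ∀ k, mdim d k * ρ k ^ 2 ≤ W ^ 2) (hT : 0 ≤ T)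
    (Psi D : (k : Fin L) → Matrix (Fin (d k)) (Fin (d k)) ℝ) :
    -((2 * W * √(∑ k, (offSupp (Psi k) : ℝ)) + T) * frobNorm (kronSum D))
      ≤ deviation x Sig0 (kronSum D)
        + ∑ k, (mdim d k : ℝ) * (ρ k * (offOne (Psi k + D k) - offOne (Psi k))) := by
  have hdiag : -(T * frobNorm (kronSum D)) ≤ deviation x Sig0 (kronSum fun k => diagPart (D k)) :=
    (neg_le_neg (mul_le_mul_of_nonneg_left (frobNorm_kronSum_diagPart_le D) hT)).trans
      (abs_le.1 (h.diag D)).1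
  have hoff := Finset.sum_le_sum fun k (_ : k ∈ Finset.univ) =>
    neg_le_deviation_offPart_add_penalty (mul_nonneg (by positivity) (hρ k)) (h.off k) (Psi k) (D k)
  have hsum : ∑ k, mdim d k * ρ k * (√(offSupp (Psi k)) * frobNorm (offPart (D k)))
      ≤ W * √(∑ k, (offSupp (Psi k) : ℝ)) * frobNorm (kronSum D) := by
    refine (sum_mul_sqrt_mul_le (fun k => by positivity) (fun k => by positivity) hW hρW _).trans ?_
    simp only [frobNorm_sq]
    rw [frobNorm_eq_sqrt (kronSum D)]
    gcongr
    exact sum_mdim_mul_frobSq_offPart_le D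
  simp only [Finset.sum_neg_distrib, ← Finset.mul_sum, Finset.sum_add_distrib, mul_assoc] at hoff
  simp only [mul_assoc] at hsum
  rw [deviation_kronSum_eq]
  linarith

end Deviation

section ObjectiveGap

open Matrix

variable {L : ℕ} {d : Fin L → ℕ}

theorem objective_sub_objective (hd : ∀ k, 1 ≤ d k) (x : Idx d → ℝ) (ρ : Fin L → ℝ)
    (Sig0 : Matrix (Idx d) (Idx d) ℝ) (Psi D : (k : Fin L) → Matrix (Fin (d k)) (Fin (d k)) ℝ) :
    objective x ρ (fun k => Psi k + D k) - objective x ρ Psi =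
      (Real.log (kronSum Psi).det - Real.log (kronSum Psi + kronSum D).det
        + (Sig0 * kronSum D).trace)
      + (deviation x Sig0 (kronSum D)
        + ∑ k, (mdim d k : ℝ) * (ρ k * (offOne (Psi k + D k) - offOne (Psi k)))) := by
  rw [objective_eq hd, objective_eq hd, kronSum_add, add_mulVec, dotProduct_add, deviation]
  simp only [mul_sub, Finset.sum_sub_distrib]
  ring

/-- At distance `f > r` from the truth, the strong convexity estimate at scale `θ = r / f` grows
like `r * f`, which beats the linear term `Λ * f`. -/
theorem objective_lt_of_frobNorm_gt (hL : 1 ≤ L) (hd : ∀ k, 1 ≤ d k) {x : Idx d → ℝ}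
    {ρ : Fin L → ℝ} {Psi : (k : Fin L) → Matrix (Fin (d k)) (Fin (d k)) ℝ}
    (hPsi : (kronSum Psi).PosDef) {Λ r : ℝ} (hr : 0 < r)
    (hlin : ∀ D : (k : Fin L) → Matrix (Fin (d k)) (Fin (d k)) ℝ,
      -(Λ * frobNorm (kronSum D)) ≤ deviation x (kronSum Psi)⁻¹ (kronSum D)
        + ∑ k, (mdim d k : ℝ) * (ρ k * (offOne (Psi k + D k) - offOne (Psi k))))
    (hΛ : 4 * opNorm (kronSum Psi) ^ 2 * Λ < r)
    (hsmall : opNorm (kronSum Psi)⁻¹ * (√((L + 1) / mmin d) * r) ≤ 1)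
    {D : (k : Fin L) → Matrix (Fin (d k)) (Fin (d k)) ℝ}
    (hD : (kronSum Psi + kronSum D).PosDef) (hgt : r < frobNorm (kronSum D)) :
    objective x ρ Psi < objective x ρ fun k => Psi k + D k := by
  set f := frobNorm (kronSum D) with hf
  have hf0 : 0 < f := hr.trans hgt
  have hθ : r / f * (opNorm (kronSum Psi)⁻¹ * opNorm (kronSum D)) ≤ 1 := by
    calc r / f * (opNorm (kronSum Psi)⁻¹ * opNorm (kronSum D))
        ≤ r / f * (opNorm (kronSum Psi)⁻¹ * (√((L + 1) / mmin d) * f)) := by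
          have := opNorm_nonneg (kronSum Psi)⁻¹
          gcongr
          exact opNorm_kronSum_le hL hd D
      _ = opNorm (kronSum Psi)⁻¹ * (√((L + 1) / mmin d) * r) := by field_simp
      _ ≤ 1 := hsmall
  have hconvex := mul_frobSq_le_log_det_sub hPsi hD (by positivity)
    ((div_le_one hf0).2 hgt.le) hθ
  have hgrowth : r / f * frobSq (kronSum D) = r * f := by rw [← frobNorm_sq, ← hf]; field_simp
  have hlinear := mul_le_mul_of_nonneg_left (hlin D)
    (by positivity : 0 ≤ 4 * opNorm (kronSum Psi) ^ 2)
  have hpos : 0 < 4 * opNorm (kronSum Psi) ^ 2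
      * (objective x ρ (fun k => Psi k + D k) - objective x ρ Psi) := by
    rw [objective_sub_objective hd x ρ (kronSum Psi)⁻¹, mul_add]
    linarith [mul_lt_mul_of_pos_right hΛ hf0]
  exact sub_pos.1 (pos_of_mul_pos_right hpos (by positivity))

end ObjectiveGap

/-! ### Existence and localization of minimizers -/

section Perturbation

open Matrix

variable {ι : Type*} [Fintype ι] {A M : Matrix ι ι ℝ}

theorem abs_apply_le_frobNorm (A : Matrix ι ι ℝ) (i j : ι) : |A i j| ≤ frobNorm A := by
  refine Real.abs_le_sqrt ((Finset.single_le_sum (f := fun j => A i j ^ 2)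
    (fun j _ => sq_nonneg _) (Finset.mem_univ j)).trans ?_)
  exact Finset.single_le_sum (f := fun i => ∑ j, A i j ^ 2) (fun i _ => by positivity)
    (Finset.mem_univ i)

variable [DecidableEq ι]

theorem dotProduct_self_le_opNorm_inv_mul (hA : A.PosDef) (x : ι → ℝ) :
    x ⬝ᵥ x ≤ opNorm A⁻¹ * (x ⬝ᵥ (A *ᵥ x)) := by
  obtain ⟨R, Q, hR, hQ, hRR, hQQ, hRQ, -⟩ := exists_isSymm_sqrt hA
  have hx : R *ᵥ (Q *ᵥ x) = x := by rw [mulVec_mulVec, hRQ, one_mulVec]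
  have hQx : (Q *ᵥ x) ⬝ᵥ (Q *ᵥ x) = x ⬝ᵥ (A *ᵥ x) := by
    rw [dotProduct_mulVec, ← mulVec_transpose, hQ.eq, mulVec_mulVec, hQQ, dotProduct_comm]
  calc x ⬝ᵥ x = (R *ᵥ (Q *ᵥ x)) ⬝ᵥ (R *ᵥ (Q *ᵥ x)) := by rw [hx]
    _ ≤ opNorm R ^ 2 * ((Q *ᵥ x) ⬝ᵥ (Q *ᵥ x)) := dotProduct_mulVec_self_le R _
    _ = opNorm A⁻¹ * (x ⬝ᵥ (A *ᵥ x)) := by rw [hQx, ← opNorm_transpose_mul_self, hR.eq, hRR]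

theorem posDef_of_opNorm_sub_lt (hA : A.PosDef) (hM : M.IsHermitian)
    (h : opNorm A⁻¹ * opNorm (M - A) < 1) : M.PosDef := by
  refine PosDef.of_dotProduct_mulVec_pos hM fun {x} hx => ?_
  rw [star_trivial]
  have hxx : 0 < x ⬝ᵥ x := (Finset.sum_nonneg fun i _ => mul_self_nonneg (x i)).lt_of_ne'
    (dotProduct_self_eq_zero.not.2 hx)
  have hlower := dotProduct_self_le_opNorm_inv_mul hA x
  have hdiff := mul_le_mul_of_nonneg_left (abs_le.1 (abs_dotProduct_mulVec_le (M - A) x)).1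
    (opNorm_nonneg A⁻¹)
  rw [sub_mulVec, dotProduct_sub] at hdiff
  have hpos : 0 < opNorm A⁻¹ * (x ⬝ᵥ (M *ᵥ x)) := by
    linarith [mul_lt_mul_of_pos_right h hxx]
  exact pos_of_mul_pos_right hpos (opNorm_nonneg _)

end Perturbation

section Existence

variable {L : ℕ} {d : Fin L → ℕ}

open Matrix

theorem frobNorm_traceless_le (hd : ∀ k, 1 ≤ d k)
    (D : (k : Fin L) → Matrix (Fin (d k)) (Fin (d k)) ℝ) (k : Fin L) :
    frobNorm (traceless (D k)) ≤ frobNorm (kronSum D) := by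
  refine Real.sqrt_le_sqrt (show frobSq (traceless (D k)) ≤ frobSq (kronSum D) from ?_)
  have hm : (1 : ℝ) ≤ mdim d k := by exact_mod_cast mdim_pos hd k
  have hnonneg l : 0 ≤ (mdim d l : ℝ) * frobSq (traceless (D l)) :=
    mul_nonneg (by positivity) (frobSq_nonneg _)
  calc frobSq (traceless (D k)) ≤ mdim d k * frobSq (traceless (D k)) :=
        le_mul_of_one_le_left (frobSq_nonneg _) hm
    _ ≤ ∑ l, mdim d l * frobSq (traceless (D l)) :=
        Finset.single_le_sum (fun l _ => hnonneg l) (Finset.mem_univ k)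
    _ ≤ frobSq (kronSum D) := by
        rw [frobSq_kronSum_eq_traceless_add hd]
        exact le_add_of_nonneg_right (by positivity)

theorem abs_diagMean_le (hd : ∀ k, 1 ≤ d k)
    (D : (k : Fin L) → Matrix (Fin (d k)) (Fin (d k)) ℝ) :
    |diagMean D| ≤ frobNorm (kronSum D) := by
  refine Real.abs_le_sqrt (show _ ≤ frobSq (kronSum D) from ?_)
  have hp : (1 : ℝ) ≤ pdim d := by exact_mod_cast pdim_pos hd
  rw [frobSq_kronSum_eq_traceless_add hd]
  exact (le_mul_of_one_le_left (sq_nonneg _) hp).trans (le_add_of_nonneg_left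
    (Finset.sum_nonneg fun l _ => mul_nonneg (by positivity) (frobSq_nonneg _)))

/-- The traceless components of `D`, with the mean of the diagonal spread evenly over the modes.
Components are determined by their Kronecker sum only up to multiples of the identity; this choice
is bounded by the sum. -/
def balanced (D : (k : Fin L) → Matrix (Fin (d k)) (Fin (d k)) ℝ) (k : Fin L) :
    Matrix (Fin (d k)) (Fin (d k)) ℝ :=
  traceless (D k) + (diagMean D / L) • 1

theorem kronSum_balanced (hL : 1 ≤ L) (D : (k : Fin L) → Matrix (Fin (d k)) (Fin (d k)) ℝ) :
    kronSum (balanced D) = kronSum D := by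
  have hL_ne : (L : ℝ) ≠ 0 := by positivity
  have hmean : ∑ _k : Fin L, diagMean D / L = diagMean D := by
    rw [Finset.sum_const, Finset.card_univ, Fintype.card_fin, nsmul_eq_mul, mul_div_cancel₀ _ hL_ne]
  rw [show balanced D = fun k => traceless (D k) + (diagMean D / L) • 1 from rfl, kronSum_add,
    kronSum_smul_one, hmean, ← kronSum_eq_traceless_add]

theorem offOne_add_balanced (P D : (k : Fin L) → Matrix (Fin (d k)) (Fin (d k)) ℝ) (k : Fin L) :
    offOne (P k + balanced D k) = offOne (P k + D k) :=
  offOne_congr fun i j hij => by simp [balanced, traceless, hij]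

theorem abs_balanced_apply_le (hd : ∀ k, 1 ≤ d k)
    (D : (k : Fin L) → Matrix (Fin (d k)) (Fin (d k)) ℝ) (k : Fin L) (a b : Fin (d k)) :
    |balanced D k a b| ≤ 2 * frobNorm (kronSum D) := by
  have hL : (1 : ℝ) ≤ L := by exact_mod_cast k.pos
  have hone : |(1 : Matrix (Fin (d k)) (Fin (d k)) ℝ) a b| ≤ 1 := by
    rw [one_apply]; split_ifs <;> simp
  have hmean : |(diagMean D / L) * (1 : Matrix (Fin (d k)) (Fin (d k)) ℝ) a b|
      ≤ frobNorm (kronSum D) :=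
    calc |(diagMean D / L) * (1 : Matrix (Fin (d k)) (Fin (d k)) ℝ) a b|
        ≤ |diagMean D| / L * 1 := by rw [abs_mul, abs_div, Nat.abs_cast]; gcongr
      _ ≤ |diagMean D| := by rw [mul_one]; exact div_le_self (abs_nonneg _) hL
      _ ≤ frobNorm (kronSum D) := abs_diagMean_le hd D
  have htraceless := (abs_apply_le_frobNorm (traceless (D k)) a b).trans
    (frobNorm_traceless_le hd D k)
  calc |balanced D k a b|
      ≤ |traceless (D k) a b|
          + |(diagMean D / L) * (1 : Matrix (Fin (d k)) (Fin (d k)) ℝ) a b| := abs_add_le _ _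
    _ ≤ 2 * frobNorm (kronSum D) := by linarith

theorem objective_congr (hd : ∀ k, 1 ≤ d k) (x : Idx d → ℝ) (ρ : Fin L → ℝ)
    {B B' : (k : Fin L) → Matrix (Fin (d k)) (Fin (d k)) ℝ} (hsum : kronSum B = kronSum B')
    (hoff : ∀ k, offOne (B k) = offOne (B' k)) : objective x ρ B = objective x ρ B' := by
  rw [objective_eq hd, objective_eq hd, hsum]
  simp only [hoff]

theorem continuous_kronSum :
    Continuous (kronSum : ((k : Fin L) → Matrix (Fin (d k)) (Fin (d k)) ℝ) → _) := by
  refine continuous_matrix fun i j => ?_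
  simp only [kronSum_eq_sum, Matrix.sum_apply, modeEmbed_apply]
  refine continuous_finsetSum _ fun k _ => ?_
  split_ifs
  · exact (continuous_apply k).matrix_elem _ _
  · exact continuous_const

theorem continuous_frobNorm {ι : Type*} [Fintype ι] :
    Continuous (frobNorm : Matrix ι ι ℝ → ℝ) :=
  Real.continuous_sqrt.comp (continuous_finsetSum _ fun i _ =>
    continuous_finsetSum _ fun j _ => (continuous_id.matrix_elem i j).pow 2)

theorem continuous_offOne {ι : Type*} [Fintype ι] [DecidableEq ι] :
    Continuous (offOne : Matrix ι ι ℝ → ℝ) := by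
  refine continuous_finsetSum _ fun i _ => continuous_finsetSum _ fun j _ => ?_
  split_ifs
  · exact continuous_const
  · exact (continuous_id.matrix_elem i j).abs

theorem continuousOn_objective (hd : ∀ k, 1 ≤ d k) (x : Idx d → ℝ) (ρ : Fin L → ℝ) :
    ContinuousOn (objective x ρ) {B | (kronSum B).PosDef} := by
  have hlogdet : ContinuousOn (fun B : (k : Fin L) → Matrix (Fin (d k)) (Fin (d k)) ℝ =>
      Real.log (kronSum B).det) {B | (kronSum B).PosDef} :=
    ContinuousOn.log continuous_kronSum.matrix_det.continuousOn fun B hB => hB.det_pos.ne'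
  have hquad : Continuous fun B : (k : Fin L) → Matrix (Fin (d k)) (Fin (d k)) ℝ =>
      x ⬝ᵥ (kronSum B *ᵥ x) :=
    continuous_const.dotProduct (continuous_kronSum.matrix_mulVec continuous_const)
  have hpenalty : Continuous fun B : (k : Fin L) → Matrix (Fin (d k)) (Fin (d k)) ℝ =>
      ∑ k, (mdim d k : ℝ) * (ρ k * offOne (B k)) :=
    continuous_finsetSum _ fun k _ => continuous_const.mul
      (continuous_const.mul (continuous_offOne.comp (continuous_apply k)))
  exact ((hlogdet.neg.add hquad.continuousOn).add hpenalty.continuousOn).congr fun B _ =>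
    objective_eq hd x ρ B

/-- The components near `Psi` whose Kronecker sum is symmetric and within Frobenius distance `r` of
the Kronecker sum of `Psi`. The bound on the entries makes this set compact although components are
not determined by their Kronecker sum. -/
def localComponents (Psi : (k : Fin L) → Matrix (Fin (d k)) (Fin (d k)) ℝ) (r : ℝ) :
    Set ((k : Fin L) → Matrix (Fin (d k)) (Fin (d k)) ℝ) :=
  {B | (∀ k a b, |B k a b - Psi k a b| ≤ 2 * r) ∧
    frobNorm (kronSum B - kronSum Psi) ≤ r ∧ (kronSum B).IsSymm}

theorem isCompact_localComponents (Psi : (k : Fin L) → Matrix (Fin (d k)) (Fin (d k)) ℝ) (r : ℝ) :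
    IsCompact (localComponents Psi r) := by
  have hbox : IsCompact {B : (k : Fin L) → Matrix (Fin (d k)) (Fin (d k)) ℝ |
      ∀ k a b, |B k a b - Psi k a b| ≤ 2 * r} := by
    convert! isCompact_univ_pi fun k : Fin L => isCompact_univ_pi fun a : Fin (d k) =>
      isCompact_univ_pi fun b : Fin (d k) =>
        isCompact_closedBall (Psi k a b) (2 * r) using 1
    ext B
    exact ⟨fun h k _ a _ b _ => h k a b, fun h k a b => h k trivial a trivial b trivial⟩
  have hclosed : IsClosed {B : (k : Fin L) → Matrix (Fin (d k)) (Fin (d k)) ℝ |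
      frobNorm (kronSum B - kronSum Psi) ≤ r ∧ (kronSum B).IsSymm} :=
    (isClosed_le (continuous_frobNorm.comp (continuous_kronSum.sub continuous_const))
      continuous_const).inter (isClosed_eq continuous_kronSum.matrix_transpose continuous_kronSum)
  exact hbox.inter_right hclosed

theorem self_mem_localComponents {Psi : (k : Fin L) → Matrix (Fin (d k)) (Fin (d k)) ℝ}
    (hPsi : (kronSum Psi).IsSymm) {r : ℝ} (hr : 0 ≤ r) : Psi ∈ localComponents Psi r := by
  refine ⟨fun k a b => ?_, ?_, hPsi⟩
  · rw [sub_self, abs_zero]; positivity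
  · rw [sub_self]; simpa [frobNorm] using hr

theorem posDef_of_mem_localComponents (hL : 1 ≤ L) (hd : ∀ k, 1 ≤ d k)
    {Psi B : (k : Fin L) → Matrix (Fin (d k)) (Fin (d k)) ℝ} (hPsi : (kronSum Psi).PosDef) {r : ℝ}
    (hsmall : opNorm (kronSum Psi)⁻¹ * (√((L + 1) / mmin d) * r) < 1)
    (hB : B ∈ localComponents Psi r) : (kronSum B).PosDef := by
  obtain ⟨-, hdist, hsymm⟩ := hB
  refine posDef_of_opNorm_sub_lt hPsi (isHermitian_iff_isSymm.2 hsymm) (lt_of_le_of_lt ?_ hsmall)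
  rw [← kronSum_sub] at hdist ⊢
  refine mul_le_mul_of_nonneg_left ((opNorm_kronSum_le hL hd _).trans ?_) (opNorm_nonneg _)
  exact mul_le_mul_of_nonneg_left hdist (Real.sqrt_nonneg _)

theorem exists_mem_localComponents_objective_eq (hL : 1 ≤ L) (hd : ∀ k, 1 ≤ d k) (x : Idx d → ℝ)
    (ρ : Fin L → ℝ) {Psi B : (k : Fin L) → Matrix (Fin (d k)) (Fin (d k)) ℝ} {r : ℝ}
    (hB : (kronSum B).IsSymm) (hdist : frobNorm (kronSum B - kronSum Psi) ≤ r) :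
    ∃ B' ∈ localComponents Psi r, objective x ρ B' = objective x ρ B := by
  set D : (k : Fin L) → Matrix (Fin (d k)) (Fin (d k)) ℝ := fun k => B k - Psi k
  have hsum : kronSum (fun k => Psi k + balanced D k) = kronSum B := by
    rw [kronSum_add, kronSum_balanced hL, kronSum_sub, add_sub_cancel]
  refine ⟨fun k => Psi k + balanced D k, ⟨fun k a b => ?_, ?_, ?_⟩,
    objective_congr hd x ρ hsum fun k => ?_⟩
  · change |Psi k a b + balanced D k a b - Psi k a b| ≤ 2 * r
    rw [add_sub_cancel_left]
    refine (abs_balanced_apply_le hd D k a b).trans ?_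
    rw [kronSum_sub]
    gcongr
  · rwa [hsum]
  · rwa [hsum]
  · rw [offOne_add_balanced, add_sub_cancel]

variable {x : Idx d → ℝ} {ρ : Fin L → ℝ} {Psi : (k : Fin L) → Matrix (Fin (d k)) (Fin (d k)) ℝ}
  {r : ℝ}

theorem exists_isTeraLasso (hL : 1 ≤ L) (hd : ∀ k, 1 ≤ d k) (hPsi : (kronSum Psi).PosDef)
    (hr : 0 ≤ r) (hsmall : opNorm (kronSum Psi)⁻¹ * (√((L + 1) / mmin d) * r) < 1)
    (hball : ∀ D : (k : Fin L) → Matrix (Fin (d k)) (Fin (d k)) ℝ,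
      (kronSum Psi + kronSum D).PosDef → r < frobNorm (kronSum D) →
        objective x ρ Psi < objective x ρ fun k => Psi k + D k) :
    ∃ Ωhat, IsTeraLasso x ρ Ωhat := by
  have hpos B (hB : B ∈ localComponents Psi r) : (kronSum B).PosDef :=
    posDef_of_mem_localComponents hL hd hPsi hsmall hB
  have hself : Psi ∈ localComponents Psi r :=
    self_mem_localComponents (isHermitian_iff_isSymm.1 hPsi.isHermitian) hr
  obtain ⟨B, hB, hmin⟩ := (isCompact_localComponents Psi r).exists_isMinOn ⟨Psi, hself⟩
    ((continuousOn_objective hd x ρ).mono hpos)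
  refine ⟨kronSum B, B, rfl, hpos B hB, fun B' hB' => ?_⟩
  rcases le_or_gt (frobNorm (kronSum B' - kronSum Psi)) r with hnear | hfar
  · obtain ⟨B₁, hB₁, heq⟩ := exists_mem_localComponents_objective_eq hL hd x ρ
      (isHermitian_iff_isSymm.1 hB'.isHermitian) hnear
    exact heq ▸ hmin hB₁
  · have hlt := hball (fun k => B' k - Psi k) (by rwa [kronSum_sub, add_sub_cancel])
      (by rwa [kronSum_sub])
    simp only [add_sub_cancel] at hlt
    exact (hmin hself).trans hlt.le

theorem IsTeraLasso.exists_sub_eq_kronSum {Ωhat : Matrix (Idx d) (Idx d) ℝ}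
    (h : IsTeraLasso x ρ Ωhat) (hPsi : (kronSum Psi).PosDef)
    (hball : ∀ D : (k : Fin L) → Matrix (Fin (d k)) (Fin (d k)) ℝ,
      (kronSum Psi + kronSum D).PosDef → r < frobNorm (kronSum D) →
        objective x ρ Psi < objective x ρ fun k => Psi k + D k) :
    ∃ D : (k : Fin L) → Matrix (Fin (d k)) (Fin (d k)) ℝ,
      Ωhat - kronSum Psi = kronSum D ∧ frobNorm (kronSum D) ≤ r := by
  obtain ⟨B, rfl, hB, hmin⟩ := h
  refine ⟨fun k => B k - Psi k, (kronSum_sub B Psi).symm, ?_⟩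
  by_contra! hfar
  have hlt := hball _ (by rwa [kronSum_sub, add_sub_cancel]) hfar
  simp only [add_sub_cancel] at hlt
  exact absurd (hmin Psi hPsi) hlt.not_ge

end Existence

/-! ### Concentration of the deviations -/

theorem four_pow_le_eexp (n : ℕ) : (4 : ENNReal) ^ n ≤ eexp (2 * n) := by
  have hfour : (4 : ENNReal) ≤ eexp (1 + 1) := by
    rw [eexp_add, show (4 : ENNReal) = 2 * 2 by norm_num]
    gcongr <;> exact two_le_eexp_one
  calc (4 : ENNReal) ^ n ≤ eexp (1 + 1) ^ n := by gcongr
    _ = eexp (2 * n) := by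
      rw [one_add_one_eq_two, mul_comm, eexp_mul_eq_rpow, ENNReal.rpow_natCast]

section Deviation

open Matrix

variable {ι : Type*}

/-- The Riesz representative of the deviation along diagonal matrices. -/
def diagNoise (x : ι → ℝ) (Sig0 : Matrix ι ι ℝ) : EuclideanSpace ℝ ι :=
  WithLp.toLp 2 fun i => x i ^ 2 - Sig0 i i

theorem measurable_diagNoise {S : Type*} [MeasurableSpace S] {Y : S → ι → ℝ}
    (hY : Measurable Y) (Sig0 : Matrix ι ι ℝ) : Measurable fun ω => diagNoise (Y ω) Sig0 := by
  unfold diagNoise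
  fun_prop

variable [Fintype ι]

theorem frobSq_single [DecidableEq ι] (a b : ι) : frobSq (Matrix.single a b (1 : ℝ)) = 1 := by
  simp [frobSq, Matrix.single_apply, ite_and]

theorem frobSq_diagonal [DecidableEq ι] (v : EuclideanSpace ℝ ι) :
    frobSq (diagonal v.ofLp) = ‖v‖ ^ 2 := by
  simp [EuclideanSpace.real_norm_sq_eq, frobSq, diagonal_apply]

theorem deviation_diagonal [DecidableEq ι] (x : ι → ℝ) (Sig0 : Matrix ι ι ℝ)
    (v : EuclideanSpace ℝ ι) :
    deviation x Sig0 (diagonal v.ofLp) = inner ℝ v (diagNoise x Sig0) := by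
  rw [PiLp.inner_apply]
  simp only [deviation, dotProduct, mulVec_diagonal, Matrix.trace, diag_apply, mul_diagonal,
    ← Finset.sum_sub_distrib]
  refine Finset.sum_congr rfl fun i _ => ?_
  simp only [diagNoise, RCLike.inner_apply, conj_trivial]
  ring

theorem deviation_diagonal_eq_inner_projection [DecidableEq ι] (x : ι → ℝ) (Sig0 : Matrix ι ι ℝ)
    (V : Submodule ℝ (EuclideanSpace ℝ ι)) (v : V) :
    deviation x Sig0 (diagonal (v : EuclideanSpace ℝ ι).ofLp)
      = inner ℝ v (V.orthogonalProjectionOnto (diagNoise x Sig0)) := by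
  rw [deviation_diagonal]
  simp

variable {S : Type*} [MeasurableSpace S]

theorem measurable_deviation {Y : S → ι → ℝ} (hY : Measurable Y) (Sig0 M : Matrix ι ι ℝ) :
    Measurable fun ω => deviation (Y ω) Sig0 M := by
  simp only [deviation, dotProduct, mulVec]
  fun_prop

theorem measurable_mulVec {Z : ι → S → ℝ} (hZ : ∀ i, Measurable (Z i)) (R : Matrix ι ι ℝ) :
    Measurable fun ω => R *ᵥ fun i => Z i ω := by
  unfold mulVec dotProduct
  fun_prop

namespace SubgaussianFamily

variable {μ : Measure S} [IsProbabilityMeasure μ] {t : ℝ} {Z : ι → S → ℝ} {R Sig0 : Matrix ι ι ℝ}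

variable [DecidableEq ι]

theorem lintegral_eexp_deviation_le (h : SubgaussianFamily μ t Z) (hR : R * Rᵀ = Sig0)
    (M : Matrix ι ι ℝ) {a : ℝ} (ha : 32 * |a| * t ^ 2 * (opNorm Sig0 * opNorm M) ≤ 1) :
    ∫⁻ ω, eexp (a * deviation (R *ᵥ fun i => Z i ω) Sig0 M) ∂μ
      ≤ eexp (256 * a ^ 2 * t ^ 4 * (opNorm Sig0 ^ 2 * frobSq M)) := by
  have hdev (z : ι → ℝ) :
      deviation (R *ᵥ z) Sig0 M = z ⬝ᵥ ((Rᵀ * M * R) *ᵥ z) - (Rᵀ * M * R).trace := by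
    rw [deviation, trace_mul_cycle Rᵀ M R, hR, ← mulVec_mulVec, ← mulVec_mulVec,
      dotProduct_mulVec z, vecMul_transpose]
  have hnorm : opNorm (Rᵀ * R) = opNorm Sig0 := by
    have hleft := opNorm_transpose_mul_self R
    have hright := opNorm_transpose_mul_self Rᵀ
    rw [transpose_transpose, hR, opNorm_transpose] at hright
    rw [hleft, hright]
  simp_rw [hdev]
  refine (h.lintegral_eexp_quadratic_le (le_trans ?_ ha)).trans (eexp_mono ?_)
  · gcongr
    exact hnorm ▸ opNorm_conj_le R M
  · gcongr
    exact hnorm ▸ frobSq_conj_le R M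

theorem measure_mul_deviation_ge_le (h : SubgaussianFamily μ t Z) (hR : R * Rᵀ = Sig0)
    (M : Matrix ι ι ℝ) {a q : ℝ} (ha : 32 * |a| * t ^ 2 * (opNorm Sig0 * opNorm M) ≤ 1)
    (hq : 256 * a ^ 2 * t ^ 4 * (opNorm Sig0 ^ 2 * frobSq M) ≤ q) :
    μ {ω | 6 * q ≤ a * deviation (R *ᵥ fun i => Z i ω) Sig0 M} ≤ eexp (-5 * q) := by
  have hmeas := measurable_deviation (measurable_mulVec h.measurable R) Sig0 M
  refine (measure_le_of_lintegral_eexp_le (hmeas.const_mul a)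
    ((h.lintegral_eexp_deviation_le hR M ha).trans (eexp_mono hq))).trans (eexp_mono ?_)
  linarith

theorem measure_abs_deviation_ge_le (h : SubgaussianFamily μ t Z) (hR : R * Rᵀ = Sig0)
    (hσ : 0 < opNorm Sig0) {M : Matrix ι ι ℝ} {m q : ℝ} (hop : opNorm M ≤ 1) (hm : 0 < m)
    (hfrob : frobSq M ≤ m) (hq : 0 ≤ q) (hqm : q ≤ m) :
    μ {ω | m * (192 * t ^ 2 * (opNorm Sig0 * √(q / m)))
        ≤ |deviation (R *ᵥ fun i => Z i ω) Sig0 M|} ≤ 2 * eexp (-5 * q) := by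
  have ht := h.pos
  set σ := opNorm Sig0
  set w := √(q / m)
  have hw : w ≤ 1 := Real.sqrt_le_one.2 ((div_le_one hm).2 hqm)
  have hwsq : m * w ^ 2 = q := by
    rw [Real.sq_sqrt (by positivity), mul_div_cancel₀ _ hm.ne']
  set η := w / (32 * t ^ 2 * σ) with hη
  have hη_nonneg : 0 ≤ η := div_nonneg (Real.sqrt_nonneg _) (by positivity)
  have hηt : 32 * η * t ^ 2 * σ = w := by rw [hη]; field_simp
  have hthreshold : η * (m * (192 * t ^ 2 * (σ * w))) = 6 * q := by
    rw [← hwsq]; linear_combination 6 * m * w * hηt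
  have htail a (ha : |a| = η) :
      μ {ω | 6 * q ≤ a * deviation (R *ᵥ fun i => Z i ω) Sig0 M} ≤ eexp (-5 * q) := by
    refine h.measure_mul_deviation_ge_le hR M ?_ ?_
    · calc 32 * |a| * t ^ 2 * (σ * opNorm M) ≤ 32 * |a| * t ^ 2 * (σ * 1) := by gcongr
        _ = w := by rw [ha, mul_one, hηt]
        _ ≤ 1 := hw
    · calc 256 * a ^ 2 * t ^ 4 * (σ ^ 2 * frobSq M)
          ≤ 256 * |a| ^ 2 * t ^ 4 * (σ ^ 2 * m) := by rw [sq_abs]; gcongr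
        _ = m * (32 * η * t ^ 2 * σ) ^ 2 / 4 := by rw [ha]; ring
        _ ≤ q := by rw [hηt, hwsq]; linarith
  have hsub : {ω | m * (192 * t ^ 2 * (σ * w)) ≤ |deviation (R *ᵥ fun i => Z i ω) Sig0 M|}
      ⊆ {ω | 6 * q ≤ η * deviation (R *ᵥ fun i => Z i ω) Sig0 M} ∪
        {ω | 6 * q ≤ -η * deviation (R *ᵥ fun i => Z i ω) Sig0 M} := by
    intro ω hω
    have hscaled := mul_le_mul_of_nonneg_left hω.out hη_nonneg
    rw [hthreshold] at hscaled
    rcases abs_choice (deviation (R *ᵥ fun i => Z i ω) Sig0 M) with habs | habs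
    · exact .inl (by rwa [habs] at hscaled)
    · exact .inr (by rwa [habs, ← neg_mul_comm] at hscaled)
  calc _ ≤ _ := (measure_mono hsub).trans (measure_union_le _ _)
    _ ≤ eexp (-5 * q) + eexp (-5 * q) :=
        add_le_add (htail η (abs_of_nonneg hη_nonneg))
          (htail (-η) (by rw [abs_neg, abs_of_nonneg hη_nonneg]))
    _ = 2 * eexp (-5 * q) := (two_mul _).symm

theorem lintegral_eexp_norm_projection_le (h : SubgaussianFamily μ t Z) (hR : R * Rᵀ = Sig0)
    {V : Submodule ℝ (EuclideanSpace ℝ ι)} {c r : ℝ} (hc : 0 ≤ c)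
    (hV : ∀ v ∈ V, opNorm (diagonal v.ofLp) ≤ c * ‖v‖) (hr : 0 < r)
    (hsmall : 32 * t ^ 2 * (opNorm Sig0 * (c * r)) ≤ 1) :
    ∫⁻ ω, eexp (r / 4 *
        ‖V.orthogonalProjectionOnto (diagNoise (R *ᵥ fun i => Z i ω) Sig0)‖) ∂μ
      ≤ 4 ^ Module.finrank ℝ V * eexp (256 * t ^ 4 * (opNorm Sig0 ^ 2 * r ^ 2)) := by
  have hσ := opNorm_nonneg Sig0
  have hmeas := V.orthogonalProjectionOnto.continuous.measurable.comp
    (measurable_diagNoise (measurable_mulVec h.measurable R) Sig0)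
  refine lintegral_eexp_norm_le hmeas hr fun v hv => ?_
  have hmgf := h.lintegral_eexp_deviation_le hR (diagonal (v : EuclideanSpace ℝ ι).ofLp)
    (a := 1) <| by
      rw [abs_one, mul_one]
      refine le_trans ?_ hsmall
      gcongr
      exact (hV v v.2).trans (mul_le_mul_of_nonneg_left hv hc)
  simp only [one_mul, one_pow, mul_one, frobSq_diagonal,
    deviation_diagonal_eq_inner_projection] at hmgf
  refine hmgf.trans (eexp_mono ?_)
  gcongr
  exact hv

theorem measure_norm_projection_ge_le (h : SubgaussianFamily μ t Z) (hR : R * Rᵀ = Sig0)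
    (hσ : 0 < opNorm Sig0) {V : Submodule ℝ (EuclideanSpace ℝ ι)} {c q : ℝ} (hc : 0 ≤ c)
    (hV : ∀ v ∈ V, opNorm (diagonal v.ofLp) ≤ c * ‖v‖) (hq : 0 < q)
    (hfin : Module.finrank ℝ V ≤ q) (hsmall : 32 * t ^ 2 * (c * √q) ≤ 1) :
    μ {ω | 4 * (5 + 256 * t ^ 4) * opNorm Sig0 * √q
        ≤ ‖V.orthogonalProjectionOnto (diagNoise (R *ᵥ fun i => Z i ω) Sig0)‖}
      ≤ eexp (-3 * q) := by
  set σ := opNorm Sig0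
  set r := √q / σ
  have hr_pos : 0 < r := by positivity
  have hσr : σ * r = √q := mul_div_cancel₀ _ hσ.ne'
  have hball := h.lintegral_eexp_norm_projection_le hR hc hV hr_pos <| by
    rwa [mul_left_comm _ c, hσr]
  have hexp : (4 : ENNReal) ^ Module.finrank ℝ V * eexp (256 * t ^ 4 * (σ ^ 2 * r ^ 2))
      ≤ eexp (2 * q + 256 * t ^ 4 * q) := by
    rw [eexp_add, ← mul_pow, hσr, Real.sq_sqrt hq.le]
    gcongr
    exact (four_pow_le_eexp _).trans (eexp_mono (by linarith))
  have hthreshold : r / 4 * (4 * (5 + 256 * t ^ 4) * σ * √q) = (5 + 256 * t ^ 4) * q := by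
    linear_combination (5 + 256 * t ^ 4) * (√q * hσr + Real.mul_self_sqrt hq.le)
  have hmeas := V.orthogonalProjectionOnto.continuous.measurable.comp
    (measurable_diagNoise (measurable_mulVec h.measurable R) Sig0)
  refine (measure_mono fun ω hω => ?_).trans ((measure_le_of_lintegral_eexp_le
    (a := (5 + 256 * t ^ 4) * q) (hmeas.norm.const_mul (r / 4)) (hball.trans hexp)).trans
    (eexp_mono (by linarith)))
  exact hthreshold ▸ mul_le_mul_of_nonneg_left hω.out (by positivity)

end SubgaussianFamily

end Deviation

section TensorDeviation

open Matrix

variable {L : ℕ} {d : Fin L → ℕ}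

/-- The linear map sending the diagonals of the components to the diagonal of their Kronecker
sum. -/
def diagSum (d : Fin L → ℕ) : ((k : Fin L) → Fin (d k) → ℝ) →ₗ[ℝ] EuclideanSpace ℝ (Idx d) where
  toFun u := WithLp.toLp 2 fun i => ∑ k, u k (i k)
  map_add' u v := by ext i; simp [Finset.sum_add_distrib]
  map_smul' c u := by ext i; simp [Finset.mul_sum]

theorem kronSum_diagonal (u : (k : Fin L) → Fin (d k) → ℝ) :
    kronSum (fun k => diagonal (u k)) = diagonal (diagSum d u).ofLp := by
  ext i j
  rw [kronSum_eq_sum, Matrix.sum_apply]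
  by_cases hij : i = j
  · subst hij
    simp [modeEmbed_apply, diagSum]
  · rw [diagonal_apply_ne _ hij]
    refine Finset.sum_eq_zero fun k _ => ?_
    rw [modeEmbed_apply, ite_eq_right_iff]
    intro hrest
    refine diagonal_apply_ne _ fun hk => hij (funext fun l => ?_)
    by_cases hl : l = k
    · subst hl; exact hk
    · exact hrest l hl

theorem finrank_range_diagSum_le :
    Module.finrank ℝ (LinearMap.range (diagSum d)) ≤ L * dmax d :=
  calc Module.finrank ℝ (LinearMap.range (diagSum d)) ≤ ∑ k, d k := by
        refine (LinearMap.finrank_range_le (diagSum d)).trans_eq ?_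
        simp [Module.finrank_pi_fintype]
    _ ≤ ∑ _k : Fin L, dmax d := Finset.sum_le_sum fun k _ => le_dmax k
    _ = L * dmax d := by simp

theorem opNorm_diagonal_le_of_mem_range (hL : 1 ≤ L) (hd : ∀ k, 1 ≤ d k)
    {v : EuclideanSpace ℝ (Idx d)} (hv : v ∈ LinearMap.range (diagSum d)) :
    opNorm (diagonal v.ofLp) ≤ √((L + 1) / mmin d) * ‖v‖ := by
  obtain ⟨u, rfl⟩ := hv
  have hle := opNorm_kronSum_le hL hd fun k => diagonal (u k)
  rwa [frobNorm_eq_sqrt, kronSum_diagonal, frobSq_diagonal, Real.sqrt_sq (norm_nonneg _)] at hle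

theorem abs_deviation_diagPart_le (x : Idx d → ℝ) (Sig0 : Matrix (Idx d) (Idx d) ℝ)
    (D : (k : Fin L) → Matrix (Fin (d k)) (Fin (d k)) ℝ) :
    |deviation x Sig0 (kronSum fun k => diagPart (D k))|
      ≤ ‖(LinearMap.range (diagSum d)).orthogonalProjectionOnto (diagNoise x Sig0)‖
        * frobNorm (kronSum fun k => diagPart (D k)) := by
  have hker := deviation_diagonal_eq_inner_projection x Sig0 _
    (LinearMap.rangeRestrict (diagSum d) fun k => (D k).diag)
  rw [LinearMap.codRestrict_apply] at hker
  simp only [diagPart]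
  rw [kronSum_diagonal fun k => (D k).diag, hker, frobNorm_eq_sqrt, frobSq_diagonal,
    Real.sqrt_sq (norm_nonneg _), mul_comm]
  exact abs_real_inner_le_norm _ _

variable {S : Type*} [MeasurableSpace S] {μ : Measure S} [IsProbabilityMeasure μ] {t : ℝ}
  {Z : Idx d → S → ℝ} {R Sig0 : Matrix (Idx d) (Idx d) ℝ}

theorem SubgaussianFamily.measure_deviation_single_ge_le (h : SubgaussianFamily μ t Z)
    (hd : ∀ k, 1 ≤ d k) (hR : R * Rᵀ = Sig0) (hσ : 0 < opNorm Sig0) (k : Fin L) {q : ℝ}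
    (hq : 0 ≤ q) (hqm : q ≤ mdim d k) (a b : Fin (d k)) :
    μ {ω | mdim d k * (192 * t ^ 2 * (opNorm Sig0 * √(q / mdim d k)))
        ≤ |deviation (R *ᵥ fun i => Z i ω) Sig0 (modeEmbed k (Matrix.single a b 1))|}
      ≤ 2 * eexp (-5 * q) := by
  refine h.measure_abs_deviation_ge_le hR hσ ?_ (by exact_mod_cast mdim_pos hd k) ?_ hq hqm
  · refine (opNorm_modeEmbed_le k _).trans ((opNorm_le_frobNorm _).trans_eq ?_)
    rw [frobNorm_eq_sqrt, frobSq_single, Real.sqrt_one]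
  · rw [frobSq_modeEmbed, frobSq_single, mul_one]

theorem SubgaussianFamily.measure_deviation_diagPart_gt_le (h : SubgaussianFamily μ t Z)
    (hL : 1 ≤ L) (hd : ∀ k, 1 ≤ d k) (hR : R * Rᵀ = Sig0) (hσ : 0 < opNorm Sig0)
    (hm : (32 * t ^ 2) ^ 2 * ((L + 1) * (L * dmax d)) ≤ mmin d) :
    μ {ω | ∃ D : (k : Fin L) → Matrix (Fin (d k)) (Fin (d k)) ℝ,
        4 * (5 + 256 * t ^ 4) * opNorm Sig0 * √(L * dmax d) *
            frobNorm (kronSum fun k => diagPart (D k))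
          < |deviation (R *ᵥ fun i => Z i ω) Sig0 (kronSum fun k => diagPart (D k))|}
      ≤ eexp (-3 * (L * dmax d)) := by
  have hm_pos : (0 : ℝ) < mmin d := by exact_mod_cast mmin_pos hL hd
  have hq : (0 : ℝ) < L * dmax d := by
    exact_mod_cast Nat.mul_pos hL ((hd ⟨0, hL⟩).trans (le_dmax _))
  have hsmall : 32 * t ^ 2 * (√((L + 1) / mmin d) * √(L * dmax d)) ≤ 1 := by
    refine (sq_le_one_iff₀ (by positivity)).1 ?_
    rw [mul_pow, mul_pow √_, Real.sq_sqrt (by positivity), Real.sq_sqrt hq.le, div_mul_eq_mul_div,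
      mul_div_assoc', div_le_one hm_pos]
    exact hm
  refine (measure_mono ?_).trans (h.measure_norm_projection_ge_le hR hσ (Real.sqrt_nonneg _)
    (fun v hv => opNorm_diagonal_le_of_mem_range hL hd hv) hq
    (by exact_mod_cast finrank_range_diagSum_le) hsmall)
  rintro ω ⟨D, hD⟩
  exact (lt_of_mul_lt_mul_right (hD.trans_le (abs_deviation_diagPart_le _ _ _))
    (frobNorm_nonneg _)).le

end TensorDeviation

/-! ### The rate of convergence -/

section Condition

open Matrix

variable {ι : Type*} [Fintype ι] [DecidableEq ι] [Nonempty ι] {A : Matrix ι ι ℝ}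

theorem one_le_opNorm_mul_opNorm_inv (hA : IsUnit A.det) : 1 ≤ opNorm A * opNorm A⁻¹ :=
  calc 1 = opNorm (1 : Matrix ι ι ℝ) := by rw [opNorm, map_one, norm_one]
    _ = opNorm (A * A⁻¹) := by rw [mul_nonsing_inv A hA]
    _ ≤ opNorm A * opNorm A⁻¹ := opNorm_mul_le A A⁻¹

theorem opNorm_pos_of_posDef (hA : A.PosDef) : 0 < opNorm A :=
  pos_of_mul_pos_left (one_pos.trans_le (one_le_opNorm_mul_opNorm_inv hA.det_pos.ne'.isUnit))
    (opNorm_nonneg _)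

theorem one_le_kappa (hA : A.PosDef) : 1 ≤ kappa A :=
  (one_le_opNorm_mul_opNorm_inv hA.det_pos.ne'.isUnit).trans (opNorm_mul_opNorm_inv_le_kappa hA)

theorem opNorm_inv_mul_opNorm_le_kappa_inv (hA : A.PosDef) :
    opNorm A⁻¹ * opNorm A ≤ kappa A⁻¹ := by
  have hle := opNorm_mul_opNorm_inv_le_kappa hA.inv
  rwa [nonsing_inv_nonsing_inv A hA.det_pos.ne'.isUnit] at hle

end Condition

section Rate

variable {L : ℕ} {d : Fin L → ℕ} {Psi : (k : Fin L) → Matrix (Fin (d k)) (Fin (d k)) ℝ}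

theorem log_pdim_le (hd : ∀ k, 1 ≤ d k) : Real.log (pdim d) ≤ L * dmax d := by
  rw [pdim]
  push_cast
  rw [Real.log_prod fun k _ => by have := hd k; positivity]
  refine (Finset.sum_le_card_nsmul Finset.univ _ (dmax d : ℝ) fun k _ => ?_).trans_eq (by simp)
  refine (Real.log_le_self (by positivity)).trans ?_
  exact_mod_cast le_dmax k

theorem mmin_mul_dmax_le_pdim (hL : 1 ≤ L) : mmin d * dmax d ≤ pdim d := by
  have : Nonempty (Fin L) := ⟨⟨0, hL⟩⟩
  obtain ⟨k, hk⟩ : ∃ k, d k = dmax d := exists_eq_ciSup_of_finite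
  rw [← mul_mdim k, ← hk, mul_comm]
  exact Nat.mul_le_mul_left _ (mmin_le k)

/-- The number of off-diagonal entries to be estimated, up to a logarithm, plus a bound on the
number of diagonal ones: the squared noise level divided by `‖Σ₀‖₂²`. -/
def effDim (Psi : (k : Fin L) → Matrix (Fin (d k)) (Fin (d k)) ℝ) : ℝ :=
  (∑ k, (offSupp (Psi k) : ℝ)) * Real.log (pdim d) + L * dmax d

theorem sum_offSupp_mul_log_le_effDim (Psi : (k : Fin L) → Matrix (Fin (d k)) (Fin (d k)) ℝ) :
    (∑ k, (offSupp (Psi k) : ℝ)) * Real.log (pdim d) ≤ effDim Psi :=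
  le_add_of_nonneg_right (by positivity)

theorem mul_dmax_le_effDim (Psi : (k : Fin L) → Matrix (Fin (d k)) (Fin (d k)) ℝ) :
    L * dmax d ≤ effDim Psi :=
  le_add_of_nonneg_left (mul_nonneg (by positivity) (Real.log_natCast_nonneg _))

theorem effDim_pos (hL : 1 ≤ L) (hd : ∀ k, 1 ≤ d k) : 0 < effDim Psi := by
  refine lt_of_lt_of_le ?_ (mul_dmax_le_effDim Psi)
  exact_mod_cast Nat.mul_pos hL ((hd ⟨0, hL⟩).trans (le_dmax _))

theorem effDim_le (hd : ∀ k, 1 ≤ d k) :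
    effDim Psi ≤ dmax d * ((∑ k, (offSupp (Psi k) : ℝ) * Real.log (pdim d) / d k) + L) := by
  rw [effDim, mul_add, mul_comm (dmax d : ℝ) (L : ℝ), Finset.sum_mul, Finset.mul_sum]
  refine add_le_add (Finset.sum_le_sum fun k _ => ?_) le_rfl
  have hdk : (0 : ℝ) < d k := by exact_mod_cast hd k
  rw [mul_div_assoc', le_div_iff₀ hdk, mul_comm]
  refine mul_le_mul_of_nonneg_right (by exact_mod_cast le_dmax k) ?_
  exact mul_nonneg (by positivity) (Real.log_natCast_nonneg _)

theorem mmin_mul_effDim_le (hL : 1 ≤ L) :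
    mmin d * effDim Psi
      ≤ (∑ k, (mdim d k : ℝ) * offSupp (Psi k)) * Real.log (pdim d) + L * pdim d := by
  have hpdim : (mmin d : ℝ) * dmax d ≤ pdim d := by exact_mod_cast mmin_mul_dmax_le_pdim hL
  rw [effDim, mul_add, ← mul_assoc, Finset.mul_sum, mul_left_comm]
  gcongr with k
  exact mmin_le k

variable {Sig0 : Matrix (Idx d) (Idx d) ℝ} {C : ℝ}

theorem A3.mono {c : ℝ} (h : A3 C Psi Sig0) (hc : 0 ≤ c) (hcC : c ≤ C) : A3 c Psi Sig0 := by
  refine le_trans ?_ h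
  gcongr

theorem A3.mul_effDim_le_mmin (h : A3 C Psi Sig0) (hL : 1 ≤ L) (hd : ∀ k, 1 ≤ d k) :
    C ^ 2 * (L + 1) * kappa Sig0 ^ 4 * effDim Psi ≤ mmin d := by
  have hm : (0 : ℝ) < mmin d := by exact_mod_cast mmin_pos hL hd
  refine le_of_mul_le_mul_left ?_ hm
  calc mmin d * (C ^ 2 * (L + 1) * kappa Sig0 ^ 4 * effDim Psi)
      = C ^ 2 * (L + 1) * kappa Sig0 ^ 4 * (mmin d * effDim Psi) := by ring
    _ ≤ (mmin d : ℝ) ^ 2 := le_trans (by gcongr; exact mmin_mul_effDim_le hL) h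
    _ = mmin d * mmin d := sq _

theorem A3.mul_dmax_le_mmin (h : A3 C Psi Sig0) (hL : 1 ≤ L) (hd : ∀ k, 1 ≤ d k)
    (hκ : 1 ≤ kappa Sig0) : C ^ 2 * ((L + 1) * (L * dmax d)) ≤ mmin d :=
  calc C ^ 2 * ((L + 1) * (L * dmax d)) = C ^ 2 * (L + 1) * 1 * (L * dmax d) := by ring
    _ ≤ C ^ 2 * (L + 1) * kappa Sig0 ^ 4 * effDim Psi := by
        gcongr
        · exact one_le_pow₀ hκ
        · exact mul_dmax_le_effDim Psi
    _ ≤ mmin d := h.mul_effDim_le_mmin hL hd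

theorem A3.mul_sqrt_le_one (h : A3 C Psi Sig0) (hL : 1 ≤ L) (hd : ∀ k, 1 ≤ d k) :
    C * kappa Sig0 ^ 2 * (√((L + 1) / mmin d) * √(effDim Psi)) ≤ 1 := by
  have hm : (0 : ℝ) < mmin d := by exact_mod_cast mmin_pos hL hd
  refine (abs_le_one_iff_mul_self_le_one.2 ?_ |> abs_le.1).2
  rw [← sq, mul_pow, mul_pow √_, Real.sq_sqrt (by positivity),
    Real.sq_sqrt (effDim_pos hL hd).le, div_mul_eq_mul_div, mul_div_assoc', div_le_one hm]
  exact le_of_eq_of_le (by ring) (h.mul_effDim_le_mmin hL hd)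

theorem mdim_mul_sq_le (hd : ∀ k, 1 ≤ d k) {k : Fin L} {ρ b σ : ℝ} (hρ_nonneg : 0 ≤ ρ)
    (hρ : ρ ≤ b * (σ * √(Real.log (pdim d) / mdim d k))) :
    mdim d k * ρ ^ 2 ≤ (b * σ * √(Real.log (pdim d))) ^ 2 := by
  have hm : (0 : ℝ) < mdim d k := by exact_mod_cast mdim_pos hd k
  have hlog : 0 ≤ Real.log (pdim d) := Real.log_natCast_nonneg _
  calc mdim d k * ρ ^ 2 ≤ mdim d k * (b * (σ * √(Real.log (pdim d) / mdim d k))) ^ 2 := by gcongr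
    _ = (b * σ * √(Real.log (pdim d))) ^ 2 := by
      rw [← mul_assoc b, mul_pow (b * σ), mul_pow (b * σ), Real.sq_sqrt (by positivity),
        Real.sq_sqrt hlog]
      field_simp

theorem noise_le_sqrt_effDim (Psi : (k : Fin L) → Matrix (Fin (d k)) (Fin (d k)) ℝ) {b σ T : ℝ}
    (hb : 0 ≤ b) (hσ : 0 ≤ σ) (hT : 0 ≤ T) :
    2 * (b * σ * √(Real.log (pdim d))) * √(∑ k, (offSupp (Psi k) : ℝ)) + T * σ * √(L * dmax d)
      ≤ (2 * b + T) * σ * √(effDim Psi) := by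
  have hoff : √(∑ k, (offSupp (Psi k) : ℝ)) * √(Real.log (pdim d)) ≤ √(effDim Psi) := by
    rw [← Real.sqrt_mul (by positivity)]
    exact Real.sqrt_le_sqrt (sum_offSupp_mul_log_le_effDim Psi)
  have hdiag : √(L * dmax d) ≤ √(effDim Psi) := Real.sqrt_le_sqrt (mul_dmax_le_effDim Psi)
  calc _ = 2 * (b * σ) * (√(∑ k, (offSupp (Psi k) : ℝ)) * √(Real.log (pdim d)))
        + T * σ * √(L * dmax d) := by ring
    _ ≤ 2 * (b * σ) * √(effDim Psi) + T * σ * √(effDim Psi) := by gcongr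
    _ = _ := by ring

theorem sqrt_mul_sqrt_effDim_le (hL : 1 ≤ L) (hd : ∀ k, 1 ≤ d k) :
    √((L + 1) / mmin d) * √(effDim Psi) ≤ 2 * (√(L * dmax d / mmin d) *
      √((∑ k, (offSupp (Psi k) : ℝ) * Real.log (pdim d) / d k) + L)) := by
  have hm : (0 : ℝ) < mmin d := by exact_mod_cast mmin_pos hL hd
  have hL' : (1 : ℝ) ≤ L := by exact_mod_cast hL
  rw [← Real.sqrt_mul (by positivity), ← Real.sqrt_mul (by positivity),
    ← Real.sqrt_sq zero_le_two, ← Real.sqrt_mul (by positivity)]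
  refine Real.sqrt_le_sqrt ?_
  rw [div_mul_eq_mul_div, div_mul_eq_mul_div, mul_div_assoc']
  gcongr ?_ / _
  calc ((L : ℝ) + 1) * effDim Psi ≤ (2 ^ 2 * L) * (dmax d *
        ((∑ k, (offSupp (Psi k) : ℝ) * Real.log (pdim d) / d k) + L)) :=
        mul_le_mul (by linarith) (effDim_le hd) (effDim_pos hL hd).le (by positivity)
    _ = _ := by ring

/-- A Frobenius radius beyond which the curvature of `-log det` at `kronSum Psi` outweighs noise of
size `Λ * ‖Σ₀‖₂ * √(effDim Psi)`. -/
def errorRadius (Psi : (k : Fin L) → Matrix (Fin (d k)) (Fin (d k)) ℝ) (Λ : ℝ) : ℝ :=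
  5 * Λ * opNorm (kronSum Psi) ^ 2 * opNorm (kronSum Psi)⁻¹ * √(effDim Psi)

theorem opNorm_inv_mul_errorRadius_le (hL : 1 ≤ L) (hd : ∀ k, 1 ≤ d k) {Λ : ℝ} (hΛ : 0 ≤ Λ)
    (hPsi : (kronSum Psi).PosDef) (h : A3 (10 * Λ) Psi (kronSum Psi)⁻¹) :
    opNorm (kronSum Psi)⁻¹ * (√((L + 1) / mmin d) * errorRadius Psi Λ) ≤ 1 / 2 := by
  have : Nonempty (Idx d) := ⟨fun k => ⟨0, hd k⟩⟩
  have hκ := opNorm_inv_mul_opNorm_le_kappa_inv hPsi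
  have hsmall := h.mul_sqrt_le_one hL hd
  have hσ := opNorm_nonneg (kronSum Psi)⁻¹
  have hw := opNorm_nonneg (kronSum Psi)
  calc opNorm (kronSum Psi)⁻¹ * (√((L + 1) / mmin d) * errorRadius Psi Λ)
      = 5 * Λ * (opNorm (kronSum Psi)⁻¹ * opNorm (kronSum Psi)) ^ 2
        * (√((L + 1) / mmin d) * √(effDim Psi)) := by rw [errorRadius]; ring
    _ ≤ 5 * Λ * kappa (kronSum Psi)⁻¹ ^ 2 * (√((L + 1) / mmin d) * √(effDim Psi)) := by gcongr
    _ ≤ 1 / 2 := by linarith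

theorem sqrt_mul_errorRadius_div_le (hL : 1 ≤ L) (hd : ∀ k, 1 ≤ d k) {Λ : ℝ} (hΛ : 0 ≤ Λ)
    (hPsi : (kronSum Psi).PosDef) :
    √((L + 1) / mmin d) * errorRadius Psi Λ / opNorm (kronSum Psi)
      ≤ 10 * Λ * kappa (kronSum Psi)⁻¹ * √(L * dmax d / mmin d) *
          √((∑ k, (offSupp (Psi k) : ℝ) * Real.log (pdim d) / d k) + L) := by
  have : Nonempty (Idx d) := ⟨fun k => ⟨0, hd k⟩⟩
  have hw := opNorm_pos_of_posDef hPsi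
  have hσ := opNorm_nonneg (kronSum Psi)⁻¹
  have hκ := opNorm_inv_mul_opNorm_le_kappa_inv hPsi
  calc √((L + 1) / mmin d) * errorRadius Psi Λ / opNorm (kronSum Psi)
      = 5 * Λ * (opNorm (kronSum Psi)⁻¹ * opNorm (kronSum Psi))
        * (√((L + 1) / mmin d) * √(effDim Psi)) := by rw [errorRadius]; field_simp
    _ ≤ 5 * Λ * kappa (kronSum Psi)⁻¹ * (2 * (√(L * dmax d / mmin d) *
          √((∑ k, (offSupp (Psi k) : ℝ) * Real.log (pdim d) / d k) + L))) :=
        mul_le_mul (mul_le_mul_of_nonneg_left hκ (by positivity)) (sqrt_mul_sqrt_effDim_le hL hd)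
          (by positivity) (mul_nonneg (by positivity) ((mul_nonneg hσ hw.le).trans hκ))
    _ = _ := by ring

theorem max_ratio_le (hL : 1 ≤ L) (hd : ∀ k, 1 ≤ d k) (hPsi : 0 < opNorm (kronSum Psi))
    {D : (k : Fin L) → Matrix (Fin (d k)) (Fin (d k)) ℝ} {r : ℝ}
    (hD : frobNorm (kronSum D) ≤ r) :
    max (opNorm (kronSum D) / opNorm (kronSum Psi)) (frobNorm (kronSum D) / frobNorm (kronSum Psi))
      ≤ √((L + 1) / mmin d) * r / opNorm (kronSum Psi) := by
  have hfrob : 0 < frobNorm (kronSum Psi) := hPsi.trans_le (opNorm_le_frobNorm _)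
  refine max_le ?_ ?_
  · gcongr
    exact (opNorm_kronSum_le hL hd D).trans (by gcongr)
  · rw [div_le_div_iff₀ hfrob hPsi]
    calc frobNorm (kronSum D) * opNorm (kronSum Psi)
        ≤ r * (√((L + 1) / mmin d) * frobNorm (kronSum Psi)) :=
          mul_le_mul hD (opNorm_kronSum_le hL hd Psi) hPsi.le ((frobNorm_nonneg _).trans hD)
      _ = √((L + 1) / mmin d) * r * frobNorm (kronSum Psi) := by ring

theorem DeviationBound.objective_lt {x : Idx d → ℝ} {ρ : Fin L → ℝ} {b T : ℝ}
    (h : DeviationBound x (kronSum Psi)⁻¹ (fun k => mdim d k * ρ k)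
      (T * opNorm (kronSum Psi)⁻¹ * √(L * dmax d)))
    (hL : 1 ≤ L) (hd : ∀ k, 1 ≤ d k) (hPsi : (kronSum Psi).PosDef) (hb : 0 ≤ b) (hT : 0 < T)
    (hρ_nonneg : ∀ k, 0 ≤ ρ k)
    (hρ : ∀ k, ρ k ≤ b * (opNorm (kronSum Psi)⁻¹ * √(Real.log (pdim d) / mdim d k)))
    (hA3 : A3 (10 * (2 * b + T)) Psi (kronSum Psi)⁻¹)
    (D : (k : Fin L) → Matrix (Fin (d k)) (Fin (d k)) ℝ) (hD : (kronSum Psi + kronSum D).PosDef)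
    (hgt : errorRadius Psi (2 * b + T) < frobNorm (kronSum D)) :
    objective x ρ Psi < objective x ρ fun k => Psi k + D k := by
  have : Nonempty (Idx d) := ⟨fun k => ⟨0, hd k⟩⟩
  have hσ := opNorm_pos_of_posDef hPsi.inv
  have hw := opNorm_pos_of_posDef hPsi
  have hQ := Real.sqrt_pos.2 (effDim_pos (Psi := Psi) hL hd)
  have hr : 0 < errorRadius Psi (2 * b + T) := by unfold errorRadius; positivity
  refine objective_lt_of_frobNorm_gt hL hd hPsi hr
    (h.neg_le_deviation_add_penalty hρ_nonneg (by positivity)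
      (fun k => mdim_mul_sq_le hd (hρ_nonneg k) (hρ k)) (by positivity) Psi) ?_
    ((opNorm_inv_mul_errorRadius_le hL hd (by positivity) hPsi hA3).trans (by norm_num)) hD hgt
  calc _ ≤ 4 * opNorm (kronSum Psi) ^ 2
        * ((2 * b + T) * opNorm (kronSum Psi)⁻¹ * √(effDim Psi)) := by
        gcongr
        exact noise_le_sqrt_effDim Psi hb hσ.le hT.le
    _ = 4 / 5 * errorRadius Psi (2 * b + T) := by rw [errorRadius]; ring
    _ < errorRadius Psi (2 * b + T) := by linarith

theorem DeviationBound.exists_isTeraLasso_and_rate {x : Idx d → ℝ} {ρ : Fin L → ℝ} {b T : ℝ}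
    (h : DeviationBound x (kronSum Psi)⁻¹ (fun k => mdim d k * ρ k)
      (T * opNorm (kronSum Psi)⁻¹ * √(L * dmax d)))
    (hL : 1 ≤ L) (hd : ∀ k, 1 ≤ d k) (hPsi : (kronSum Psi).PosDef) (hb : 0 ≤ b) (hT : 0 < T)
    (hρ_nonneg : ∀ k, 0 ≤ ρ k)
    (hρ : ∀ k, ρ k ≤ b * (opNorm (kronSum Psi)⁻¹ * √(Real.log (pdim d) / mdim d k)))
    (hA3 : A3 (10 * (2 * b + T)) Psi (kronSum Psi)⁻¹) :
    (∃ Ωhat, IsTeraLasso x ρ Ωhat) ∧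
      ∀ Ωhat, IsTeraLasso x ρ Ωhat →
        max (opNorm (Ωhat - kronSum Psi) / opNorm (kronSum Psi))
            (frobNorm (Ωhat - kronSum Psi) / frobNorm (kronSum Psi)) ≤
          10 * (2 * b + T) * kappa (kronSum Psi)⁻¹ * √(L * dmax d / mmin d) *
            √((∑ k, (offSupp (Psi k) : ℝ) * Real.log (pdim d) / d k) + L) := by
  have : Nonempty (Idx d) := ⟨fun k => ⟨0, hd k⟩⟩
  have hσ := opNorm_nonneg (kronSum Psi)⁻¹
  have hr : 0 ≤ errorRadius Psi (2 * b + T) := by unfold errorRadius; positivity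
  have hball := h.objective_lt hL hd hPsi hb hT hρ_nonneg hρ hA3
  refine ⟨exists_isTeraLasso hL hd hPsi hr
    ((opNorm_inv_mul_errorRadius_le hL hd (by positivity) hPsi hA3).trans_lt (by norm_num)) hball,
    fun Ωhat hΩ => ?_⟩
  obtain ⟨D, hD, hDr⟩ := hΩ.exists_sub_eq_kronSum hPsi hball
  rw [hD]
  exact (max_ratio_le hL hd (opNorm_pos_of_posDef hPsi) hDr).trans
    (sqrt_mul_errorRadius_div_le hL hd (by positivity) hPsi)

end Rate

/-! ### The deviation bounds hold with high probability -/

section HighProbability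

open Matrix

variable {L : ℕ} {d : Fin L → ℕ} {S : Type*} [MeasurableSpace S] {μ : Measure S}
  [IsProbabilityMeasure μ] {t : ℝ} {Z : Idx d → S → ℝ} {R Sig0 : Matrix (Idx d) (Idx d) ℝ}

theorem natCast_le_eexp_log_pdim (hd : ∀ k, 1 ≤ d k) (k : Fin L) :
    (d k : ENNReal) ≤ eexp (Real.log (pdim d)) := by
  rw [eexp_log_natCast (pdim_pos hd), ← mul_mdim k]
  exact_mod_cast Nat.le_mul_of_pos_right _ (mdim_pos hd k)

theorem SubgaussianFamily.measure_exists_deviation_single_ge_le (h : SubgaussianFamily μ t Z)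
    (hd : ∀ k, 1 ≤ d k) (hR : R * Rᵀ = Sig0) (hσ : 0 < opNorm Sig0)
    (hlog : Real.log (pdim d) ≤ mmin d) :
    μ {ω | ∃ k a b, mdim d k * (192 * t ^ 2 * (opNorm Sig0 * √(Real.log (pdim d) / mdim d k)))
        ≤ |deviation (R *ᵥ fun i => Z i ω) Sig0 (modeEmbed k (Matrix.single a b 1))|}
      ≤ L * (2 * eexp (-3 * Real.log (pdim d))) := by
  simp only [Set.ofPred_exists]
  have hmode : ∀ k : Fin L, μ (⋃ a : Fin (d k), ⋃ b : Fin (d k),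
      {ω | mdim d k * (192 * t ^ 2 * (opNorm Sig0 * √(Real.log (pdim d) / mdim d k)))
        ≤ |deviation (R *ᵥ fun i => Z i ω) Sig0 (modeEmbed k (Matrix.single a b 1))|})
      ≤ 2 * eexp (-3 * Real.log (pdim d)) := fun k =>
    calc _ ≤ ∑ _a : Fin (d k), ∑ _b : Fin (d k), 2 * eexp (-5 * Real.log (pdim d)) :=
          (measure_iUnion_fintype_le _ _).trans <| Finset.sum_le_sum fun a _ =>
            (measure_iUnion_fintype_le _ _).trans <| Finset.sum_le_sum fun b _ =>
              h.measure_deviation_single_ge_le hd hR hσ k (Real.log_natCast_nonneg _)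
                (hlog.trans (by exact_mod_cast mmin_le k)) a b
      _ = d k * (d k * (2 * eexp (-5 * Real.log (pdim d)))) := by simp
      _ ≤ eexp (Real.log (pdim d)) *
            (eexp (Real.log (pdim d)) * (2 * eexp (-5 * Real.log (pdim d)))) := by
          gcongr <;> exact natCast_le_eexp_log_pdim hd k
      _ = 2 * (eexp (Real.log (pdim d)) * eexp (Real.log (pdim d)) *
            eexp (-5 * Real.log (pdim d))) := by ring
      _ = 2 * eexp (-3 * Real.log (pdim d)) := by
          rw [← eexp_add, ← eexp_add]
          congr 2
          ring
  exact ((measure_iUnion_fintype_le _ _).trans (Finset.sum_le_sum fun k _ => hmode k)).trans_eq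
    (by simp)

theorem mul_two_mul_eexp_add_eexp_le (hL : 1 ≤ L) {x : ℝ} (hx : Real.log 2 ≤ x) :
    L * (2 * eexp (-3 * x)) + eexp (-3 * x) ≤ ENNReal.ofReal (L * Real.exp (-x)) := by
  have hL' : (1 : ℝ) ≤ L := by exact_mod_cast hL
  have hcube : Real.exp (-3 * x) = Real.exp (-x) ^ 3 := by
    rw [← Real.exp_nat_mul]
    push_cast
    ring_nf
  have hhalf : Real.exp (-x) ≤ 1 / 2 :=
    calc Real.exp (-x) ≤ Real.exp (-Real.log 2) := Real.exp_le_exp.2 (neg_le_neg hx)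
      _ = 1 / 2 := by rw [Real.exp_neg, Real.exp_log two_pos, one_div]
  rw [eexp, hcube, ← ENNReal.ofReal_natCast L, ← ENNReal.ofReal_ofNat 2,
    ← ENNReal.ofReal_mul zero_le_two, ← ENNReal.ofReal_mul (by positivity),
    ← ENNReal.ofReal_add (by positivity) (by positivity)]
  refine ENNReal.ofReal_le_ofReal ?_
  calc L * (2 * Real.exp (-x) ^ 3) + Real.exp (-x) ^ 3
      ≤ L * (2 * Real.exp (-x) ^ 3) + L * Real.exp (-x) ^ 3 := by
        gcongr
        exact le_mul_of_one_le_left (by positivity) hL'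
    _ = 3 * (L * Real.exp (-x)) * Real.exp (-x) ^ 2 := by ring
    _ ≤ 3 * (L * Real.exp (-x)) * (1 / 2) ^ 2 := by gcongr
    _ ≤ L * Real.exp (-x) := by
        linarith [mul_nonneg (Nat.cast_nonneg (α := ℝ) L) (Real.exp_pos (-x)).le]

theorem SubgaussianFamily.measure_not_deviationBound_le (h : SubgaussianFamily μ t Z)
    (hL : 1 ≤ L) (hd : ∀ k, 1 ≤ d k) (hR : R * Rᵀ = Sig0) (hσ : 0 < opNorm Sig0)
    (hlog : Real.log (pdim d) ≤ mmin d)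
    (hm : (32 * t ^ 2) ^ 2 * ((L + 1) * (L * dmax d)) ≤ mmin d) {w : Fin L → ℝ}
    (hw : ∀ k, mdim d k * (192 * t ^ 2 * (opNorm Sig0 * √(Real.log (pdim d) / mdim d k))) ≤ w k) :
    μ {ω | ¬ DeviationBound (R *ᵥ fun i => Z i ω) Sig0 w
        (4 * (5 + 256 * t ^ 4) * opNorm Sig0 * √(L * dmax d))}
      ≤ ENNReal.ofReal (L * Real.exp (-Real.log (pdim d))) := by
  rcases Nat.lt_or_ge (pdim d) 2 with hp | hp
  · have hone : pdim d = 1 := by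
      have := pdim_pos hd
      omega
    refine prob_le_one.trans ?_
    rw [hone, Nat.cast_one, Real.log_one, neg_zero, Real.exp_zero, mul_one, ENNReal.ofReal_natCast]
    exact_mod_cast hL
  refine le_trans ?_ (mul_two_mul_eexp_add_eexp_le hL (Real.log_le_log two_pos
    (by exact_mod_cast hp)))
  have hdiag := (h.measure_deviation_diagPart_gt_le hL hd hR hσ hm).trans
    (eexp_mono (show _ ≤ -3 * Real.log (pdim d) by linarith [log_pdim_le hd]))
  refine (measure_mono fun ω hω => ?_).trans ((measure_union_le _ _).trans
    (add_le_add (h.measure_exists_deviation_single_ge_le hd hR hσ hlog) hdiag))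
  by_contra! hgood
  rw [Set.mem_union, not_or] at hgood
  exact hω
    { off := fun k a b _ => le_trans (le_of_not_ge fun hge => hgood.1 ⟨k, a, b, hge⟩) (hw k)
      diag := fun D => le_of_not_gt fun hgt => hgood.2 ⟨D, hgt⟩ }

open scoped MatrixOrder in
theorem IsSubgaussianTensor.measure_not_deviationBound_le {K : ℝ} {X : S → Idx d → ℝ}
    (h : IsSubgaussianTensor μ K Sig0 X) (hK : 0 < K) (hL : 1 ≤ L) (hd : ∀ k, 1 ≤ d k)
    (hSig : Sig0.PosDef) (hlog : Real.log (pdim d) ≤ mmin d)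
    (hm : (32 * (2 * K) ^ 2) ^ 2 * ((L + 1) * (L * dmax d)) ≤ mmin d) {w : Fin L → ℝ}
    (hw : ∀ k, mdim d k *
      (192 * (2 * K) ^ 2 * (opNorm Sig0 * √(Real.log (pdim d) / mdim d k))) ≤ w k) :
    μ {ω | ¬ DeviationBound (X ω) Sig0 w
        (4 * (5 + 256 * (2 * K) ^ 4) * opNorm Sig0 * √(L * dmax d))}
      ≤ ENNReal.ofReal (L * Real.exp (-Real.log (pdim d))) := by
  have : Nonempty (Idx d) := ⟨fun k => ⟨0, hd k⟩⟩
  obtain ⟨Z, hmeas, hindep, hmean, hvar, hpsi, hX⟩ := h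
  have hZ : SubgaussianFamily μ (2 * K) Z :=
    { measurable := hmeas
      indep := hindep
      mean := hmean
      variance := hvar
      tail := fun i => lintegral_eexp_le_two_of_psi2Norm_lt
        ((hpsi i).trans_lt ((ENNReal.ofReal_lt_ofReal_iff (by positivity)).2 (by linarith)))
      pos := by positivity }
  have hR : CFC.sqrt Sig0 * (CFC.sqrt Sig0)ᵀ = Sig0 := by
    rw [isSymm_sqrt Sig0, sqrt_mul_sqrt_self hSig.posSemidef]
  refine le_of_eq_of_le (measure_congr ?_) (hZ.measure_not_deviationBound_le hL hd hR
    (opNorm_pos_of_posDef hSig) hlog hm hw)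
  filter_upwards [hX] with ω hω
  exact congrArg (fun x => ¬ DeviationBound x Sig0 w _) hω

theorem A1.penalty_bounds {a₁ a₂ ε₀ : ℝ} {ρ : Fin L → ℝ} (h : A1 a₁ a₂ ε₀ Sig0 ρ)
    (ha₁ : 0 ≤ a₁) (hε₀ : 0 < ε₀) (k : Fin L) :
    a₁ * (opNorm Sig0 * √(Real.log (pdim d) / mdim d k)) ≤ ρ k ∧
      ρ k ≤ a₂ / ε₀ * (opNorm Sig0 * √(Real.log (pdim d) / mdim d k)) := by
  obtain ⟨-, δ, ε, hδε⟩ := h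
  obtain ⟨hδ_ge, hδ_le, hε_pos, hε_lt, hε_ge, hρ⟩ := hδε k
  have hδ : 0 ≤ δ k :=
    le_trans (mul_nonneg ha₁ (mul_nonneg (opNorm_nonneg _) (Real.sqrt_nonneg _))) hδ_ge
  rw [hρ, div_mul_eq_mul_div]
  exact ⟨hδ_ge.trans (le_div_self hδ hε_pos hε_lt.le),
    div_le_div₀ (hδ.trans hδ_le) hδ_le hε₀ hε_ge⟩

end HighProbability

end TeraLasso

end

open TeraLasso in
/-- `a₁`, `c` depend only on the bound `K` on the `ψ₂` norms; `C₃`, `C` depend only on `K`, on the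
upper constant `a₂` in the choice of the penalties and on the lower bound `ε₀` of the `ε k`.
The exceptional set need not be measurable: `μ` of it is the outer measure. -/
theorem mainTheorem3 (K : ℝ) (hK : 0 < K) :
    ∃ a₁ c : ℝ, 0 < a₁ ∧ 0 < c ∧
      ∀ a₂ ε₀ : ℝ, a₁ ≤ a₂ → 0 < ε₀ → ε₀ < 1 →
        ∃ C₃ C : ℝ, 0 < C₃ ∧ 0 < C ∧
          ∀ (L : ℕ) (d : Fin L → ℕ) (Psi : (k : Fin L) → Matrix (Fin (d k)) (Fin (d k)) ℝ)
            (Omega0 Sig0 : Matrix (Idx d) (Idx d) ℝ) (ρ : Fin L → ℝ) (kLow kUp : ℝ)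
            (S : Type*) [MeasurableSpace S] (μ : Measure S) [IsProbabilityMeasure μ]
            (X : S → Idx d → ℝ),
            1 ≤ L → (∀ k, 1 ≤ d k) →
            (∀ k, (Psi k).IsSymm) → Omega0 = kronSum Psi → Sig0 = Omega0⁻¹ →
            IsSubgaussianTensor μ K Sig0 X →
            A1 a₁ a₂ ε₀ Sig0 ρ → A2 kLow kUp Omega0 → A3 C₃ Psi Sig0 →
            μ {ω | ¬ ((∃ Ωhat, IsTeraLasso (X ω) ρ Ωhat) ∧
                ∀ Ωhat, IsTeraLasso (X ω) ρ Ωhat →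
                  max (opNorm (Ωhat - Omega0) / opNorm Omega0)
                      (frobNorm (Ωhat - Omega0) / frobNorm Omega0) ≤
                    C * kappa Sig0 * √(L * dmax d / mmin d) *
                      √((∑ k, (offSupp (Psi k) : ℝ) * Real.log (pdim d) / d k) + L))}
              ≤ ENNReal.ofReal (L * Real.exp (-c * Real.log (pdim d))) := by
  refine ⟨192 * (2 * K) ^ 2, 1, by positivity, one_pos, fun a₂ ε₀ ha₂ hε₀ _ => ?_⟩
  have hb : 0 < a₂ / ε₀ := div_pos (lt_of_lt_of_le (by positivity) ha₂) hε₀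
  set b := a₂ / ε₀
  set T := 4 * (5 + 256 * (2 * K) ^ 4)
  have hT : 0 < T := by positivity
  refine ⟨10 * (2 * b + T) + 32 * (2 * K) ^ 2, 10 * (2 * b + T), by positivity, by positivity, ?_⟩
  rintro L d Psi _ _ ρ kLow kUp S _ μ _ X hL hd hPsi rfl rfl hX hA1 hA2 hA3
  have : Nonempty (Idx d) := ⟨fun k => ⟨0, hd k⟩⟩
  have hΩ : (kronSum Psi).PosDef := posDef_of_phiMin_pos
    (isHermitian_iff_isSymm.2 (kronSum_isSymm hPsi)) (hA2.1.trans_le hA2.2.1)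
  have hρ := hA1.penalty_bounds (by positivity) hε₀
  have hρ_nonneg k : 0 ≤ ρ k :=
    le_trans (mul_nonneg (by positivity) (mul_nonneg (opNorm_nonneg _) (Real.sqrt_nonneg _)))
      (hρ k).1
  have hm := (hA3.mono (c := 32 * (2 * K) ^ 2) (by positivity) (le_add_of_nonneg_left
    (by positivity))).mul_dmax_le_mmin hL hd (one_le_kappa hΩ.inv)
  rw [neg_one_mul]
  refine (measure_mono fun ω => mt fun hdev => ?_).trans (hX.measure_not_deviationBound_le hK hL hd
    hΩ.inv hA1.1 hm fun k => mul_le_mul_of_nonneg_left (hρ k).1 (Nat.cast_nonneg _))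
  exact hdev.exists_isTeraLasso_and_rate hL hd hΩ hb.le hT hρ_nonneg (fun k => (hρ k).2)
    (hA3.mono (by positivity) (le_add_of_nonneg_right (by positivity)))
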